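/- **Setting.** Let $x(t)\in\mathbb R^M$ be a zero-mean, finite-variance, jointly wide-sense stationary process with measurable, integrable matrix power spectral density $C_x(f)\succeq 0$, i.e. $\mathbb E[x(t+\tau)x(t)^T]=\int C_x(f)e^{j2\pi f\tau}\,df$. It is bandlimited: for some $\Upsilon\in\{0,1,2,\dots\}$, $C_x(f)=0$ whenever $|f|>(\Upsilon+\tfrac12)f_s$. Let $s\in\mathbb R^N$ be a zero-mean random vector with finite variance whose MMSE estimate is linear, $\tilde s:=\mathbb E[s\mid\{x(t)\}_{t\in\mathbb R}]=(\Gamma*x)(0)$, for a filter $\Gamma$ with real impulse response and frequency response $\Gamma(f)\in\mathbb C^{N\times M}$. Assume $\mathbb E\|\tilde s\|^2>0$. Fix the number of ADCs $K\ge1$, the sampling rate $f_s>0$ (with $T_s=1/f_s$), the resolution $b$, and $\eta>0$ with $2\eta^2<3\cdot2^{2b}$. An acquisition system is given as follows. - *Analog filter:* a filter $H$ with real impulse response, frequency response $H(f)\in\mathbb C^{K\times M}$ and finite output power. The samples are $y[n]=T_s\,(H*x)(nT_s)\in\mathbb R^K$. - *Dithered quantizers:* $z_k[n]=\Delta\big(\lfloor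 (y_k[n]+w_k[n])/\Delta\rfloor+\tfrac12\big)$, the $b$-bit mid-rise quantizer operating without overload, with $\Delta=2\gamma/2^b$ and dynamic range $\gamma>0$ determined by $\gamma^2=\eta^2\max_k\mathbb E[(y_k[n]+w_k[n])^2]$. The dither $w_k[n]$ is i.i.d. over $k$ and $n$, has density $\frac1\Delta(1-|w|/\Delta)^+$, and is independent of $(x,s)$; the probability space is assumed to carry such a dither for every $\Delta>0$. - *Linear digital filter:* $\hat s=\sum_n G[-n]z[n]$ with real square-summable $G[n]\in\mathbb R^{N\times K}$. Filter outputs are understood in the mean-square sense: $(H*x)(t)$ is the mean-square limit of outputs of tapped delay lines with real coefficients whose frequency responses converge to $H$ in $L^2(C_x\,df)$, and $\hat s$ is the mean-square limit of outputs of finite impulse response filters whose impulse responses converge to $G$ in $\ell^2$. Put $\bar M=(2\Upsilon+1)M$ and, for a filter $A\in\{\Gamma,H\}$ and $f\in[-\frac{f_s}2,\frac{f_s}2]$, $$\bar A(f)=\big[A(f-kf_s)\,C_x^{1/2}(f-kf_s)\big]_{k=-\Upsilon,\dots,\Upsilon}.$$ Let $\sigma_1(f)\ge\sigma_2(f)\ge\cdots$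 be the singular values of $\bar\Gamma(f)$ (zero beyond its size), and let $\bar\kappa=\eta^2\big(1-\frac{2\eta^2}{3\cdot2^{2b}}\big)^{-1}$. **Theorem.** 1. There is exactly one $\zeta\in\mathbb R$ such that, with $\Sigma_i(f)=2^{-b}\sqrt{(\zeta\sigma_i(f)-1)^+}$, $$\frac{\bar\kappa T_s}{K}\int_{-f_s/2}^{f_s/2}\sum_{i=1}^{\min(K,\bar M)}\Sigma_i(f)^2\,df=1 .$$ 2. With this $\zeta$, there exist analog filters $H^{\rm o}$ with real impulse response such that, for almost every $f\in[-\frac{f_s}2,\frac{f_s}2]$, $$\bar H^{\rm o}(f)=\bar U_H(f)\,\bar\Sigma_H(f)\,\bar V_H^H(f).$$ Here $\bar V_H(f)\in\mathbb C^{\bar M\times\bar M}$ is a unitary matrix of right-singular vectors of $\bar\Gamma(f)$ in descending order of the singular values, $\bar\Sigma_H(f)\in\mathbb R^{K\times\bar M}$ is diagonal with entries $\Sigma_i(f)$, and $\bar U_H(f)\in\mathbb C^{K\times K}$ is a unitary matrix for which $\bar U_H\bar\Sigma_H\bar\Sigma_H^H\bar U_H^H$ has identical diagonal entries. 3. Every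 such $H^{\rm o}$ is an admissible analog filter and minimizes the mean-squared error. More precisely, with $H^{\rm o}$ the minimum of $\mathbb E\|\tilde s-\hat s\|^2$ over linear digital filters is attained and equals $$D^{\rm o}=\mathbb E\|\tilde s\|^2-\int_{-f_s/2}^{f_s/2}\sum_{i=1}^{\min(K,\bar M)}\frac{\sigma_i(f)^2\,\Sigma_i(f)^2}{\Sigma_i(f)^2+2^{-2b}}\,df ,$$ and no acquisition system, with any analog filter and any linear digital filter, has $\mathbb E\|\tilde s-\hat s\|^2<D^{\rm o}$. Likewise, the minimum of $\mathbb E\|s-\hat s\|^2$ over all acquisition systems is $\mathbb E\|s-\tilde s\|^2+D^{\rm o}$, and it is attained with $H^{\rm o}$. -/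

import Mathlib

open MeasureTheory ProbabilityTheory Filter Topology
open scoped MatrixOrder ComplexOrder

namespace TaskADC

noncomputable section

/-! ### Random signals and linear filtering -/

/-- Real-valued vector processes on `Ω` indexed by `T`. -/
abbrev Proc (T Ω : Type*) (n : ℕ) := T → Ω → Fin n → ℝ

/-- `x` is a zero-mean, finite-variance, jointly wide-sense stationary real vector process with
matrix power spectral density `Cx`, that is
`E[x_m(t + τ) x_l(t)] = ∫ (Cx f)_{m,l} e^{2 π i f τ} df` for all `t` and `τ`. -/
structure IsWSS {Ω : Type*} [MeasurableSpace Ω] (P : Measure Ω) {M : ℕ}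
    (x : Proc ℝ Ω M) (Cx : ℝ → Matrix (Fin M) (Fin M) ℂ) : Prop where
  measurable : ∀ t, Measurable (x t)
  memLp : ∀ t m, MemLp (fun ω => x t ω m) 2 P
  mean_zero : ∀ t m, ∫ ω, x t ω m ∂P = 0
  psd_measurable : ∀ m l, Measurable fun f => Cx f m l
  psd_posSemidef : ∀ f, (Cx f).PosSemidef
  psd_integrable : ∀ m l, Integrable fun f => Cx f m l
  correlation : ∀ t τ m l,
    ((∫ ω, x (t + τ) ω m * x t ω l ∂P : ℝ) : ℂ)
      = ∫ f : ℝ, Complex.exp (2 * Real.pi * Complex.I * f * τ) * Cx f m l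

/-- A frequency response belonging to a filter with real impulse response. -/
structure IsFreqResponse {p M : ℕ} (H : ℝ → Matrix (Fin p) (Fin M) ℂ) : Prop where
  measurable : ∀ i m, Measurable fun f => H f i m
  conj_symm : ∀ᵐ f : ℝ, ∀ i m, H (-f) i m = star (H f i m)

/-- A tapped delay line: finitely many delays, each with a real gain matrix. -/
abbrev Taps (p M : ℕ) := ℝ →₀ Matrix (Fin p) (Fin M) ℝ

/-- Frequency response `∑ A_τ e^{-2 π i f τ}` of a tapped delay line. -/
def Taps.freq {p M : ℕ} (A : Taps p M) (f : ℝ) : Matrix (Fin p) (Fin M) ℂ :=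
  ∑ τ ∈ A.support,
    Complex.exp (-(2 * Real.pi * Complex.I * f * τ)) • (A τ).map (fun r : ℝ => (r : ℂ))

/-- Output `∑ A_τ x(t - τ)` of a tapped delay line at time `t`. -/
def Taps.out {p M : ℕ} {Ω : Type*} (A : Taps p M) (x : Proc ℝ Ω M) (t : ℝ) (ω : Ω) :
    Fin p → ℝ :=
  ∑ τ ∈ A.support, (A τ).mulVec (x (t - τ) ω)

/-- Mean power `∫ tr (H Cx Hᴴ) df` of the output of the filter `H` driven by a process with
power spectral density `Cx`. -/
def filterPower {p M : ℕ} (Cx : ℝ → Matrix (Fin M) (Fin M) ℂ)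
    (H : ℝ → Matrix (Fin p) (Fin M) ℂ) : ENNReal :=
  ∫⁻ f, ENNReal.ofReal ((H f * Cx f * (H f).conjTranspose).trace.re)

/-- `Y` is the value at time `t` of the output of the linear time-invariant filter with frequency
response `H` driven by `x`, i.e. `Y = (h * x)(t) = ∫ h(τ) x(t - τ) dτ` in the mean-square sense: the
mean-square limit of the outputs of tapped delay lines whose frequency responses tend to `H`
in `L²(Cx df)`. -/
def IsFilterOutput {Ω : Type*} [MeasurableSpace Ω] (P : Measure Ω) {p M : ℕ}
    (x : Proc ℝ Ω M) (Cx : ℝ → Matrix (Fin M) (Fin M) ℂ)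
    (H : ℝ → Matrix (Fin p) (Fin M) ℂ) (t : ℝ) (Y : Ω → Fin p → ℝ) : Prop :=
  (∀ i, MemLp (fun ω => Y ω i) 2 P) ∧
  ∃ A : ℕ → Taps p M,
    Tendsto (fun j => filterPower Cx fun f => H f - (A j).freq f) atTop (𝓝 0) ∧
    ∀ i, Tendsto (fun j => eLpNorm (fun ω => Y ω i - (A j).out x t ω i) 2 P) atTop (𝓝 0)

/-! ### The task -/

/-- The σ-algebra generated by a process. -/
abbrev sigmaOf {T Ω : Type*} {n : ℕ} (x : Proc T Ω n) : MeasurableSpace Ω :=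
  ⨆ t, MeasurableSpace.comap (x t) inferInstance

/-- The analog MMSE estimate `E[s | {x(t)}]` of the task vector `s`. -/
def mmseEst {Ω : Type*} [MeasurableSpace Ω] (P : Measure Ω) {M N : ℕ}
    (x : Proc ℝ Ω M) (s : Ω → Fin N → ℝ) : Ω → Fin N → ℝ :=
  fun ω i => (P[fun ω' => s ω' i | sigmaOf x]) ω

/-- The mean-squared error `E ‖r - r'‖²` (Euclidean norm). -/
def mse {Ω : Type*} [MeasurableSpace Ω] (P : Measure Ω) {N : ℕ} (r r' : Ω → Fin N → ℝ) : ℝ :=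
  ∑ i, ∫ ω, (r ω i - r' ω i) ^ 2 ∂P

/-- The signal model: observed process `x` with power spectral density `Cx`, zero-mean task `s`
with finite variance, and linear MMSE estimate `E[s | {x(t)}] = (Γ * x)(0)`. -/
structure IsSignalModel {Ω : Type*} [MeasurableSpace Ω] (P : Measure Ω) {M N : ℕ}
    (x : Proc ℝ Ω M) (Cx : ℝ → Matrix (Fin M) (Fin M) ℂ)
    (s : Ω → Fin N → ℝ) (Γ : ℝ → Matrix (Fin N) (Fin M) ℂ) : Prop where
  wss : IsWSS P x Cx
  task_measurable : Measurable s
  task_memLp : ∀ i, MemLp (fun ω => s ω i) 2 P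
  task_mean_zero : ∀ i, ∫ ω, s ω i ∂P = 0
  freqResponse : IsFreqResponse Γ
  linear_mmse : IsFilterOutput P x Cx Γ 0 (mmseEst P x s)

/-! ### Dithered quantization -/

/-- Step size `Δ = 2 γ / 2 ^ b` of a `b`-bit quantizer with dynamic range `γ`. -/
def stepSize (γ : ℝ) (b : ℕ) : ℝ := 2 * γ / 2 ^ b

/-- The uniform mid-rise quantizer with `b` bits and dynamic range `γ`. -/
def midRise (γ : ℝ) (b : ℕ) (u : ℝ) : ℝ :=
  if |u| < γ then stepSize γ b * ((⌊u / stepSize γ b⌋ : ℝ) + 1 / 2)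
  else Real.sign u * (γ - stepSize γ b / 2)

/-- The mid-rise quantization rule with step `Δ` operating without overload. -/
def granular (Δ u : ℝ) : ℝ := Δ * ((⌊u / Δ⌋ : ℝ) + 1 / 2)

/-- Wherever the quantizer is not overloaded, it follows the granular rule. -/
theorem midRise_eq_granular {γ : ℝ} {b : ℕ} {u : ℝ} (h : |u| < γ) :
    midRise γ b u = granular (stepSize γ b) u := by
  simp [midRise, granular, h]

/-- With zero overload probability the quantizer output is almost surely the granular one. -/
theorem midRise_ae_eq_granular {Ω : Type*} [MeasurableSpace Ω] {P : Measure Ω} {γ : ℝ} {b : ℕ}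
    {u : Ω → ℝ} (h : P {ω | γ ≤ |u ω|} = 0) :
    (fun ω => midRise γ b (u ω)) =ᵐ[P] fun ω => granular (stepSize γ b) (u ω) := by
  have h' : ∀ᵐ ω ∂P, ¬ γ ≤ |u ω| := by
    rw [ae_iff]
    simpa using h
  filter_upwards [h'] with ω hω
  exact midRise_eq_granular (not_le.mp hω)

/-- The triangular density of width `2 Δ`. -/
def triangularPdf (Δ w : ℝ) : ℝ := if |w| ≤ Δ then 1 / Δ * (1 - |w| / Δ) else 0

/-- `w` is a dither process for step size `Δ`: i.i.d. in time and space with the triangular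
density, and independent of the input process and the task. -/
structure IsDither {Ω : Type*} [MeasurableSpace Ω] (P : Measure Ω) {M N K : ℕ}
    (x : Proc ℝ Ω M) (s : Ω → Fin N → ℝ) (Δ : ℝ) (w : Proc ℤ Ω K) : Prop where
  measurable : ∀ n, Measurable (w n)
  law : ∀ n k, P.map (fun ω => w n ω k)
    = volume.withDensity fun u => ENNReal.ofReal (triangularPdf Δ u)
  iid : iIndepFun (fun (q : ℤ × Fin K) ω => w q.1 ω q.2) P
  indep : Indep (sigmaOf w) (sigmaOf x ⊔ MeasurableSpace.comap s inferInstance) P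

/-! ### The acquisition system -/

/-- `(y, γ, w, z)` are the signals and the dynamic range arising in the acquisition system with
analog filter `H`, sampling rate `fs`, resolution `b` and overload parameter `η`:
`y[n] = T_s (h * x)(n T_s)` are the samples, `γ² = η² max_k E[(y_k[n] + w_k[n])²]` fixes the
dynamic range, `w` is the dither, and `z` is the output of the quantizers operating within their
dynamic range. -/
structure IsAcquisition {Ω : Type*} [MeasurableSpace Ω] (P : Measure Ω) {M N K : ℕ}
    (x : Proc ℝ Ω M) (Cx : ℝ → Matrix (Fin M) (Fin M) ℂ) (s : Ω → Fin N → ℝ)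
    (fs : ℝ) (b : ℕ) (η : ℝ) (H : ℝ → Matrix (Fin K) (Fin M) ℂ)
    (y : Proc ℤ Ω K) (γ : ℝ) (w z : Proc ℤ Ω K) : Prop where
  freqResponse : IsFreqResponse H
  samples : ∃ Y : Proc ℤ Ω K, (∀ n : ℤ, IsFilterOutput P x Cx H (n * (1 / fs)) (Y n)) ∧
    ∀ n ω k, y n ω k = 1 / fs * Y n ω k
  range_pos : 0 < γ
  range_eq : ∀ n : ℤ, γ ^ 2 = η ^ 2 * ⨆ k : Fin K, ∫ ω, (y n ω k + w n ω k) ^ 2 ∂P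
  dither : IsDither P x s (stepSize γ b) w
  quantized : ∀ n k, (fun ω => z n ω k)
    =ᵐ[P] fun ω => granular (stepSize γ b) (y n ω k + w n ω k)

/-- `r` is the output at time `0` of the linear digital filter with real, square-summable impulse
response `G` driven by `z`, i.e. `r = ∑ₙ G[-n] z[n]` in the mean-square sense: the mean-square
limit of the outputs of finite impulse response filters whose impulse responses tend to `G`. -/
def IsDigitalOutput {Ω : Type*} [MeasurableSpace Ω] (P : Measure Ω) {N K : ℕ}
    (z : Proc ℤ Ω K) (G : ℤ → Matrix (Fin N) (Fin K) ℝ) (r : Ω → Fin N → ℝ) : Prop :=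
  (∀ i k, Summable fun n => (G n i k) ^ 2) ∧
  (∀ i, MemLp (fun ω => r ω i) 2 P) ∧
  ∃ A : ℕ → (ℤ →₀ Matrix (Fin N) (Fin K) ℝ),
    (∀ i k, Tendsto (fun j => ∑' n, (G n i k - A j n i k) ^ 2) atTop (𝓝 0)) ∧
    ∀ i, Tendsto (fun j =>
      eLpNorm (fun ω => r ω i - ∑ n ∈ (A j).support, (A j n).mulVec (z (-n) ω) i) 2 P)
      atTop (𝓝 0)

/-- The mean-squared errors in recovering `r` from `z` with a linear digital filter. -/
def digitalMSEs {Ω : Type*} [MeasurableSpace Ω] (P : Measure Ω) {N K : ℕ}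
    (z : Proc ℤ Ω K) (r : Ω → Fin N → ℝ) : Set ℝ :=
  {D | ∃ (G : ℤ → Matrix (Fin N) (Fin K) ℝ) (shat : Ω → Fin N → ℝ),
    IsDigitalOutput P z G shat ∧ D = mse P r shat}

/-! ### The aliased stacked matrices and the water-filling filter -/

/-- The stacked matrix
`[A(f + Υ fs) L(f + Υ fs), …, A(f - Υ fs) L(f - Υ fs)]` with `L = Cx ^ (1/2)`; its block with
index `k = -Υ, …, Υ` is `A(f - k fs) L(f - k fs)`. -/
def stacked {p M : ℕ} (Υ : ℕ) (fs : ℝ) (Cx : ℝ → Matrix (Fin M) (Fin M) ℂ)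
    (A : ℝ → Matrix (Fin p) (Fin M) ℂ) (f : ℝ) : Matrix (Fin p) (Fin ((2 * Υ + 1) * M)) ℂ :=
  Matrix.of fun i j =>
    let q := finProdFinEquiv.symm j
    let g : ℝ := f - ((q.1 : ℕ) - (Υ : ℝ)) * fs
    (A g * CFC.sqrt (Cx g)) i q.2

/-- The `i`-th largest singular value (`i = 0, 1, …`; zero beyond the size of the matrix). -/
def singVal {p q : ℕ} (A : Matrix (Fin p) (Fin q) ℂ) (i : ℕ) : ℝ :=
  (Matrix.toEuclideanLin A).singularValues i

/-- The rectangular diagonal matrix with diagonal entries `d 0, d 1, …`. -/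
def rectDiag (p q : ℕ) (d : ℕ → ℝ) : Matrix (Fin p) (Fin q) ℂ :=
  Matrix.of fun i j => if (i : ℕ) = (j : ℕ) then (d i : ℂ) else 0

/-- `V` is a matrix of right-singular vectors of `A`, in descending order of the singular values:
`A = W Σ Vᴴ` is a singular value decomposition for some `W`. -/
def IsRightSingular {p q : ℕ} (A : Matrix (Fin p) (Fin q) ℂ) (V : Matrix (Fin q) (Fin q) ℂ) :
    Prop :=
  V ∈ Matrix.unitaryGroup (Fin q) ℂ ∧
  ∃ W ∈ Matrix.unitaryGroup (Fin p) ℂ, A = W * rectDiag p q (singVal A) * V.conjTranspose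

/-- The constant `κ̄ = η² (1 - 2 η² / (3 · 2 ^ (2 b)))⁻¹`. -/
def kappaBar (η : ℝ) (b : ℕ) : ℝ := η ^ 2 * (1 - 2 * η ^ 2 / (3 * 2 ^ (2 * b)))⁻¹

/-- The water-filling entry `2 ^ (-b) √((ζ σ - 1)⁺)`. -/
def waterEntry (b : ℕ) (ζ σ : ℝ) : ℝ := 1 / 2 ^ b * √(max (ζ * σ - 1) 0)

/-- The power constraint on the water level `ζ`, for the stacked matrix function `Gb`. -/
def IsWaterLevel {N Mb : ℕ} (K : ℕ) (fs : ℝ) (b : ℕ) (η : ℝ)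
    (Gb : ℝ → Matrix (Fin N) (Fin Mb) ℂ) (ζ : ℝ) : Prop :=
  kappaBar η b * (1 / fs) / K *
    (∫ f in (-(fs / 2))..(fs / 2),
      ∑ i ∈ Finset.range (min K Mb), waterEntry b ζ (singVal (Gb f) i) ^ 2) = 1

/-- The closed-form value `E‖s̃‖² - ∫ ∑ σ² Σ² / (Σ² + 2 ^ (-2 b)) df`, where `E`
is the energy `E‖s̃‖²` of the analog MMSE estimate. -/
def optimalDistortion {N Mb : ℕ} (K : ℕ) (fs : ℝ) (b : ℕ)
    (Gb : ℝ → Matrix (Fin N) (Fin Mb) ℂ) (ζ E : ℝ) : ℝ :=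
  E - ∫ f in (-(fs / 2))..(fs / 2), ∑ i ∈ Finset.range (min K Mb),
    singVal (Gb f) i ^ 2 * waterEntry b ζ (singVal (Gb f) i) ^ 2
      / (waterEntry b ζ (singVal (Gb f) i) ^ 2 + 1 / 2 ^ (2 * b))

/-- The `K × Mb` diagonal matrix `Σ` of water-filling entries built from the singular values
of `A`. -/
def waterMatrix {N Mb : ℕ} (K b : ℕ) (ζ : ℝ) (A : Matrix (Fin N) (Fin Mb) ℂ) :
    Matrix (Fin K) (Fin Mb) ℂ :=
  rectDiag K Mb fun i => waterEntry b ζ (singVal A i)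

/-- `Hb(f) = U(f) Σ(f) V(f)ᴴ` on the base band, with `V` the right-singular vectors of `Gb`, `Σ`
the diagonal matrix of water-filling entries, and `U` unitary such that `U Σ Σᴴ Uᴴ` has identical
diagonal entries. -/
def HasWaterFillingForm {K N Mb : ℕ} (fs : ℝ) (b : ℕ) (ζ : ℝ)
    (Gb : ℝ → Matrix (Fin N) (Fin Mb) ℂ) (Hb : ℝ → Matrix (Fin K) (Fin Mb) ℂ)
    (U : ℝ → Matrix (Fin K) (Fin K) ℂ) (V : ℝ → Matrix (Fin Mb) (Fin Mb) ℂ) : Prop :=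
  ∀ᵐ f ∂(volume.restrict (Set.Icc (-(fs / 2)) (fs / 2))),
    IsRightSingular (Gb f) (V f) ∧
    U f ∈ Matrix.unitaryGroup (Fin K) ℂ ∧
    (∀ k l, (U f * waterMatrix K b ζ (Gb f) * (waterMatrix K b ζ (Gb f)).conjTranspose
        * (U f).conjTranspose) k k
      = (U f * waterMatrix K b ζ (Gb f) * (waterMatrix K b ζ (Gb f)).conjTranspose
        * (U f).conjTranspose) l l) ∧
    Hb f = U f * waterMatrix K b ζ (Gb f) * (V f).conjTranspose

end

end TaskADC

namespace TaskADC

noncomputable section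

/-! ### Uniqueness of Fourier coefficients of integrable functions -/

/-! The problem reduces to a matrix optimisation at each frequency of the base band, coupled over
frequencies by a single power budget.

Given the input, the error of a quantizer with triangular dither has mean zero and second moment
$\Delta^2/4$, whatever the input value (`integral_qerr`). The quantization noise is therefore white
with variance $\gamma^2/2^{2b}$ and uncorrelated with $x$ and $s$. Spectral isometries for filter
outputs, together with folding of the frequency axis, turn the error of an FIR digital filter into
$\int \|\bar\Gamma-G\bar H\|^2+c\|G\|^2$ in Frobenius norm, with $c=\gamma^2 f_s/2^{2b}$
(`IsAcquisition.integral_fir_error`). The rule for the dynamic range amounts to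
$\gamma^2=\bar\kappa\max_k\mathbb E[y_k^2]$ (`range_sq_iff`). Since a maximum is at least an
average, this bounds $\int\|\bar H\|^2$ by $K\gamma^2f_s^2/\bar\kappa$ (`IsAcquisition.power_le`).

Lower bound: price the power of $\bar H$ by a multiplier $l$. For fixed $f$ and $\tau^2=cl$, the sum
$\|A-GH\|^2+c\|G\|^2+l\|H\|^2$ is at least $\|A\|^2-\sum_{i<\min(K,\bar M)}((\sigma_i-\tau)^+)^2$
(`pointwise_lower_bound`). A singular value decomposition of $H$ decouples the columns, each column
is a scalar Wiener problem followed by soft thresholding, and a Ky Fan argument assigns the largest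
$\sigma_i$ to the at most $K$ active columns. With $\tau=1/\zeta$ the range $\gamma$ cancels against
the power budget, and what remains is $D^{\rm o}$ (`IsWaterLevel.optimalDistortion_eq`).
Square-summable digital filters follow as limits of FIR filters.

Attainment: for $H^{\rm o}$ all channels carry equal power, so max equals average, $\gamma^2=1/f_s$
and $c=2^{-2b}$. The Wiener filter of $\bar\Gamma$ and $\bar H^{\rm o}$ is diagonal in their common
singular frames and gives equality (`wiener_value`). It is conjugate symmetric, hence a limit of
real FIR filters (`exists_tapFreq_approx`, `IsAcquisition.exists_digitalOutput`).

Existence of $H^{\rm o}$ requires measurable and conjugate-symmetric choices. Left-singular vectors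
of $\bar\Gamma$ are selected measurably by power iteration and deflation. The filter is $\Gamma$
multiplied on the left by an $f_s$-periodic matrix built from them and from the unitary DFT, whose
entries of equal modulus equalise the diagonal (`exists_waterFilling`). Finally, $s-\tilde s$ is
orthogonal to every digital output, which transfers all statements from $\tilde s$ to $s$. -/

theorem integral_smul_eq_zero_of_fourier {R : ℝ} (hR : 0 < R) {φ : ℝ → ℂ}
    (hφ : IntegrableOn φ (Set.Icc (-R) R))
    (h : ∀ n : ℤ, ∫ f in Set.Icc (-R) R,
      Complex.exp (-(2 * Real.pi * Complex.I * f * (n / (2 * R) : ℝ))) * φ f = 0)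
    (g : C(AddCircle (2 * R), ℂ)) : ∫ f in Set.Icc (-R) R, g (f : AddCircle (2 * R)) * φ f = 0 := by
  have : Fact (0 < 2 * R) := ⟨by linarith⟩
  have hint : ∀ g : C(AddCircle (2 * R), ℂ),
      IntegrableOn (fun f : ℝ => g (f : AddCircle (2 * R)) * φ f) (Set.Icc (-R) R) := by
    intro g
    refine Integrable.bdd_mul (c := ‖g‖) hφ ?_ ?_
    · exact (g.continuous.comp (AddCircle.continuous_mk' _)).aestronglyMeasurable
    · exact Eventually.of_forall fun f => g.norm_coe_le_norm _
  let ℓ : C(AddCircle (2 * R), ℂ) →ₗ[ℂ] ℂ :=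
    { toFun := fun g => ∫ f in Set.Icc (-R) R, g (f : AddCircle (2 * R)) * φ f
      map_add' := fun a b => by
        simp only [ContinuousMap.add_apply, add_mul]
        exact integral_add (hint a) (hint b)
      map_smul' := fun c a => by
        simp only [ContinuousMap.smul_apply, smul_eq_mul, mul_assoc, RingHom.id_apply]
        exact integral_const_mul _ _ }
  let L : C(AddCircle (2 * R), ℂ) →L[ℂ] ℂ := ℓ.mkContinuous (∫ f in Set.Icc (-R) R, ‖φ f‖) (by
    intro g
    calc ‖ℓ g‖ ≤ ∫ f in Set.Icc (-R) R, ‖φ f‖ * ‖g‖ := by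
          refine norm_integral_le_of_norm_le (hφ.norm.mul_const _) (Eventually.of_forall fun f => ?_)
          rw [norm_mul, mul_comm]
          exact mul_le_mul_of_nonneg_left (g.norm_coe_le_norm _) (norm_nonneg _)
      _ = _ := integral_mul_const _ _)
  have hL : ∀ g ∈ (Submodule.span ℂ (Set.range (@fourier (2 * R)))).topologicalClosure,
      g ∈ LinearMap.ker L.toLinearMap := by
    intro g hg
    refine Submodule.topologicalClosure_minimal _ ?_ L.isClosed_ker hg
    rw [Submodule.span_le]
    rintro _ ⟨n, rfl⟩
    rw [SetLike.mem_coe, LinearMap.mem_ker]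
    change ∫ f in Set.Icc (-R) R, fourier n (f : AddCircle (2 * R)) * φ f = 0
    -- `fourier n` carries the exponent with the opposite sign to the kernel of the hypothesis,
    -- hence `-n`.
    rw [← h (-n)]
    congr 1
    ext f
    rw [fourier_coe_apply]
    congr 2
    push_cast
    have : (R : ℂ) ≠ 0 := by exact_mod_cast hR.ne'
    field_simp
  have : g ∈ (Submodule.span ℂ (Set.range (@fourier (2 * R)))).topologicalClosure := by
    rw [span_fourier_closure_eq_top]; trivial
  exact LinearMap.mem_ker.mp (hL g this)

/-- A test function supported in the open interval descends to a continuous function on the circle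
of length `2 * R`, where trigonometric polynomials are uniformly dense. So `φ` integrates to zero
against every test function, and the endpoints are null. -/
theorem ae_eq_zero_of_fourier {R : ℝ} (hR : 0 < R) {φ : ℝ → ℂ}
    (hφ : IntegrableOn φ (Set.Icc (-R) R))
    (h : ∀ n : ℤ, ∫ f in Set.Icc (-R) R,
      Complex.exp (-(2 * Real.pi * Complex.I * f * (n / (2 * R) : ℝ))) * φ f = 0) :
    ∀ᵐ f ∂(volume.restrict (Set.Icc (-R) R)), φ f = 0 := by
  have : Fact (0 < 2 * R) := ⟨by linarith⟩
  have key : ∀ᵐ f : ℝ, f ∈ Set.Ioo (-R) R → φ f = 0 := by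
    refine isOpen_Ioo.ae_eq_zero_of_integral_contDiff_smul_eq_zero
      ((hφ.mono_set Set.Ioo_subset_Icc_self).locallyIntegrableOn) ?_
    intro g hg _ hsupp
    have hz : ∀ f, f ∉ Set.Ioo (-R) R → g f = 0 := fun f hf =>
      image_eq_zero_of_notMem_tsupport fun h' => hf (hsupp h')
    let G₀ : ℝ → ℂ := fun f => (g f : ℂ)
    have hends : G₀ (-R) = G₀ (-R + 2 * R) := by
      simp only [G₀]
      rw [hz (-R) (by simp), hz (-R + 2 * R) (by simp; intro _; linarith)]
    let G : C(AddCircle (2 * R), ℂ) := ⟨AddCircle.liftIco (2 * R) (-R) G₀,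
      AddCircle.liftIco_continuous hends
        (Complex.continuous_ofReal.comp hg.continuous).continuousOn⟩
    have h1 := integral_smul_eq_zero_of_fourier hR hφ h G
    rw [integral_Icc_eq_integral_Ico] at h1
    have h2 : ∫ f in Set.Ico (-R) R, G (f : AddCircle (2 * R)) * φ f
        = ∫ f in Set.Ico (-R) R, g f • φ f := by
      refine setIntegral_congr_fun measurableSet_Ico fun f hf => ?_
      have : G (f : AddCircle (2 * R)) = G₀ f := by
        change AddCircle.liftIco (2 * R) (-R) G₀ (f : AddCircle (2 * R)) = G₀ f
        exact AddCircle.liftIco_coe_apply ⟨hf.1, by have := hf.2; linarith⟩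
      simp only [this, G₀, Complex.real_smul]
    rw [← setIntegral_eq_integral_of_forall_compl_eq_zero (s := Set.Ico (-R) R), ← h2, h1]
    intro f hf
    rw [hz f fun h' => hf (Set.Ioo_subset_Ico_self h'), zero_smul]
  rw [← restrict_Ioo_eq_restrict_Icc]
  exact (ae_restrict_iff' measurableSet_Ioo).mpr key

/-! ### Frobenius norm -/

/-- A matrix as a vector of the Euclidean space with the Frobenius norm. -/
def fvec {r q : ℕ} (A : Matrix (Fin r) (Fin q) ℂ) : EuclideanSpace ℂ (Fin r × Fin q) :=
  WithLp.toLp 2 fun p => A p.1 p.2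

@[simp] theorem fvec_apply {r q : ℕ} (A : Matrix (Fin r) (Fin q) ℂ) (p : Fin r × Fin q) :
    fvec A p = A p.1 p.2 := rfl

theorem fvec_add {r q : ℕ} (A B : Matrix (Fin r) (Fin q) ℂ) : fvec (A + B) = fvec A + fvec B := rfl

theorem fvec_sub {r q : ℕ} (A B : Matrix (Fin r) (Fin q) ℂ) : fvec (A - B) = fvec A - fvec B := rfl

/-- The squared Frobenius norm. -/
def frob {r q : ℕ} (A : Matrix (Fin r) (Fin q) ℂ) : ℝ := ∑ i, ∑ j, ‖A i j‖ ^ 2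

theorem frob_nonneg {r q : ℕ} (A : Matrix (Fin r) (Fin q) ℂ) : 0 ≤ frob A :=
  Finset.sum_nonneg fun _ _ => Finset.sum_nonneg fun _ _ => sq_nonneg _

theorem norm_fvec_sq {r q : ℕ} (A : Matrix (Fin r) (Fin q) ℂ) : ‖fvec A‖ ^ 2 = frob A := by
  rw [EuclideanSpace.norm_sq_eq, frob, Fintype.sum_prod_type]
  rfl

theorem memLp_fvec_iff {α : Type*} [MeasurableSpace α] {μ : Measure α} {r q : ℕ}
    {F : α → Matrix (Fin r) (Fin q) ℂ} :
    MemLp (fun a => fvec (F a)) 2 μ ↔ ∀ i j, MemLp (fun a => F a i j) 2 μ := by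
  rw [memLp_piLp_iff]
  exact ⟨fun h i j => h (i, j), fun h p => h p.1 p.2⟩

theorem aesm_fvec {α : Type*} [MeasurableSpace α] {μ : Measure α} {r q : ℕ}
    {F : α → Matrix (Fin r) (Fin q) ℂ} (h : ∀ i j, AEStronglyMeasurable (fun a => F a i j) μ) :
    AEStronglyMeasurable (fun a => fvec (F a)) μ := by
  have : AEStronglyMeasurable (fun a => (fun p : Fin r × Fin q => F a p.1 p.2)) μ :=
    (aemeasurable_pi_lambda _ fun p : Fin r × Fin q => (h p.1 p.2).aemeasurable).aestronglyMeasurable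
  exact (PiLp.continuous_toLp 2 _).comp_aestronglyMeasurable this

/-! ### Tapped delay lines and density of trigonometric polynomials -/

/-- The character `e^{-2 π i f τ}`. -/
def chr (f τ : ℝ) : ℂ := Complex.exp (-(2 * Real.pi * Complex.I * f * τ))

theorem norm_chr (f τ : ℝ) : ‖chr f τ‖ = 1 := by
  rw [chr, show -(2 * Real.pi * Complex.I * f * τ : ℂ)
    = ((-(2 * Real.pi * f * τ) : ℝ) : ℂ) * Complex.I by push_cast; ring]
  exact Complex.norm_exp_ofReal_mul_I _

theorem star_chr_neg (f τ : ℝ) : star (chr (-f) τ) = chr f τ := by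
  rw [chr, chr, ← starRingEnd_apply, ← Complex.exp_conj]
  congr 1
  simp [map_ofNat]

theorem star_chr (f τ : ℝ) : star (chr f τ) = chr f (-τ) := by
  rw [chr, chr, ← starRingEnd_apply, ← Complex.exp_conj]
  congr 1
  simp [map_ofNat]

theorem chr_add (f τ τ' : ℝ) : chr f (τ + τ') = chr f τ * chr f τ' := by
  rw [chr, chr, chr, ← Complex.exp_add]
  congr 1
  push_cast
  ring

@[fun_prop]
theorem continuous_chr (τ : ℝ) : Continuous fun f => chr f τ := by
  unfold chr
  fun_prop

/-- Frequency response of a delay line with delays `t τ` and real matrix gains `c τ`. -/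
def tapFreq {ι : Type*} (t : ι → ℝ) {r p : ℕ} (c : ι →₀ Matrix (Fin r) (Fin p) ℝ) (f : ℝ) :
    Matrix (Fin r) (Fin p) ℂ :=
  c.sum fun τ C => chr f (t τ) • C.map (fun x : ℝ => (x : ℂ))

section

variable {ι : Type*} (t : ι → ℝ) {r p q : ℕ}

theorem tapFreq_apply (c : ι →₀ Matrix (Fin r) (Fin p) ℝ) (f : ℝ) (i : Fin r) (k : Fin p) :
    tapFreq t c f i k = ∑ τ ∈ c.support, chr f (t τ) * c τ i k := by
  simp [tapFreq, Finsupp.sum, Matrix.sum_apply]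

theorem tapFreq_add (c d : ι →₀ Matrix (Fin r) (Fin p) ℝ) (f : ℝ) :
    tapFreq t (c + d) f = tapFreq t c f + tapFreq t d f := by
  classical
  refine Finsupp.sum_add_index' (fun a => ?_) fun a b₁ b₂ => ?_
  · ext; simp
  · ext; simp [mul_add]

theorem tapFreq_smul (a : ℝ) (c : ι →₀ Matrix (Fin r) (Fin p) ℝ) (f : ℝ) :
    tapFreq t (a • c) f = (a : ℂ) • tapFreq t c f := by
  rw [tapFreq, Finsupp.sum_smul_index' (fun a => by ext; simp), tapFreq, Finsupp.smul_sum]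
  congr 1
  ext i C k l
  simp
  ring

theorem tapFreq_sub (c d : ι →₀ Matrix (Fin r) (Fin p) ℝ) (f : ℝ) :
    tapFreq t (c - d) f = tapFreq t c f - tapFreq t d f := by
  rw [sub_eq_add_neg, tapFreq_add, ← neg_one_smul ℝ d, tapFreq_smul]
  simp [sub_eq_add_neg]

theorem tapFreq_single (τ : ι) (C : Matrix (Fin r) (Fin p) ℝ) (f : ℝ) :
    tapFreq t (Finsupp.single τ C) f = chr f (t τ) • C.map (fun x : ℝ => (x : ℂ)) :=
  Finsupp.sum_single_index (by ext; simp)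

theorem continuous_tapFreq (c : ι →₀ Matrix (Fin r) (Fin p) ℝ) (i : Fin r) (k : Fin p) :
    Continuous fun f => tapFreq t c f i k := by
  simp only [tapFreq_apply]
  fun_prop

theorem norm_tapFreq_le (c : ι →₀ Matrix (Fin r) (Fin p) ℝ) (f : ℝ) (i : Fin r) (k : Fin p) :
    ‖tapFreq t c f i k‖ ≤ ∑ τ ∈ c.support, |c τ i k| := by
  rw [tapFreq_apply]
  refine (norm_sum_le _ _).trans (Finset.sum_le_sum fun τ _ => ?_)
  simp [norm_chr]

theorem memLp_tapFreq_mul {μ : Measure ℝ} {B : ℝ → Matrix (Fin p) (Fin q) ℂ}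
    (hB : MemLp (fun f => fvec (B f)) 2 μ) (c : ι →₀ Matrix (Fin r) (Fin p) ℝ) :
    MemLp (fun f => fvec (tapFreq t c f * B f)) 2 μ := by
  rw [memLp_fvec_iff] at hB ⊢
  intro i j
  simp only [Matrix.mul_apply]
  refine memLp_finsetSum _ fun k _ => ?_
  refine (hB k j).of_le_mul (c := ∑ τ ∈ c.support, |c τ i k|)
    ((continuous_tapFreq t c i k).aestronglyMeasurable.mul (hB k j).1)
    (Eventually.of_forall fun f => ?_)
  rw [norm_mul]
  exact mul_le_mul_of_nonneg_right (norm_tapFreq_le t c f i k) (norm_nonneg _)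

/-- The real-linear map taking tap weights to the weighted frequency response. -/
def tapLp {μ : Measure ℝ} {B : ℝ → Matrix (Fin p) (Fin q) ℂ}
    (hB : MemLp (fun f => fvec (B f)) 2 μ) :
    (ι →₀ Matrix (Fin r) (Fin p) ℝ) →ₗ[ℝ] Lp (EuclideanSpace ℂ (Fin r × Fin q)) 2 μ where
  toFun c := (memLp_tapFreq_mul t hB c).toLp _
  map_add' c d := by
    rw [← MemLp.toLp_add]
    refine MemLp.toLp_congr _ _ (Eventually.of_forall fun f => ?_)
    simp only [tapFreq_add, Matrix.add_mul, fvec_add, Pi.add_apply]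
  map_smul' a c := by
    rw [RingHom.id_apply, ← MemLp.toLp_const_smul]
    refine MemLp.toLp_congr _ _ (Eventually.of_forall fun f => ?_)
    ext
    simp [tapFreq_smul]

end

theorem integral_symm_Icc {E : Type*} [NormedAddCommGroup E] [NormedSpace ℝ E] (R : ℝ)
    (φ : ℝ → E) :
    ∫ f in Set.Icc (-R) R, φ (-f) = ∫ f in Set.Icc (-R) R, φ f := by
  have h := (Measure.measurePreserving_neg (volume : Measure ℝ)).setIntegral_preimage_emb
    (MeasurableEquiv.neg ℝ).measurableEmbedding φ (Set.Icc (-R) R)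
  rw [← h]
  congr 2
  ext f
  simp only [Set.mem_preimage, Set.mem_Icc]
  constructor <;> rintro ⟨h1, h2⟩ <;> constructor <;> linarith

theorem integrableOn_symm_Icc {E : Type*} [NormedAddCommGroup E] {R : ℝ} {φ : ℝ → E}
    (h : IntegrableOn φ (Set.Icc (-R) R)) : IntegrableOn (fun f => φ (-f)) (Set.Icc (-R) R) := by
  have h' := (Measure.measurePreserving_neg (volume : Measure ℝ)).integrableOn_comp_preimage
    (MeasurableEquiv.neg ℝ).measurableEmbedding (f := φ) (s := Set.Icc (-R) R)
  have : (Neg.neg ⁻¹' Set.Icc (-R) R) = Set.Icc (-R) R := by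
    ext f
    simp only [Set.mem_preimage, Set.mem_Icc]
    constructor <;> rintro ⟨h1, h2⟩ <;> constructor <;> linarith
  rw [this] at h'
  exact h'.mpr h

theorem ae_symm_Icc {R : ℝ} {p : ℝ → Prop}
    (h : ∀ᵐ f ∂(volume.restrict (Set.Icc (-R) R)), p f) :
    ∀ᵐ f ∂(volume.restrict (Set.Icc (-R) R)), p (-f) := by
  rw [ae_restrict_iff' measurableSet_Icc] at h ⊢
  have := (Measure.measurePreserving_neg (volume : Measure ℝ)).quasiMeasurePreserving.ae h
  filter_upwards [this] with f hf hm
  exact hf ⟨by linarith [hm.2], by linarith [hm.1]⟩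

/-- An integrable function all of whose Fourier coefficients have zero real part is
conjugate-antisymmetric. -/
theorem ae_antisymm_of_fourier_re {ι : Type*} {t : ι → ℝ} {R : ℝ} (hR : 0 < R)
    (ht : ∀ n : ℤ, ∃ τ, t τ = n / (2 * R)) {φ : ℝ → ℂ}
    (hφ : IntegrableOn φ (Set.Icc (-R) R))
    (h : ∀ τ, (∫ f in Set.Icc (-R) R, chr f (t τ) * φ f).re = 0) :
    ∀ᵐ f ∂(volume.restrict (Set.Icc (-R) R)), φ (-f) = -star (φ f) := by
  have hφ' : IntegrableOn (fun f => star (φ (-f))) (Set.Icc (-R) R) :=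
    Complex.conjCLE.toContinuousLinearMap.integrable_comp (integrableOn_symm_Icc hφ)
  -- Reflection followed by conjugation conjugates each Fourier coefficient, so those of this sum
  -- are twice the real parts of those of `φ`, that is, zero.
  have key : ∀ᵐ f ∂(volume.restrict (Set.Icc (-R) R)), φ f + star (φ (-f)) = 0 := by
    refine ae_eq_zero_of_fourier hR (hφ.add hφ') fun n => ?_
    obtain ⟨τ, hτ⟩ := ht n
    have hb : ∀ ψ : ℝ → ℂ, IntegrableOn ψ (Set.Icc (-R) R) →
        IntegrableOn (fun f => chr f (t τ) * ψ f) (Set.Icc (-R) R) := fun ψ hψ =>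
      Integrable.bdd_mul (c := 1) hψ (continuous_chr _).aestronglyMeasurable
        (Eventually.of_forall fun f => (norm_chr _ _).le)
    have e1 : ∀ f : ℝ, Complex.exp (-(2 * Real.pi * Complex.I * f * (n / (2 * R) : ℝ)))
        * (φ + fun f => star (φ (-f))) f
        = chr f (t τ) * φ f + chr f (t τ) * star (φ (-f)) := by
      intro f
      rw [hτ, chr, Pi.add_apply, mul_add]
    refine (integral_congr_ae (Eventually.of_forall e1)).trans ?_
    rw [integral_add (hb _ hφ) (hb _ hφ')]
    have e2 : ∫ f in Set.Icc (-R) R, chr f (t τ) * star (φ (-f))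
        = starRingEnd ℂ (∫ f in Set.Icc (-R) R, chr f (t τ) * φ f) := by
      rw [← integral_conj, ← integral_symm_Icc R fun f => starRingEnd ℂ (chr f (t τ) * φ f)]
      congr 1
      ext f
      rw [map_mul, starRingEnd_apply, starRingEnd_apply, star_chr_neg]
    rw [e2, Complex.add_conj, h τ]
    simp
  filter_upwards [ae_symm_Icc key] with f hf
  rw [neg_neg] at hf
  exact eq_neg_of_add_eq_zero_left hf

/-- Real gains span only a real subspace of the weighted `L²` space, so its closure is computed as a
double orthogonal complement over `ℝ`. If `g` is orthogonal to it, single taps show that the entries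
of `B gᴴ` have Fourier coefficients with zero real part, hence are conjugate-antisymmetric. Against
a conjugate-symmetric `h` the integrand of the inner product is then odd, and the inner product
vanishes. -/
theorem exists_tapFreq_approx {ι : Type*} {t : ι → ℝ} {R : ℝ} (hR : 0 < R)
    (ht : ∀ n : ℤ, ∃ τ, t τ = n / (2 * R)) {r p q : ℕ} {B : ℝ → Matrix (Fin p) (Fin q) ℂ}
    (hB : MemLp (fun f => fvec (B f)) 2 (volume.restrict (Set.Icc (-R) R)))
    {h : ℝ → Matrix (Fin r) (Fin p) ℂ}
    (hhB : MemLp (fun f => fvec (h f * B f)) 2 (volume.restrict (Set.Icc (-R) R)))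
    (hsym : ∀ᵐ f ∂(volume.restrict (Set.Icc (-R) R)), ∀ i k, h (-f) i k = star (h f i k))
    {ε : ENNReal} (hε : 0 < ε) :
    ∃ c : ι →₀ Matrix (Fin r) (Fin p) ℝ,
      eLpNorm (fun f => fvec ((h f - tapFreq t c f) * B f)) 2
        (volume.restrict (Set.Icc (-R) R)) < ε := by
  classical
  set μ := (volume.restrict (Set.Icc (-R) R) : Measure ℝ) with hμ
  let V := LinearMap.range (tapLp (r := r) t hB)
  have hmem : hhB.toLp _ ∈ V.topologicalClosure := by
    rw [← V.orthogonal_orthogonal_eq_closure, Submodule.mem_orthogonal]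
    intro g hg
    have hgB : ∀ i k, Integrable (fun f => ∑ j, B f k j * star (g f (i, j))) μ := by
      intro i k
      refine integrable_finsetSum _ fun j _ => ?_
      exact (memLp_fvec_iff.mp hB k j).integrable_mul
        ((memLp_piLp_iff.mp (Lp.memLp g) (i, j)).star)
    have hanti : ∀ i k, ∀ᵐ f ∂μ, (∑ j, B (-f) k j * star (g (-f) (i, j)))
        = - star (∑ j, B f k j * star (g f (i, j))) := by
      intro i k
      refine ae_antisymm_of_fourier_re hR ht (hgB i k) fun τ => ?_
      -- A single tap whose gain is a matrix unit isolates one Fourier coefficient of one entry.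
      have h1 := Submodule.mem_orthogonal V g |>.mp hg
        (tapLp t hB (Finsupp.single τ (Matrix.single i k 1))) ⟨_, rfl⟩
      rw [L2.inner_def] at h1
      rw [← h1]
      have hI : Integrable (fun f => chr f (t τ) * ∑ j, B f k j * star (g f (i, j))) μ :=
        Integrable.bdd_mul (c := 1) (hgB i k) (continuous_chr _).aestronglyMeasurable
          (Eventually.of_forall fun f => (norm_chr _ _).le)
      rw [← Complex.reCLM_apply, ← ContinuousLinearMap.integral_comp_comm _ hI]
      refine integral_congr_ae ?_
      filter_upwards [(memLp_tapFreq_mul t hB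
        (Finsupp.single τ (Matrix.single i k (1 : ℝ)))).coeFn_toLp] with f hf
      change _ = inner ℝ ((memLp_tapFreq_mul t hB _).toLp _ f) (g f)
      rw [hf, PiLp.inner_apply, Fintype.sum_prod_type]
      simp only [fvec_apply, tapFreq_single, Matrix.mul_apply, Matrix.smul_apply,
        Matrix.map_apply, Complex.inner, smul_eq_mul]
      rw [Finset.sum_eq_single i]
      · rw [← Complex.re_sum, Complex.reCLM_apply, Finset.mul_sum]
        rw [Complex.re_sum, Complex.re_sum]
        refine Finset.sum_congr rfl fun j _ => ?_
        rw [Finset.sum_eq_single k]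
        · simp
          ring
        · intro b _ hb
          simp [hb.symm]
        · simp
      · intro b _ hb
        refine Finset.sum_eq_zero fun j _ => ?_
        simp [hb.symm]
      · simp
    rw [real_inner_comm, L2.inner_def]
    set ψ : ℝ → ℝ := fun f => (∑ i, ∑ k, h f i k * ∑ j, B f k j * star (g f (i, j))).re with hψ
    have e1 : ∫ f, inner ℝ (hhB.toLp _ f) (g f) ∂μ = ∫ f, ψ f ∂μ := by
      refine integral_congr_ae ?_
      filter_upwards [hhB.coeFn_toLp] with f hf
      rw [hf, PiLp.inner_apply, Fintype.sum_prod_type]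
      simp only [hψ, fvec_apply, Matrix.mul_apply, Complex.inner, ← Complex.re_sum]
      rw [← Complex.conj_re]
      congr 1
      simp only [map_sum, map_mul, Finset.mul_sum,
        starRingEnd_apply, star_star]
      refine Finset.sum_congr rfl fun i _ => ?_
      rw [Finset.sum_comm]
      refine Finset.sum_congr rfl fun k _ => Finset.sum_congr rfl fun j _ => ?_
      ring
    have e2 : ∫ f, ψ (-f) ∂μ = - ∫ f, ψ f ∂μ := by
      rw [← integral_neg]
      refine integral_congr_ae ?_
      have hall : ∀ᵐ f ∂μ, ∀ i k, (∑ j, B (-f) k j * star (g (-f) (i, j)))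
        = - star (∑ j, B f k j * star (g f (i, j))) :=
        ae_all_iff.mpr fun i => ae_all_iff.mpr fun k => hanti i k
      filter_upwards [hall, hsym] with f hf hs
      simp only [hψ, hf, hs]
      simp only [mul_neg, Finset.sum_neg_distrib, Complex.neg_re, ← star_mul', ← star_sum]
      rfl
    have e3 := integral_symm_Icc R ψ
    rw [e1]
    rw [← hμ] at e3
    linarith
  rw [← SetLike.mem_coe, Submodule.topologicalClosure_coe] at hmem
  obtain ⟨_, ⟨c, rfl⟩, hc⟩ := EMetric.mem_closure_iff.mp hmem ε hε
  refine ⟨c, ?_⟩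
  have : eLpNorm (fun f => fvec ((h f - tapFreq t c f) * B f)) 2 μ
      = edist (hhB.toLp _) ((memLp_tapFreq_mul t hB c).toLp _) := by
    rw [Lp.edist_toLp_toLp]
    congr 1
    ext1 f
    rw [Matrix.sub_mul, fvec_sub, Pi.sub_apply]
  rw [this]
  exact hc

/-! ### Measurable diagonalization -/

theorem exists_diag {n : ℕ} {S : Matrix (Fin n) (Fin n) ℂ} (hS : S.PosSemidef) :
    ∃ (U : Matrix (Fin n) (Fin n) ℂ) (d : Fin n → ℝ), U.conjTranspose * U = 1 ∧
      U * U.conjTranspose = 1 ∧ (∀ i, 0 ≤ d i) ∧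
      S = U * Matrix.diagonal (fun i => (d i : ℂ)) * U.conjTranspose := by
  refine ⟨hS.isHermitian.eigenvectorUnitary, hS.isHermitian.eigenvalues, ?_, ?_,
    hS.eigenvalues_nonneg, ?_⟩
  · exact Unitary.coe_star_mul_self hS.isHermitian.eigenvectorUnitary
  · exact Unitary.coe_mul_star_self hS.isHermitian.eigenvectorUnitary
  · conv_lhs => rw [hS.isHermitian.spectral_theorem, Unitary.conjStarAlgAut_apply]
    rfl

theorem conj_diag_pow {n : ℕ} {U : Matrix (Fin n) (Fin n) ℂ} (hU : U.conjTranspose * U = 1)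
    (hU' : U * U.conjTranspose = 1) (d : Fin n → ℂ) (k : ℕ) :
    (U * Matrix.diagonal d * U.conjTranspose) ^ k
      = U * Matrix.diagonal (fun i => d i ^ k) * U.conjTranspose := by
  induction k with
  | zero => simp [hU']
  | succ k ih =>
    rw [pow_succ, ih]
    calc _ = U * Matrix.diagonal (fun i => d i ^ k) * (U.conjTranspose * U) * Matrix.diagonal d
        * U.conjTranspose := by simp only [Matrix.mul_assoc]
      _ = _ := by
        rw [hU, Matrix.mul_one, Matrix.mul_assoc U, Matrix.diagonal_mul_diagonal]
        simp only [pow_succ]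

theorem conj_diag_apply {n : ℕ} (U : Matrix (Fin n) (Fin n) ℂ) (d : Fin n → ℂ) (i j : Fin n) :
    (U * Matrix.diagonal d * U.conjTranspose) i j = ∑ l, U i l * star (U j l) * d l := by
  rw [Matrix.mul_apply]
  refine Finset.sum_congr rfl fun l _ => ?_
  rw [Matrix.mul_diagonal, Matrix.conjTranspose_apply]
  ring

theorem conj_diag_trace {n : ℕ} {U : Matrix (Fin n) (Fin n) ℂ} (hU : U.conjTranspose * U = 1)
    (d : Fin n → ℂ) : (U * Matrix.diagonal d * U.conjTranspose).trace = ∑ i, d i := by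
  rw [Matrix.trace_mul_comm, ← Matrix.mul_assoc, hU, Matrix.one_mul, Matrix.trace_diagonal]

theorem conj_diag_posSemidef {n : ℕ} (U : Matrix (Fin n) (Fin n) ℂ) {d : Fin n → ℝ}
    (hd : ∀ i, 0 ≤ d i) :
    (U * Matrix.diagonal (fun i => (d i : ℂ)) * U.conjTranspose).PosSemidef :=
  (Matrix.PosSemidef.diagonal fun i => by simpa using hd i).mul_mul_conjTranspose_same U

/-- Power iteration: after normalisation by the trace, the powers converge to the projection onto
the top eigenspace divided by its dimension. A pointwise limit of measurable functions of `S` is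
measurable whatever the multiplicities, and every nonzero column of the limit is a top eigenvector.
-/
theorem exists_power_limit {n : ℕ} {S : Matrix (Fin n) (Fin n) ℂ} (hS : S.PosSemidef) :
    ∃ Q : Matrix (Fin n) (Fin n) ℂ,
      (∀ i j, Tendsto (fun k => (S ^ k) i j / (S ^ k).trace) atTop (𝓝 (Q i j))) ∧
      (S ≠ 0 → Q ≠ 0 ∧ ∃ μ : ℝ, 0 < μ ∧ S * Q = (μ : ℂ) • Q ∧
        ((μ : ℂ) • (1 : Matrix (Fin n) (Fin n) ℂ) - S).PosSemidef) := by
  by_cases hS0 : S = 0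
  · refine ⟨0, fun i j => ?_, fun h => absurd hS0 h⟩
    refine tendsto_const_nhds.congr' ?_
    -- The power zero is the identity even when `S = 0`, so the first term is dropped.
    filter_upwards [eventually_ge_atTop 1] with k hk
    rw [hS0, zero_pow (by omega)]
    simp
  obtain ⟨U, d, hU, hU', hd, hSU⟩ := exists_diag hS
  have hne : Nonempty (Fin n) := by
    by_contra h
    rw [not_nonempty_iff] at h
    exact hS0 (Subsingleton.elim _ _)
  obtain ⟨i0, hi0⟩ := Finite.exists_max d
  have hμ : 0 < d i0 := by
    refine lt_of_le_of_ne (hd i0) fun h => hS0 ?_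
    have : (fun i => (d i : ℂ)) = fun _ => 0 := by
      ext i
      have := le_antisymm (h ▸ hi0 i) (hd i)
      simp [this]
    rw [hSU, this]
    simp
  set w : Fin n → ℝ := fun l => if d l = d i0 then 1 else 0 with hw
  have hlim : ∀ l, Tendsto (fun k => (d l / d i0) ^ k) atTop (𝓝 (w l)) := by
    intro l
    by_cases h : d l = d i0
    · simp [hw, h, div_self hμ.ne']
    · simp only [hw, h, if_false]
      refine tendsto_pow_atTop_nhds_zero_of_lt_one (div_nonneg (hd l) hμ.le) ?_
      rw [div_lt_one hμ]
      exact lt_of_le_of_ne (hi0 l) h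
  have hsum : 0 < ∑ m, w m := by
    refine Finset.sum_pos' (fun i _ => by simp only [hw]; split_ifs <;> norm_num)
      ⟨i0, Finset.mem_univ _, by simp [hw]⟩
  have hlim' : ∀ l, Tendsto (fun k => ((d l ^ k / ∑ m, d m ^ k : ℝ) : ℂ)) atTop
      (𝓝 ((w l / ∑ m, w m : ℝ) : ℂ)) := by
    intro l
    refine (Complex.continuous_ofReal.tendsto _).comp ?_
    have := (hlim l).div (tendsto_finsetSum Finset.univ fun m _ => hlim m) hsum.ne'
    refine this.congr fun k => ?_
    simp only [Pi.div_apply, div_pow]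
    rw [← Finset.sum_div, div_div_div_cancel_right₀ (pow_ne_zero _ hμ.ne')]
  set q : Fin n → ℂ := fun l => ((w l / ∑ m, w m : ℝ) : ℂ) with hq
  refine ⟨U * Matrix.diagonal q * U.conjTranspose, fun i j => ?_, fun _ => ⟨?_, d i0, hμ, ?_, ?_⟩⟩
  · rw [conj_diag_apply]
    have := tendsto_finsetSum Finset.univ fun l (_ : l ∈ Finset.univ) =>
      (hlim' l).const_mul (U i l * star (U j l))
    refine this.congr fun k => ?_
    rw [hSU, conj_diag_pow hU hU', conj_diag_trace hU, conj_diag_apply, Finset.sum_div]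
    refine Finset.sum_congr rfl fun l _ => ?_
    push_cast
    ring
  · intro h
    have h1 : (U * Matrix.diagonal q * U.conjTranspose).trace = 1 := by
      rw [conj_diag_trace hU]
      simp only [hq]
      rw [← Complex.ofReal_sum, ← Finset.sum_div, div_self hsum.ne']
      simp
    rw [h] at h1
    simp at h1
  · conv_lhs => rw [hSU]
    calc _ = U * Matrix.diagonal (fun i => (d i : ℂ)) * (U.conjTranspose * U) * Matrix.diagonal q
        * U.conjTranspose := by simp only [Matrix.mul_assoc]
      _ = U * Matrix.diagonal (fun i => (d i : ℂ) * q i) * U.conjTranspose := by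
        rw [hU, Matrix.mul_one, Matrix.mul_assoc U, Matrix.diagonal_mul_diagonal]
      _ = U * ((d i0 : ℂ) • Matrix.diagonal q) * U.conjTranspose := by
        congr 2
        rw [← Matrix.diagonal_smul]
        congr 1
        ext i
        simp only [Pi.smul_apply, smul_eq_mul, hq, hw]
        split_ifs with h
        · rw [h]
        · simp
      _ = _ := by simp
  · have : (d i0 : ℂ) • (1 : Matrix (Fin n) (Fin n) ℂ) - S
        = U * Matrix.diagonal (fun i => ((d i0 - d i : ℝ) : ℂ)) * U.conjTranspose := by
      have e : Matrix.diagonal (fun i => ((d i0 - d i : ℝ) : ℂ))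
          = (d i0 : ℂ) • (1 : Matrix (Fin n) (Fin n) ℂ) - Matrix.diagonal (fun i => (d i : ℂ)) := by
        ext i j
        by_cases h : i = j
        · subst h; simp
        · simp [h]
      rw [e, Matrix.mul_sub, Matrix.sub_mul, ← hSU]
      simp [hU']
    rw [this]
    exact conj_diag_posSemidef U fun i => sub_nonneg.mpr (hi0 i)

section Measurability

variable {α : Type*} [MeasurableSpace α]

/-- Entrywise measurability of a matrix-valued function. -/
def EntryMeas {p q : ℕ} (F : α → Matrix (Fin p) (Fin q) ℂ) : Prop :=
  ∀ i j, Measurable fun a => F a i j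

theorem EntryMeas.mul {p q r : ℕ} {F : α → Matrix (Fin p) (Fin q) ℂ}
    {G : α → Matrix (Fin q) (Fin r) ℂ} (hF : EntryMeas F) (hG : EntryMeas G) :
    EntryMeas fun a => F a * G a := by
  intro i j
  simp only [Matrix.mul_apply]
  exact Finset.measurable_sum _ fun k _ => (hF i k).mul (hG k j)

theorem EntryMeas.add {p q : ℕ} {F G : α → Matrix (Fin p) (Fin q) ℂ}
    (hF : EntryMeas F) (hG : EntryMeas G) : EntryMeas fun a => F a + G a :=
  fun i j => (hF i j).add (hG i j)

theorem EntryMeas.sub {p q : ℕ} {F G : α → Matrix (Fin p) (Fin q) ℂ}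
    (hF : EntryMeas F) (hG : EntryMeas G) : EntryMeas fun a => F a - G a :=
  fun i j => (hF i j).sub (hG i j)

theorem EntryMeas.smul {p q : ℕ} {F : α → Matrix (Fin p) (Fin q) ℂ} {c : α → ℂ}
    (hc : Measurable c) (hF : EntryMeas F) : EntryMeas fun a => c a • F a :=
  fun i j => hc.mul (hF i j)

theorem EntryMeas.conjTranspose {p q : ℕ} {F : α → Matrix (Fin p) (Fin q) ℂ}
    (hF : EntryMeas F) : EntryMeas fun a => (F a).conjTranspose :=
  fun i j => continuous_star.measurable.comp (hF j i)

theorem EntryMeas.const {p q : ℕ} (A : Matrix (Fin p) (Fin q) ℂ) :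
    EntryMeas fun _ : α => A := fun _ _ => measurable_const

theorem EntryMeas.sum {ι : Type*} {p q : ℕ} {F : ι → α → Matrix (Fin p) (Fin q) ℂ}
    (s : Finset ι) (hF : ∀ i, EntryMeas (F i)) : EntryMeas fun a => ∑ i ∈ s, F i a := by
  intro i j
  simp only [Matrix.sum_apply]
  exact Finset.measurable_sum _ fun k _ => hF k i j

theorem EntryMeas.pow {n : ℕ} {F : α → Matrix (Fin n) (Fin n) ℂ} (hF : EntryMeas F) (k : ℕ) :
    EntryMeas fun a => F a ^ k := by
  induction k with
  | zero => simp only [pow_zero]; exact EntryMeas.const 1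
  | succ k ih => simp only [pow_succ]; exact ih.mul hF

theorem EntryMeas.trace {n : ℕ} {F : α → Matrix (Fin n) (Fin n) ℂ} (hF : EntryMeas F) :
    Measurable fun a => (F a).trace := by
  simp only [Matrix.trace, Matrix.diag]
  exact Finset.measurable_sum _ fun k _ => hF k k

theorem EntryMeas.comp {β : Type*} [MeasurableSpace β] {p q : ℕ}
    {F : α → Matrix (Fin p) (Fin q) ℂ} (hF : EntryMeas F) {g : β → α} (hg : Measurable g) :
    EntryMeas fun b => F (g b) := fun i j => (hF i j).comp hg

/-- A measurable choice of a nonzero column. -/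
theorem exists_measurable_column {n : ℕ} {Q : α → Matrix (Fin n) (Fin n) ℂ} (hQ : EntryMeas Q) :
    ∃ v : α → Fin n → ℂ, (∀ i, Measurable fun a => v a i) ∧
      ∀ a, Q a ≠ 0 → v a ≠ 0 ∧ ∃ j, v a = fun i => Q a i j := by
  classical
  -- The search is for the first nonzero column; the alternative `n ≤ k` only makes it terminate
  -- when the matrix is zero.
  let p : α → ℕ → Prop := fun a k => n ≤ k ∨ ∃ (h : k < n) (i : Fin n), Q a i ⟨k, h⟩ ≠ 0
  have hp : ∀ a, ∃ k, p a k := fun a => ⟨n, Or.inl le_rfl⟩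
  have hm : ∀ k, MeasurableSet {a | p a k} := by
    intro k
    by_cases hk : n ≤ k
    · have : {a | p a k} = Set.univ := by ext; simp [p, hk]
      rw [this]; exact MeasurableSet.univ
    · have hk' : k < n := not_le.mp hk
      have : {a | p a k} = ⋃ i : Fin n, {a | Q a i ⟨k, hk'⟩ ≠ 0} := by
        ext a; simp [p, hk, hk']
      rw [this]
      exact MeasurableSet.iUnion fun i => (hQ i ⟨k, hk'⟩) (measurableSet_singleton 0).compl
  have hfind := measurable_find hp hm
  let col : Fin n → α × ℕ → ℂ := fun i x => if h : x.2 < n then Q x.1 i ⟨x.2, h⟩ else 0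
  have hcol : ∀ i, Measurable (col i) := fun i => by
    refine measurable_from_prod_countable_left fun k => ?_
    by_cases h : k < n
    · simp only [col, h, dif_pos]; exact hQ i ⟨k, h⟩
    · simp only [col, h, dif_neg, not_false_iff]; exact measurable_const
  refine ⟨fun a i => col i (a, Nat.find (hp a)),
    fun i => (hcol i).comp (measurable_id.prodMk hfind), fun a ha => ?_⟩
  obtain ⟨i, j, hij⟩ : ∃ i j, Q a i j ≠ 0 := by
    by_contra! h
    exact ha (by ext i j; simp [h i j])
  have hlt : Nat.find (hp a) < n := lt_of_le_of_lt
    (Nat.find_min' (hp a) (Or.inr ⟨j.2, i, hij⟩)) j.2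
  rcases Nat.find_spec (hp a) with h | ⟨h, i', hi'⟩
  · omega
  · refine ⟨fun h0 => hi' ?_, ⟨_, h⟩, ?_⟩
    · have := congrFun h0 i'
      simpa [col, hlt] using this
    · ext i
      simp [col, hlt]

/-- Measurable selection of a unit eigenvector for the largest eigenvalue. -/
theorem exists_measurable_top {n : ℕ} {S : α → Matrix (Fin n) (Fin n) ℂ} (hm : EntryMeas S)
    (hS : ∀ a, (S a).PosSemidef) :
    ∃ (v : α → Fin n → ℂ) (μ : α → ℝ), (∀ i, Measurable fun a => v a i) ∧ Measurable μ ∧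
      (∀ a, S a = 0 → v a = 0 ∧ μ a = 0) ∧
      ∀ a, S a ≠ 0 → 0 < μ a ∧ star (v a) ⬝ᵥ v a = 1 ∧ (S a).mulVec (v a) = (μ a : ℂ) • v a ∧
        ((μ a : ℂ) • (1 : Matrix (Fin n) (Fin n) ℂ) - S a).PosSemidef := by
  classical
  choose Q hQlim hQ using fun a => exists_power_limit (hS a)
  have hQm : EntryMeas Q := fun i j =>
    measurable_of_tendsto_metrizable (fun k => ((hm.pow k) i j).div (hm.pow k).trace)
      (tendsto_pi_nhds.mpr fun a => hQlim a i j)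
  obtain ⟨u, hum, hu⟩ := exists_measurable_column hQm
  set r : α → ℝ := fun a => √(∑ i, ‖u a i‖ ^ 2) with hr
  have hrm : Measurable r := by
    refine Measurable.sqrt (Finset.measurable_sum _ fun i _ => ?_)
    exact (hum i).norm.pow_const 2
  have h0 : MeasurableSet {a | S a = 0} := by
    have : {a | S a = 0} = ⋂ i, ⋂ j, {a | S a i j = 0} := by
      ext a
      simp only [Set.mem_ofPred_eq, Set.mem_iInter]
      exact ⟨fun h i j => by rw [h]; rfl, fun h => by ext i j; exact h i j⟩
    rw [this]
    exact MeasurableSet.iInter fun i => MeasurableSet.iInter fun j =>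
      hm i j (measurableSet_singleton 0)
  let v : α → Fin n → ℂ := fun a i => if S a = 0 then 0 else u a i / r a
  have hv : ∀ i, Measurable fun a => v a i := fun i =>
    Measurable.ite h0 measurable_const ((hum i).div (Complex.measurable_ofReal.comp hrm))
  -- The eigenvalue is taken as the Rayleigh quotient of the selected vector, which makes it
  -- measurable.
  refine ⟨v, fun a => (star (v a) ⬝ᵥ (S a).mulVec (v a)).re, hv, ?_, ?_, ?_⟩
  · refine Complex.measurable_re.comp ?_
    simp only [dotProduct, Matrix.mulVec]
    exact Finset.measurable_sum _ fun i _ => (continuous_star.measurable.comp (hv i)).mul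
      (Finset.measurable_sum _ fun j _ => (hm i j).mul (hv j))
  · intro a ha
    have : v a = 0 := by ext i; simp [v, ha]
    simp [this]
  · intro a ha
    obtain ⟨hQ0, μ, hμ, hSQ, hpsd⟩ := hQ a ha
    obtain ⟨hu0, j, huj⟩ := hu a hQ0
    have hva : v a = (r a : ℂ)⁻¹ • u a := by
      ext i; simp [v, ha, div_eq_inv_mul]
    have hnn : 0 ≤ ∑ i, ‖u a i‖ ^ 2 := Finset.sum_nonneg fun i _ => sq_nonneg _
    have hrpos : 0 < r a := by
      refine Real.sqrt_pos.mpr (lt_of_le_of_ne hnn fun h => hu0 ?_)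
      ext i
      have := (Finset.sum_eq_zero_iff_of_nonneg fun i _ => sq_nonneg ‖u a i‖).mp h.symm i
        (Finset.mem_univ i)
      simpa using this
    have hun : star (u a) ⬝ᵥ u a = ((r a ^ 2 : ℝ) : ℂ) := by
      rw [hr, Real.sq_sqrt hnn]
      simp only [dotProduct, Pi.star_apply]
      push_cast
      refine Finset.sum_congr rfl fun i _ => ?_
      rw [← starRingEnd_apply, Complex.conj_mul']
    have hvn : star (v a) ⬝ᵥ v a = 1 := by
      rw [hva, star_smul, smul_dotProduct, dotProduct_smul, hun]
      have : (r a : ℂ) ≠ 0 := by exact_mod_cast hrpos.ne'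
      simp
      field_simp
    have hSu : (S a).mulVec (u a) = (μ : ℂ) • u a := by
      rw [huj]
      ext i
      have := congrFun (congrFun hSQ i) j
      rw [Matrix.mul_apply] at this
      simpa [Matrix.mulVec, dotProduct] using this
    have hSv : (S a).mulVec (v a) = (μ : ℂ) • v a := by
      rw [hva, Matrix.mulVec_smul, hSu, smul_comm]
    have hμe : (star (v a) ⬝ᵥ (S a).mulVec (v a)).re = μ := by
      rw [hSv, dotProduct_smul, hvn]; simp
    beta_reduce
    rw [hμe]
    exact ⟨hμ, hvn, hSv, hpsd⟩

/-- The projection `P` onto the eigenvector commutes with `S`, so removing the eigenvalue is the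
compression of `S` by `1 - P`. -/
theorem deflate_posSemidef {n : ℕ} {S : Matrix (Fin n) (Fin n) ℂ} (hS : S.PosSemidef)
    {v : Fin n → ℂ} {μ : ℝ} (hv : star v ⬝ᵥ v = 1) (hSv : S.mulVec v = (μ : ℂ) • v) :
    (S - (μ : ℂ) • Matrix.vecMulVec v (star v)).PosSemidef := by
  set P := Matrix.vecMulVec v (star v) with hP
  have hPP : P * P = P := by
    rw [hP, Matrix.vecMulVec_mul_vecMulVec, hv]; simp
  have hPh : P.conjTranspose = P := by
    rw [hP, Matrix.conjTranspose_vecMulVec, star_star]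
  have hSP : S * P = (μ : ℂ) • P := by
    rw [hP, Matrix.mul_vecMulVec, hSv, Matrix.smul_vecMulVec]
  have hPS : P * S = (μ : ℂ) • P := by
    have := congrArg Matrix.conjTranspose hSP
    rw [Matrix.conjTranspose_mul, hPh, hS.isHermitian.eq, Matrix.conjTranspose_smul, hPh] at this
    simpa using this
  have : S - (μ : ℂ) • P = (1 - P).conjTranspose * S * (1 - P) := by
    rw [Matrix.conjTranspose_sub, hPh, Matrix.conjTranspose_one, Matrix.sub_mul, Matrix.one_mul,
      hPS, Matrix.mul_sub, Matrix.mul_one, Matrix.sub_mul, hSP, Matrix.smul_mul, hPP]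
    simp
  rw [this]
  exact hS.conjTranspose_mul_mul_same _

theorem vecMulVec_star_mulVec {n : ℕ} (v w : Fin n → ℂ) :
    (Matrix.vecMulVec v (star v)).mulVec w = (star v ⬝ᵥ w) • v := by
  rw [Matrix.vecMulVec_mulVec]
  ext i
  simp [mul_comm]

/-- Each deflation puts the removed eigenvector into the kernel of all later stages, and
eigenvectors of a Hermitian matrix for a nonzero eigenvalue are orthogonal to its kernel; this gives
orthogonality. Positive definiteness of `T 0` prevents the process from reaching zero before step
`n`. Thereafter the zero convention for `v` and `μ` keeps the recursion valid. -/
theorem deflation_spec {n : ℕ} {T : ℕ → Matrix (Fin n) (Fin n) ℂ} {v : ℕ → Fin n → ℂ}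
    {μ : ℕ → ℝ} (h0 : (T 0).PosDef) (hT : ∀ k, (T k).PosSemidef)
    (hstep : ∀ k, T (k + 1) = T k - (μ k : ℂ) • Matrix.vecMulVec (v k) (star (v k)))
    (hzero : ∀ k, T k = 0 → v k = 0 ∧ μ k = 0)
    (hne : ∀ k, T k ≠ 0 → 0 < μ k ∧ star (v k) ⬝ᵥ v k = 1 ∧ (T k).mulVec (v k) = (μ k : ℂ) • v k ∧
      ((μ k : ℂ) • (1 : Matrix (Fin n) (Fin n) ℂ) - T k).PosSemidef) :
    Antitone μ ∧ (∀ i j : Fin n, star (v i) ⬝ᵥ v j = if i = j then 1 else 0) ∧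
      ∀ j : Fin n, (T 0).mulVec (v j) = (μ j : ℂ) • v j := by
  have hTv : ∀ k, (T k).mulVec (v k) = (μ k : ℂ) • v k := by
    intro k
    by_cases h : T k = 0
    · simp [(hzero k h).1]
    · exact (hne k h).2.2.1
  have hker : ∀ k, ∀ i < k, (T k).mulVec (v i) = 0 := by
    intro k
    induction k with
    | zero => intro i hi; omega
    | succ k ih =>
      intro i hi
      rw [hstep, Matrix.sub_mulVec, Matrix.smul_mulVec, vecMulVec_star_mulVec]
      by_cases h : T k = 0
      · simp [h, (hzero k h).1]
      obtain ⟨hμ, hvv, hev, -⟩ := hne k h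
      rcases Nat.lt_succ_iff_lt_or_eq.mp hi with hlt | rfl
      · rw [ih i hlt]
        have h1 : star (v k) ⬝ᵥ v i = 0 := by
          have e1 : star ((T k).mulVec (v k)) ⬝ᵥ v i = 0 := by
            rw [Matrix.star_mulVec, ← Matrix.dotProduct_mulVec, (hT k).isHermitian.eq, ih i hlt]
            simp
          rw [hev, star_smul, smul_dotProduct] at e1
          have : (star (μ k : ℂ)) ≠ 0 := by simpa using hμ.ne'
          exact (smul_eq_zero.mp e1).resolve_left this
        simp [h1]
      · rw [hev, hvv]; simp
  have horth : ∀ k, ∀ i < k, star (v k) ⬝ᵥ v i = 0 := by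
    intro k i hi
    by_cases h : T k = 0
    · simp [(hzero k h).1]
    obtain ⟨hμ, hvv, hev, -⟩ := hne k h
    have e1 : star ((T k).mulVec (v k)) ⬝ᵥ v i = 0 := by
      rw [Matrix.star_mulVec, ← Matrix.dotProduct_mulVec, (hT k).isHermitian.eq, hker k i hi]
      simp
    rw [hev, star_smul, smul_dotProduct] at e1
    have : (star (μ k : ℂ)) ≠ 0 := by simpa using hμ.ne'
    exact (smul_eq_zero.mp e1).resolve_left this
  have hsum : ∀ k w, (∀ i < k, star (v i) ⬝ᵥ w = 0) → (T k).mulVec w = (T 0).mulVec w := by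
    intro k w
    induction k with
    | zero => intro _; rfl
    | succ k ih =>
      intro hw
      rw [hstep, Matrix.sub_mulVec, Matrix.smul_mulVec, vecMulVec_star_mulVec,
        hw k (Nat.lt_succ_self k), ih fun i hi => hw i (Nat.lt_succ_of_lt hi)]
      simp
  -- Fewer than `n` vectors leave a nonzero `w` orthogonal to all of them. On `w` the stages `T k`
  -- and `T 0` agree, and `T 0` is positive definite.
  have hT0 : ∀ k < n, T k ≠ 0 := by
    intro k hk h
    let A : Matrix (Fin k) (Fin n) ℂ := Matrix.of fun i => star (v i)
    have : LinearMap.ker A.mulVecLin ≠ ⊥ := by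
      apply LinearMap.ker_ne_bot_of_finrank_lt
      simpa using hk
    obtain ⟨w, hw, hw0⟩ := Submodule.exists_mem_ne_zero_of_ne_bot this
    have h1 := hsum k w fun i hi => by
      have := congrFun (LinearMap.mem_ker.mp hw) ⟨i, hi⟩
      exact this
    rw [h, Matrix.zero_mulVec] at h1
    have := h0.dotProduct_mulVec_pos hw0
    rw [← h1] at this
    simp at this
  refine ⟨antitone_nat_of_succ_le fun k => ?_, fun i j => ?_, fun j => ?_⟩
  · by_cases h : T (k + 1) = 0
    · rw [(hzero _ h).2]
      by_cases h' : T k = 0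
      · rw [(hzero _ h').2]
      · exact (hne k h').1.le
    · have hk : T k ≠ 0 := fun h' => h (by rw [hstep, h', (hzero k h').2]; simp)
      obtain ⟨-, hvv, hev, -⟩ := hne (k + 1) h
      obtain ⟨-, -, -, hpsd⟩ := hne k hk
      -- The next eigenvector is orthogonal to the current one, so it is already an eigenvector of
      -- `T k` with eigenvalue `μ (k + 1)`, and `T k` is bounded above by `μ k`.
      have h1 := hpsd.dotProduct_mulVec_nonneg (v (k + 1))
      have h2 : (T k).mulVec (v (k + 1)) = (μ (k + 1) : ℂ) • v (k + 1) := by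
        rw [← hev, hstep, Matrix.sub_mulVec, Matrix.smul_mulVec, vecMulVec_star_mulVec]
        have : star (v k) ⬝ᵥ v (k + 1) = 0 := by
          have := horth (k + 1) k (Nat.lt_succ_self k)
          rw [← star_eq_zero, Matrix.star_dotProduct, star_star]
          exact this
        simp [this]
      rw [Matrix.sub_mulVec, h2, Matrix.smul_mulVec, Matrix.one_mulVec, ← sub_smul,
        dotProduct_smul, hvv, smul_eq_mul, mul_one, ← Complex.ofReal_sub] at h1
      have : (0 : ℝ) ≤ μ k - μ (k + 1) := by exact_mod_cast h1
      linarith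
  · by_cases hij : i = j
    · subst hij
      rw [if_pos rfl]
      exact (hne i (hT0 i i.2)).2.1
    · rw [if_neg hij]
      rcases lt_or_gt_of_ne (Fin.val_ne_of_ne hij) with h | h
      · rw [← star_eq_zero, Matrix.star_dotProduct, star_star]
        exact horth j i h
      · exact horth i j h
  · rw [← hTv, hsum j (v j)]
    intro i hi
    rw [← star_eq_zero, Matrix.star_dotProduct, star_star]
    exact horth j i hi

/-- Measurable diagonalization with eigenvalues in descending order. -/
theorem exists_measurable_diag {n : ℕ} {S : α → Matrix (Fin n) (Fin n) ℂ} (hm : EntryMeas S)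
    (hS : ∀ a, (S a).PosSemidef) :
    ∃ (W : α → Matrix (Fin n) (Fin n) ℂ) (d : α → Fin n → ℝ), EntryMeas W ∧
      (∀ i, Measurable fun a => d a i) ∧ ∀ a, (W a).conjTranspose * W a = 1 ∧
      W a * (W a).conjTranspose = 1 ∧ Antitone (d a) ∧ (∀ i, 0 ≤ d a i) ∧
      S a = W a * Matrix.diagonal (fun i => (d a i : ℂ)) * (W a).conjTranspose := by
  -- Bundling the hypotheses into a type makes the selection a function on all admissible families,
  -- so that the deflation can be iterated.
  let Fam := {S : α → Matrix (Fin n) (Fin n) ℂ // EntryMeas S ∧ ∀ a, (S a).PosSemidef}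
  choose v μ hv hμ hzero hne using fun T : Fam => exists_measurable_top T.2.1 T.2.2
  have hdef : ∀ T : Fam, ∀ a,
      (T.1 a - (μ T a : ℂ) • Matrix.vecMulVec (v T a) (star (v T a))).PosSemidef := by
    intro T a
    by_cases h : T.1 a = 0
    · rw [(hzero T a h).1, h]; simpa using Matrix.PosSemidef.zero
    · exact deflate_posSemidef (T.2.2 a) (hne T a h).2.1 (hne T a h).2.2.1
  let step : Fam → Fam := fun T => ⟨fun a =>
    T.1 a - (μ T a : ℂ) • Matrix.vecMulVec (v T a) (star (v T a)),
    T.2.1.sub (EntryMeas.smul (Complex.measurable_ofReal.comp (hμ T)) fun i j =>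
      (hv T i).mul (continuous_star.measurable.comp (hv T j))), hdef T⟩
  -- Adding the identity makes the start positive definite, so that deflation yields a full
  -- orthonormal basis; the eigenvalues are shifted back by one at the end.
  let S0 : Fam := ⟨fun a => S a + 1, hm.add (EntryMeas.const 1),
    fun a => (hS a).add Matrix.PosSemidef.one⟩
  let T : ℕ → Fam := fun k => step^[k] S0
  have hTs : ∀ k, T (k + 1) = step (T k) := fun k => Function.iterate_succ_apply' _ _ _
  have key := fun a => deflation_spec (T := fun k => (T k).1 a) (v := fun k => v (T k) a)
    (μ := fun k => μ (T k) a) (Matrix.PosDef.one.posSemidef_add (hS a)) (fun k => (T k).2.2 a)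
    (fun k => by rw [hTs]) (fun k => hzero (T k) a) (fun k => hne (T k) a)
  let W : α → Matrix (Fin n) (Fin n) ℂ := fun a => Matrix.of fun i j => v (T j) a i
  have hW : ∀ a, (W a).conjTranspose * W a = 1 := by
    intro a
    ext i j
    rw [Matrix.mul_apply, Matrix.one_apply, ← (key a).2.1 i j]
    rfl
  have hSv : ∀ a, S a * W a
      = W a * Matrix.diagonal (fun i : Fin n => ((μ (T i) a - 1 : ℝ) : ℂ)) := by
    intro a
    ext i j
    have := congrFun ((key a).2.2 j) i
    change ((S a + 1).mulVec (v (T j) a)) i = _ at this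
    rw [Matrix.add_mulVec, Matrix.one_mulVec, Pi.add_apply] at this
    rw [Matrix.mul_diagonal]
    change (S a).mulVec (v (T j) a) i = v (T j) a i * _
    rw [eq_sub_of_add_eq this, Pi.smul_apply, smul_eq_mul]
    push_cast
    ring
  have hWW : ∀ a, W a * (W a).conjTranspose = 1 := fun a => mul_eq_one_comm.mp (hW a)
  refine ⟨W, fun a i => μ (T i) a - 1, fun i j => hv _ _, fun i => (hμ _).sub_const 1,
    fun a => ⟨hW a, hWW a, fun i j hij => sub_le_sub_right ((key a).1 hij) 1, fun i => ?_, ?_⟩⟩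
  · have h1 : ((W a).conjTranspose * S a * W a) i i = ((μ (T i) a - 1 : ℝ) : ℂ) := by
      rw [Matrix.mul_assoc, hSv, ← Matrix.mul_assoc, hW, Matrix.one_mul, Matrix.diagonal_apply_eq]
    have h2 := ((hS a).conjTranspose_mul_mul_same (W a)).diag_nonneg (i := i)
    rw [h1] at h2
    exact_mod_cast h2
  · rw [← hSv, Matrix.mul_assoc, hWW, Matrix.mul_one]

end Measurability

/-! ### Singular values -/

theorem toEuclideanLin_adjoint_comp {p q : ℕ} (A : Matrix (Fin p) (Fin q) ℂ) :
    LinearMap.adjoint (Matrix.toEuclideanLin A) ∘ₗ Matrix.toEuclideanLin A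
      = Matrix.toEuclideanLin (A.conjTranspose * A) := by
  rw [← Matrix.toEuclideanLin_conjTranspose_eq_adjoint]
  ext v
  simp [Matrix.toLpLin_apply]

theorem charpoly_toEuclideanLin {q : ℕ} (A : Matrix (Fin q) (Fin q) ℂ) :
    (Matrix.toEuclideanLin A).charpoly = A.charpoly := by
  rw [Matrix.toEuclideanLin_eq_toLin_orthonormal, Matrix.charpoly_toLin]

theorem singVal_nonneg {p q : ℕ} (A : Matrix (Fin p) (Fin q) ℂ) (i : ℕ) : 0 ≤ singVal A i :=
  LinearMap.singularValues_nonneg _ _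

theorem singVal_antitone {p q : ℕ} (A : Matrix (Fin p) (Fin q) ℂ) : Antitone (singVal A) :=
  LinearMap.singularValues_antitone _

theorem singVal_of_le {p q : ℕ} (A : Matrix (Fin p) (Fin q) ℂ) {i : ℕ} (hi : q ≤ i) :
    singVal A i = 0 :=
  LinearMap.singularValues_of_finrank_le _ (by simpa using hi)

/-- The squared singular values are the sorted roots of the characteristic polynomial of `Aᴴ A`, and
the entries of `d` are these roots already in descending order. -/
theorem singVal_sq_of_diag {p q : ℕ} {A : Matrix (Fin p) (Fin q) ℂ}
    {V : Matrix (Fin q) (Fin q) ℂ} (hV : V.conjTranspose * V = 1) {d : Fin q → ℝ}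
    (hd : Antitone d) (hA : A.conjTranspose * A
      = V * Matrix.diagonal (fun i => (d i : ℂ)) * V.conjTranspose) (i : Fin q) :
    singVal A i ^ 2 = d i := by
  have hn : Module.finrank ℂ (EuclideanSpace ℂ (Fin q)) = q := finrank_euclideanSpace_fin
  rw [singVal, LinearMap.sq_singularValues_fin _ hn]
  have hsymm := (Matrix.toEuclideanLin A).isSymmetric_adjoint_comp_self
  have h1 := hsymm.sort_roots_charpoly_eq_eigenvalues hn
  have hch : (LinearMap.adjoint (Matrix.toEuclideanLin A) ∘ₗ Matrix.toEuclideanLin A).charpoly.roots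
      = Multiset.map (fun i => (d i : ℂ)) Finset.univ.val := by
    rw [toEuclideanLin_adjoint_comp, hA, charpoly_toEuclideanLin, Matrix.charpoly_mul_comm,
      ← Matrix.mul_assoc, hV, Matrix.one_mul, Matrix.charpoly_diagonal, Polynomial.roots_prod _ _ (by
        simp [Finset.prod_ne_zero_iff, Polynomial.X_sub_C_ne_zero])]
    simp
  have h2 : List.ofFn d = List.ofFn (hsymm.eigenvalues hn) := by
    rw [← h1, hch]
    rw [Multiset.map_map, show (RCLike.re ∘ fun i => (d i : ℂ)) = d from
      funext fun i => RCLike.ofReal_re (K := ℂ) (d i), Fin.univ_val_map, Multiset.coe_sort]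
    symm
    convert! List.mergeSort_of_pairwise ?_
    simp_rw [decide_eq_true_eq, ← List.sortedGE_iff_pairwise]
    convert! hd.sortedGE_ofFn
  exact congrFun (List.ofFn_injective h2).symm i

theorem rectDiag_apply {p q : ℕ} (d : ℕ → ℝ) (i : Fin p) (j : Fin q) :
    rectDiag p q d i j = if (i : ℕ) = (j : ℕ) then (d i : ℂ) else 0 := rfl

theorem rectDiag_mul_apply {p q r : ℕ} (d : ℕ → ℝ) (B : Matrix (Fin q) (Fin r) ℂ) (i : Fin p)
    (k : Fin r) : (rectDiag p q d * B) i k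
      = if h : (i : ℕ) < q then (d i : ℂ) * B ⟨i, h⟩ k else 0 := by
  rw [Matrix.mul_apply]
  split_ifs with h
  · rw [Finset.sum_eq_single ⟨i, h⟩]
    · simp [rectDiag_apply]
    · intro j _ hj
      rw [rectDiag_apply, if_neg, zero_mul]
      exact fun h' => hj (Fin.ext h'.symm)
    · simp
  · refine Finset.sum_eq_zero fun j _ => ?_
    rw [rectDiag_apply, if_neg, zero_mul]
    exact fun h' => h (h' ▸ j.2)

theorem rectDiag_conjTranspose {p q : ℕ} (d : ℕ → ℝ) :
    (rectDiag p q d).conjTranspose = rectDiag q p d := by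
  ext i j
  simp only [Matrix.conjTranspose_apply, rectDiag_apply]
  by_cases h : (i : ℕ) = (j : ℕ)
  · rw [if_pos h.symm, if_pos h, h]; simp
  · rw [if_neg h, if_neg fun h' => h h'.symm]; simp

/-- The sequence `d` truncated to indices below `q`. -/
def trunc (q : ℕ) (d : ℕ → ℝ) (i : ℕ) : ℝ := if i < q then d i else 0

theorem rectDiag_mul_rectDiag {p q r : ℕ} (d e : ℕ → ℝ) :
    rectDiag p q d * rectDiag q r e = rectDiag p r (fun i => trunc q d i * e i) := by
  ext i k
  rw [rectDiag_mul_apply]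
  simp only [rectDiag_apply, trunc]
  split_ifs <;> simp_all

theorem rectDiag_self {p : ℕ} (d : ℕ → ℝ) :
    rectDiag p p d = Matrix.diagonal fun i : Fin p => (d i : ℂ) := by
  ext i j
  simp [rectDiag_apply, Matrix.diagonal_apply, Fin.ext_iff]

/-- Completing a left diagonalization to a singular value decomposition. -/
theorem exists_svd_of_left {p q : ℕ} {A : Matrix (Fin p) (Fin q) ℂ}
    {W : Matrix (Fin p) (Fin p) ℂ} (hW : W.conjTranspose * W = 1) {d : ℕ → ℝ}
    (hd : Antitone d) (hd0 : ∀ i, 0 ≤ d i) (hdp : ∀ i, p ≤ i → d i = 0)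
    (hA : A * A.conjTranspose = W * rectDiag p p d * W.conjTranspose) :
    (∀ i, singVal A i = √(d i)) ∧ ∃ V : Matrix (Fin q) (Fin q) ℂ, V.conjTranspose * V = 1 ∧
      A = W * rectDiag p q (singVal A) * V.conjTranspose := by
  have hW' : W * W.conjTranspose = 1 := mul_eq_one_comm.mp hW
  -- The rows of `B` are pairwise orthogonal with squared norms `d i`; normalised and conjugated,
  -- they are the wanted right-singular vectors.
  set B := W.conjTranspose * A with hB
  have hAB : A = W * B := by rw [hB, ← Matrix.mul_assoc, hW', Matrix.one_mul]
  have hBB : B * B.conjTranspose = rectDiag p p d := by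
    rw [hB, Matrix.conjTranspose_mul, Matrix.conjTranspose_conjTranspose]
    calc _ = W.conjTranspose * (A * A.conjTranspose) * W := by simp only [Matrix.mul_assoc]
      _ = (W.conjTranspose * W) * rectDiag p p d * (W.conjTranspose * W) := by
        rw [hA]; simp only [Matrix.mul_assoc]
      _ = _ := by rw [hW]; simp
  have hrow : ∀ i j : Fin p, ∑ k, B i k * star (B j k) = if i = j then (d i : ℂ) else 0 := by
    intro i j
    have := congrFun (congrFun hBB i) j
    rw [Matrix.mul_apply, rectDiag_apply] at this
    simpa [Fin.ext_iff] using this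
  -- Indexing by `ℕ`, with zero beyond `p`, lets the rows be indexed by `Fin q` as well, where the
  -- columns of `V` live.
  let R : ℕ → EuclideanSpace ℂ (Fin q) := fun j =>
    if h : j < p then WithLp.toLp 2 fun k => star (B ⟨j, h⟩ k) else 0
  have hR : ∀ j (h : j < p) k, R j k = star (B ⟨j, h⟩ k) := fun j h k => by simp [R, h]
  have hRR : ∀ i j (hi : i < p) (hj : j < p),
      inner ℂ (R i) (R j) = if i = j then (d i : ℂ) else 0 := by
    intro i j hi hj
    rw [PiLp.inner_apply]
    have := hrow ⟨i, hi⟩ ⟨j, hj⟩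
    simp only [Fin.mk.injEq] at this
    rw [← this]
    refine Finset.sum_congr rfl fun k _ => ?_
    rw [hR i hi, hR j hj, RCLike.inner_apply]
    simp [mul_comm]
  let u : Fin q → EuclideanSpace ℂ (Fin q) := fun j => ((√(d j))⁻¹ : ℂ) • R j
  let s : Set (Fin q) := {j | 0 < d j}
  have hsp : ∀ j : ℕ, 0 < d j → j < p := fun j hj => by
    by_contra h; rw [hdp j (not_lt.mp h)] at hj; exact lt_irrefl _ hj
  have hu : Orthonormal ℂ (s.domRestrict u) := by
    rw [orthonormal_iff_ite]
    rintro ⟨i, hi⟩ ⟨j, hj⟩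
    simp only [Set.domRestrict_apply, u, inner_smul_left, inner_smul_right]
    rw [hRR i j (hsp i hi) (hsp j hj)]
    have hi' : 0 < d i := hi
    have h1 : (√(d i) : ℂ) ≠ 0 := by exact_mod_cast (Real.sqrt_pos.mpr hi').ne'
    have h2 : (d i : ℂ) = √(d i) * √(d i) := by exact_mod_cast (Real.mul_self_sqrt hi'.le).symm
    by_cases h : i = j
    · subst h
      simp only [if_true]
      rw [h2]
      simp
      field_simp
    · rw [if_neg fun h' => h (Fin.ext h'), if_neg fun h' => h (by simpa using h')]
      simp
  obtain ⟨b, hb⟩ := hu.exists_orthonormalBasis_extension_of_card_eq (by simp)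
  let V : Matrix (Fin q) (Fin q) ℂ := Matrix.of fun i j => b j i
  have hV : V.conjTranspose * V = 1 := by
    ext i j
    have := orthonormal_iff_ite.mp b.orthonormal i j
    rw [PiLp.inner_apply] at this
    rw [Matrix.mul_apply, Matrix.one_apply, ← this]
    refine Finset.sum_congr rfl fun k _ => ?_
    rw [RCLike.inner_apply]
    simp [V, mul_comm]
  have hRb : ∀ j : Fin q, 0 < d j → R j = ((√(d j) : ℝ) : ℂ) • b j := by
    intro j hj
    rw [hb j hj]
    have h1 : (√(d j) : ℂ) ≠ 0 := by exact_mod_cast (Real.sqrt_pos.mpr hj).ne'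
    simp [u, smul_smul, h1]
  have hR0 : ∀ i (hi : i < p), d i = 0 → R i = 0 := by
    intro i hi h
    rw [← inner_self_eq_zero (𝕜 := ℂ), hRR i i hi hi, if_pos rfl, h]
    simp
  -- If `d i` were positive for some `i ≥ q`, the rows `0, …, q - 1` would already span the space,
  -- and row `i`, orthogonal to all of them, would vanish.
  have hdq : ∀ i, q ≤ i → d i = 0 := by
    intro i hi
    by_contra h
    have hpos : 0 < d i := lt_of_le_of_ne (hd0 i) (Ne.symm h)
    have hall : ∀ j ≤ i, 0 < d j := fun j hj => hpos.trans_le (hd hj)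
    have hz : R i = 0 := by
      refine InnerProductSpace.ext_inner_left_basis b.toBasis fun j => ?_
      have hj := hall j (j.2.le.trans hi)
      have h1 := hRR j i (hsp _ hj) (hsp _ hpos)
      rw [if_neg (by have := j.2; omega), hRb j hj, inner_smul_left] at h1
      have h2 : (starRingEnd ℂ) ((√(d j) : ℝ) : ℂ) ≠ 0 := by
        rw [Complex.conj_ofReal]
        exact_mod_cast (Real.sqrt_pos.mpr hj).ne'
      rw [OrthonormalBasis.coe_toBasis, inner_zero_right]
      exact (mul_eq_zero.mp h1).resolve_left h2
    have := hRR i i (hsp _ hpos) (hsp _ hpos)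
    rw [hz, inner_zero_left, if_pos rfl] at this
    exact h (by exact_mod_cast this.symm)
  have hBV : B = rectDiag p q (fun i => √(d i)) * V.conjTranspose := by
    ext i k
    rw [rectDiag_mul_apply]
    have e : B i k = star (R i k) := by rw [hR i i.2]; simp
    rw [e]
    split_ifs with h
    · by_cases hdi : d i = 0
      · rw [hR0 i i.2 hdi, hdi]; simp
      · have := hRb ⟨i, h⟩ (lt_of_le_of_ne (hd0 i) (Ne.symm hdi))
        simp only at this
        rw [this]
        simp [V]
    · rw [hR0 i i.2 (hdq i (not_lt.mp h))]; simp
  have hsv : ∀ i, singVal A i = √(d i) := by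
    intro i
    by_cases hi : i < q
    · have h2 : A.conjTranspose * A
          = V * Matrix.diagonal (fun j : Fin q => (d j : ℂ)) * V.conjTranspose := by
        have h3 : A.conjTranspose * A = B.conjTranspose * B := by
          rw [hAB, Matrix.conjTranspose_mul]
          calc _ = B.conjTranspose * (W.conjTranspose * W) * B := by simp only [Matrix.mul_assoc]
            _ = _ := by rw [hW, Matrix.mul_one]
        rw [h3, hBV, Matrix.conjTranspose_mul, Matrix.conjTranspose_conjTranspose,
          rectDiag_conjTranspose, ← rectDiag_self]
        have h4 : rectDiag q p (fun i => √(d i)) * rectDiag p q (fun i => √(d i))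
            = rectDiag q q d := by
          rw [rectDiag_mul_rectDiag]
          congr 1
          ext j
          simp only [trunc]
          split_ifs with hj
          · exact Real.mul_self_sqrt (hd0 j)
          · rw [hdp j (not_lt.mp hj)]; simp
        rw [← h4]
        simp only [Matrix.mul_assoc]
      have := singVal_sq_of_diag hV (fun a b hab => hd hab) h2 ⟨i, hi⟩
      rw [← Real.sqrt_sq (singVal_nonneg A i)]
      exact congrArg Real.sqrt this
    · rw [singVal_of_le A (not_lt.mp hi), hdq i (not_lt.mp hi)]; simp
  refine ⟨hsv, V, hV, ?_⟩
  rw [show singVal A = fun i => √(d i) from funext hsv, Matrix.mul_assoc, ← hBV, ← hAB]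

theorem extend_antitone {p : ℕ} {d : Fin p → ℝ} (hd : Antitone d) (hd0 : ∀ i, 0 ≤ d i) :
    Antitone (fun i : ℕ => if h : i < p then d ⟨i, h⟩ else 0) := by
  intro i j hij
  by_cases hj : j < p
  · have hi : i < p := lt_of_le_of_lt hij hj
    simp only [hi, hj, dif_pos]
    exact hd hij
  · simp only [hj, dif_neg, not_false_iff]
    split_ifs
    · exact hd0 _
    · exact le_rfl

/-- A left-singular-vector matrix depending measurably on the parameter; measurable singular
values. -/
theorem exists_measurable_left {α : Type*} [MeasurableSpace α] {p q : ℕ}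
    {A : α → Matrix (Fin p) (Fin q) ℂ}
    (hm : EntryMeas fun a => A a * (A a).conjTranspose) :
    (∀ i, Measurable fun a => singVal (A a) i) ∧
    ∃ W : α → Matrix (Fin p) (Fin p) ℂ, EntryMeas W ∧ ∀ a, (W a).conjTranspose * W a = 1 ∧
      W a * (W a).conjTranspose = 1 ∧
      A a * (A a).conjTranspose = W a * rectDiag p p (fun i => singVal (A a) i ^ 2)
        * (W a).conjTranspose ∧ ∀ i, p ≤ i → singVal (A a) i = 0 := by
  obtain ⟨W, d, hWm, hdm, h⟩ := exists_measurable_diag hm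
    fun a => Matrix.posSemidef_self_mul_conjTranspose (A a)
  let e : α → ℕ → ℝ := fun a i => if h : i < p then d a ⟨i, h⟩ else 0
  have he0 : ∀ a i, 0 ≤ e a i := fun a i => by
    simp only [e]; split_ifs
    · exact (h a).2.2.2.1 _
    · exact le_rfl
  have hep : ∀ a i, p ≤ i → e a i = 0 := fun a i hi => by simp [e, not_lt.mpr hi]
  have hdiag : ∀ a, Matrix.diagonal (fun i => (d a i : ℂ)) = rectDiag p p (e a) := fun a => by
    rw [rectDiag_self]; simp [e]
  have key := fun a => exists_svd_of_left (A := A a) (h a).1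
    (extend_antitone (h a).2.2.1 (h a).2.2.2.1) (he0 a) (hep a)
    (by rw [(h a).2.2.2.2, hdiag])
  have hs : ∀ a i, singVal (A a) i = √(e a i) := fun a => (key a).1
  refine ⟨fun i => ?_, W, hWm, fun a => ⟨(h a).1, (h a).2.1, ?_, fun i hi => ?_⟩⟩
  · simp only [hs]
    refine Measurable.sqrt ?_
    by_cases hi : i < p
    · simp only [e, hi, dif_pos]; exact hdm _
    · simp only [e, hi, dif_neg, not_false_iff]; exact measurable_const
  · rw [(h a).2.2.2.2, hdiag]
    congr 3
    ext i
    rw [hs, Real.sq_sqrt (he0 a i)]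
  · rw [hs, hep a i hi]; simp

theorem exists_svd {p q : ℕ} (A : Matrix (Fin p) (Fin q) ℂ) :
    (∀ i, p ≤ i → singVal A i = 0) ∧
    ∃ (W : Matrix (Fin p) (Fin p) ℂ) (V : Matrix (Fin q) (Fin q) ℂ), W.conjTranspose * W = 1 ∧
      V.conjTranspose * V = 1 ∧ A = W * rectDiag p q (singVal A) * V.conjTranspose := by
  -- A single matrix is a measurable family over a one-point space.
  obtain ⟨-, W₀, -, h⟩ := exists_measurable_left (α := Unit) (A := fun _ => A)
    fun _ _ => measurable_const
  obtain ⟨h1, -, h3, h4⟩ := h ()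
  have := exists_svd_of_left h1 (fun i j hij => pow_le_pow_left₀ (singVal_nonneg A j)
    (singVal_antitone A hij) 2) (fun i => sq_nonneg _) (fun i hi => by rw [h4 i hi]; simp) h3
  obtain ⟨-, V, hV, hA⟩ := this
  exact ⟨h4, W₀ (), V, h1, hV, hA⟩

/-! ### Frobenius norm identities -/

theorem frob_eq_trace {p q : ℕ} (A : Matrix (Fin p) (Fin q) ℂ) :
    (A * A.conjTranspose).trace = (frob A : ℂ) := by
  simp only [Matrix.trace, Matrix.diag, Matrix.mul_apply, Matrix.conjTranspose_apply, frob]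
  push_cast
  refine Finset.sum_congr rfl fun i _ => Finset.sum_congr rfl fun j _ => ?_
  rw [← starRingEnd_apply, Complex.mul_conj']

theorem frob_conjTranspose {p q : ℕ} (A : Matrix (Fin p) (Fin q) ℂ) :
    frob A.conjTranspose = frob A := by
  simp only [frob, Matrix.conjTranspose_apply, norm_star]
  exact Finset.sum_comm

theorem frob_mul_right {p q r : ℕ} (A : Matrix (Fin p) (Fin q) ℂ) {Q : Matrix (Fin q) (Fin r) ℂ}
    (hQ : Q * Q.conjTranspose = 1) : frob (A * Q) = frob A := by
  have h : ((frob (A * Q) : ℝ) : ℂ) = frob A := by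
    rw [← frob_eq_trace, ← frob_eq_trace, Matrix.conjTranspose_mul, Matrix.mul_assoc,
      ← Matrix.mul_assoc Q, hQ, Matrix.one_mul]
  exact_mod_cast h

theorem frob_mul_left {p q r : ℕ} (A : Matrix (Fin p) (Fin q) ℂ) {W : Matrix (Fin r) (Fin p) ℂ}
    (hW : W.conjTranspose * W = 1) : frob (W * A) = frob A := by
  rw [← frob_conjTranspose, Matrix.conjTranspose_mul, frob_mul_right _ (by simpa using hW),
    frob_conjTranspose]

theorem sum_fin_lt {q K : ℕ} (f : ℕ → ℝ) :
    ∑ j : Fin q, (if (j : ℕ) < K then f j else 0) = ∑ i ∈ Finset.range (min K q), f i := by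
  rw [Fin.sum_univ_eq_sum_range (fun j => if j < K then f j else 0) q, ← Finset.sum_filter]
  congr 1
  ext i
  simp
  tauto

theorem frob_rectDiag {p q : ℕ} (d : ℕ → ℝ) :
    frob (rectDiag p q d) = ∑ i ∈ Finset.range (min p q), d i ^ 2 := by
  rw [frob, ← sum_fin_lt, Finset.sum_comm]
  refine Finset.sum_congr rfl fun j _ => ?_
  simp only [rectDiag_apply]
  split_ifs with h
  · rw [Finset.sum_eq_single ⟨j, h⟩]
    · simp
    · intro i _ hi
      rw [if_neg fun h' => hi (Fin.ext h')]; simp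
    · simp
  · refine Finset.sum_eq_zero fun i _ => ?_
    rw [if_neg fun h' : (i : ℕ) = (j : ℕ) => h (h' ▸ i.2)]; simp

theorem frob_eq_sum_singVal {p q : ℕ} (A : Matrix (Fin p) (Fin q) ℂ) :
    frob A = ∑ i ∈ Finset.range q, singVal A i ^ 2 := by
  obtain ⟨h0, W, V, hW, hV, hA⟩ := exists_svd A
  conv_lhs => rw [hA]
  rw [frob_mul_right _ (by simpa using hV), frob_mul_left _ hW, frob_rectDiag]
  refine Finset.sum_subset (by intro i; simp) fun i _ hi' => ?_
  by_cases h : i < q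
  · rw [h0 i (by simp at hi'; omega)]; simp
  · rw [singVal_of_le A (not_lt.mp h)]; simp

theorem sum_range_min {r s : ℕ} {f : ℕ → ℝ} (h : ∀ i, r ≤ i → f i = 0) :
    ∑ i ∈ Finset.range (min r s), f i = ∑ i ∈ Finset.range s, f i :=
  Finset.sum_subset (Finset.range_mono (min_le_right _ _)) fun i hi hi' => h i (by
    rw [Finset.mem_range] at hi hi'
    omega)

/-! ### The pointwise optimization problem -/

/-- Scalar Wiener estimation: completing the square in `e` puts the minimum at `e = b h / (h² + c)`.
-/
theorem norm_sub_mul_sq_ge {b e : ℂ} {h c : ℝ} (hc : 0 < c) :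
    ‖b‖ ^ 2 - ‖b‖ ^ 2 * (h ^ 2 / (h ^ 2 + c)) ≤ ‖b - e * h‖ ^ 2 + c * ‖e‖ ^ 2 := by
  have hpos : 0 < h ^ 2 + c := by positivity
  simp only [Complex.sq_norm, Complex.normSq_apply, Complex.sub_re, Complex.sub_im,
    Complex.mul_re, Complex.mul_im, Complex.ofReal_re, Complex.ofReal_im, mul_zero, sub_zero,
    zero_add]
  have key : ∀ x y : ℝ, x * x - x * x * (h ^ 2 / (h ^ 2 + c))
      ≤ (x - y * h) * (x - y * h) + c * (y * y) := by
    intro x y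
    have : (x - y * h) * (x - y * h) + c * (y * y) - (x * x - x * x * (h ^ 2 / (h ^ 2 + c)))
        = (y * (h ^ 2 + c) - x * h) ^ 2 / (h ^ 2 + c) := by
      field_simp; ring
    have h2 : 0 ≤ (y * (h ^ 2 + c) - x * h) ^ 2 / (h ^ 2 + c) := by positivity
    linarith
  have h1 := key b.re e.re
  have h2 := key b.im e.im
  nlinarith [h1, h2]

/-- Power `d` earns `σ² d / (d + c)` and costs `l d`. For `σ ≥ τ` the difference between the two
sides is a perfect square, zero at `d + c = c σ / τ` when `τ > 0`; for `σ ≤ τ` the power never pays.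
With `τ = 1 / ζ` and `c = 2 ^ (-2 b)` the optimal `d` is the squared water-filling entry. -/
theorem soft_threshold_ge {σ d c l τ : ℝ} (hσ : 0 ≤ σ) (hd : 0 ≤ d) (hc : 0 < c)
    (hl : τ ^ 2 = c * l) : σ ^ 2 * (d / (d + c)) - l * d ≤ (max (σ - τ) 0) ^ 2 := by
  have hpos : 0 < d + c := by linarith
  have hl' : l = τ ^ 2 / c := by rw [hl]; field_simp
  rcases le_total τ σ with h | h
  · rw [max_eq_left (by linarith), hl']
    have : (σ - τ) ^ 2 - (σ ^ 2 * (d / (d + c)) - τ ^ 2 / c * d)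
        = (c * σ - (d + c) * τ) ^ 2 / (c * (d + c)) := by
      field_simp; ring
    have h2 : 0 ≤ (c * σ - (d + c) * τ) ^ 2 / (c * (d + c)) := by positivity
    linarith
  · rw [max_eq_right (by linarith), hl']
    have h1 : σ ^ 2 * (d / (d + c)) ≤ τ ^ 2 * (d / c) := by
      refine mul_le_mul (pow_le_pow_left₀ hσ h 2) ?_ (by positivity) (by positivity)
      exact div_le_div_of_nonneg_left hd hc (by linarith)
    have h2 : τ ^ 2 * (d / c) = τ ^ 2 / c * d := by ring
    linarith

/-- A weighted sum of a decreasing sequence with weights in `[0, 1]` of total mass `r` is at most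
the sum of the first `r` terms. -/
theorem sum_weights_le {q r : ℕ} (hr : r ≤ q) {w : Fin q → ℝ} (hw0 : ∀ i, 0 ≤ w i)
    (hw1 : ∀ i, w i ≤ 1) (hw : ∑ i, w i = r) {φ : ℕ → ℝ} (hφ : Antitone φ) :
    ∑ i, w i * φ i ≤ ∑ i ∈ Finset.range r, φ i := by
  have h1 : ∑ i ∈ Finset.range r, φ i = ∑ i : Fin q, (if (i : ℕ) < r then φ i else 0) := by
    rw [sum_fin_lt, min_eq_left hr]
  have h2 : (r : ℝ) = ∑ i : Fin q, (if (i : ℕ) < r then (1 : ℝ) else 0) := by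
    rw [sum_fin_lt (fun _ => 1), min_eq_left hr]; simp
  -- Relative to the level `φ r`, moving weight onto the first `r` indices can only help: in each
  -- term the two factors have the same sign.
  have h3 : 0 ≤ ∑ i : Fin q, ((if (i : ℕ) < r then (1 : ℝ) else 0) - w i) * (φ i - φ r) := by
    refine Finset.sum_nonneg fun i _ => ?_
    split_ifs with h
    · exact mul_nonneg (by linarith [hw1 i]) (by linarith [hφ h.le])
    · exact mul_nonneg_of_nonpos_of_nonpos (by linarith [hw0 i])
        (by linarith [hφ (not_lt.mp h)])
  have h4 : ∑ i : Fin q, ((if (i : ℕ) < r then (1 : ℝ) else 0) - w i) * (φ i - φ r)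
      = (∑ i : Fin q, (if (i : ℕ) < r then φ i else 0)) - ∑ i, w i * φ i
        - (∑ i : Fin q, (if (i : ℕ) < r then (1 : ℝ) else 0) - ∑ i, w i) * φ r := by
    rw [← Finset.sum_sub_distrib, ← Finset.sum_sub_distrib, Finset.sum_mul,
      ← Finset.sum_sub_distrib]
    refine Finset.sum_congr rfl fun i _ => ?_
    split_ifs <;> ring
  rw [h4, hw, ← h2, ← h1] at h3
  linarith

theorem sum_norm_sq_col {q : ℕ} {Q : Matrix (Fin q) (Fin q) ℂ} (hQ : Q.conjTranspose * Q = 1)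
    (j : Fin q) : ∑ i, ‖Q i j‖ ^ 2 = 1 := by
  have := congrFun (congrFun hQ j) j
  rw [Matrix.mul_apply, Matrix.one_apply_eq] at this
  have h : ((∑ i, ‖Q i j‖ ^ 2 : ℝ) : ℂ) = 1 := by
    rw [← this]
    push_cast
    refine Finset.sum_congr rfl fun i _ => ?_
    rw [Matrix.conjTranspose_apply, ← starRingEnd_apply, Complex.conj_mul']
  exact_mod_cast h

theorem sum_norm_sq_row {q : ℕ} {Q : Matrix (Fin q) (Fin q) ℂ} (hQ : Q * Q.conjTranspose = 1)
    (i : Fin q) : ∑ j, ‖Q i j‖ ^ 2 = 1 := by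
  have := sum_norm_sq_col (Q := Q.conjTranspose) (by simpa using hQ) i
  simpa using this

theorem mul_rectDiag_apply {p q r : ℕ} (d : ℕ → ℝ) (B : Matrix (Fin r) (Fin p) ℂ) (i : Fin r)
    (k : Fin q) : (B * rectDiag p q d) i k
      = if h : (k : ℕ) < p then B i ⟨k, h⟩ * (d k : ℂ) else 0 := by
  rw [Matrix.mul_apply]
  split_ifs with h
  · rw [Finset.sum_eq_single ⟨k, h⟩]
    · simp [rectDiag_apply]
    · intro j _ hj
      rw [rectDiag_apply, if_neg, mul_zero]
      exact fun h' => hj (Fin.ext h')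
    · simp
  · refine Finset.sum_eq_zero fun j _ => ?_
    rw [rectDiag_apply, if_neg, mul_zero]
    exact fun h' => h (h' ▸ j.2)

/-- In the singular frames of `H` the cost splits into columns of `B = A Q`, each a scalar Wiener
problem with gain `h j`. Column `j` mixes the `σ i ^ 2` with weights `‖Z i j‖ ^ 2`, where `Z` is
unitary. Soft thresholding applies to each `σ i`, and the total weight on `i` over the active
columns lies in `[0, 1]`, so the largest singular values dominate. -/
theorem pointwise_lower_bound {p q K : ℕ} (A : Matrix (Fin p) (Fin q) ℂ)
    (G : Matrix (Fin p) (Fin K) ℂ) (H : Matrix (Fin K) (Fin q) ℂ) {c l τ : ℝ} (hc : 0 < c)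
    (hl : τ ^ 2 = c * l) :
    frob A - ∑ i ∈ Finset.range (min K q), (max (singVal A i - τ) 0) ^ 2
      ≤ frob (A - G * H) + c * frob G + l * frob H := by
  obtain ⟨-, P, Q, hP, hQ, hH⟩ := exists_svd H
  obtain ⟨hσ0, W, V, hW, hV, hA⟩ := exists_svd A
  have hP' : P * P.conjTranspose = 1 := mul_eq_one_comm.mp hP
  have hQ' : Q * Q.conjTranspose = 1 := mul_eq_one_comm.mp hQ
  have hV' : V * V.conjTranspose = 1 := mul_eq_one_comm.mp hV
  set h := singVal H with hh
  set σ := singVal A with hσ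
  set B := A * Q with hB
  set E := G * P with hE
  set Z := V.conjTranspose * Q with hZ
  have hZ1 : Z.conjTranspose * Z = 1 := by
    rw [hZ, Matrix.conjTranspose_mul, Matrix.conjTranspose_conjTranspose, Matrix.mul_assoc,
      ← Matrix.mul_assoc V, hV', Matrix.one_mul, hQ]
  have hZ2 : Z * Z.conjTranspose = 1 := mul_eq_one_comm.mp hZ1
  have e1 : frob (A - G * H) = frob (B - E * rectDiag K q h) := by
    rw [← frob_mul_right _ hQ', Matrix.sub_mul]
    congr 2
    conv_lhs => rw [hH]
    calc _ = G * P * rectDiag K q h * (Q.conjTranspose * Q) := by simp only [Matrix.mul_assoc]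
      _ = _ := by rw [hQ, Matrix.mul_one]
  have e2 : frob G = frob E := (frob_mul_right _ hP').symm
  have e3 : frob H = ∑ j : Fin q, (if (j : ℕ) < K then h j ^ 2 else 0) := by
    conv_lhs => rw [hH]
    rw [frob_mul_right _ (by simpa using hQ), frob_mul_left _ hP, frob_rectDiag,
      sum_fin_lt (fun j => h j ^ 2)]
  set α : Fin q → ℝ := fun j => ∑ i, ‖B i j‖ ^ 2 with hα
  have e4 : frob A = ∑ j, α j := by
    rw [← frob_mul_right A hQ', frob, Finset.sum_comm]
  -- Multiplication by `Wᴴ` preserves column norms and turns `B` into a diagonal matrix times `Z`.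
  have e5 : ∀ j, α j = ∑ i : Fin q, σ i ^ 2 * ‖Z i j‖ ^ 2 := by
    intro j
    have hBW : W.conjTranspose * B = rectDiag p q σ * Z := by
      rw [hB, hA]
      calc _ = (W.conjTranspose * W) * rectDiag p q σ * (V.conjTranspose * Q) := by
            simp only [Matrix.mul_assoc]
        _ = _ := by rw [hW, Matrix.one_mul]
    have h1 : α j = ∑ i, ‖(W.conjTranspose * B) i j‖ ^ 2 := by
      have h2 : ∀ M : Matrix (Fin p) (Fin q) ℂ, ∑ i, ‖M i j‖ ^ 2
          = frob (Matrix.of fun (i : Fin p) (_ : Fin 1) => M i j) := by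
        intro M; simp [frob]
      change ∑ i, ‖B i j‖ ^ 2 = _
      rw [h2, h2, ← frob_mul_left _ (show W.conjTranspose.conjTranspose * W.conjTranspose = 1 by
        rw [Matrix.conjTranspose_conjTranspose]; exact mul_eq_one_comm.mp hW)]
      congr 1
    rw [h1, hBW]
    obtain ⟨ψ, hψ⟩ : ∃ ψ : ℕ → ℝ, ∀ i (hi : i < q), ψ i = σ i ^ 2 * ‖Z ⟨i, hi⟩ j‖ ^ 2 :=
      ⟨fun i => if hi : i < q then σ i ^ 2 * ‖Z ⟨i, hi⟩ j‖ ^ 2 else 0, fun i hi => dif_pos hi⟩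
    calc ∑ i, ‖(rectDiag p q σ * Z) i j‖ ^ 2
        = ∑ i : Fin p, (if (i : ℕ) < q then ψ i else 0) := by
          refine Finset.sum_congr rfl fun i _ => ?_
          rw [rectDiag_mul_apply]
          split_ifs with hi
          · rw [hψ i hi, norm_mul, mul_pow, Complex.norm_real, Real.norm_eq_abs, sq_abs]
          · simp
      _ = ∑ i : Fin q, (if (i : ℕ) < p then ψ i else 0) := by
          rw [sum_fin_lt, sum_fin_lt, min_comm]
      _ = _ := by
          refine Finset.sum_congr rfl fun i _ => ?_
          split_ifs with hi
          · rw [hψ i i.2]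
          · rw [hσ0 i (not_lt.mp hi)]; simp
  have e6 : ∑ j, (α j - if (j : ℕ) < K then α j * (h j ^ 2 / (h j ^ 2 + c)) else 0)
      ≤ frob (B - E * rectDiag K q h) + c * frob E := by
    -- Columns of `E` with index at least `q` meet only zeros of the diagonal matrix; their cost is
    -- dropped.
    have hE' : ∑ j : Fin q, ∑ i, (if hj : (j : ℕ) < K then ‖E i ⟨j, hj⟩‖ ^ 2 else 0) ≤ frob E := by
      rw [frob, Finset.sum_comm]
      refine Finset.sum_le_sum fun i _ => ?_
      have := sum_fin_lt (q := q) (K := K)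
        (fun j => if hj : j < K then ‖E i ⟨j, hj⟩‖ ^ 2 else 0)
      have h2 : ∑ k, ‖E i k‖ ^ 2 = ∑ j ∈ Finset.range K,
          (if hj : j < K then ‖E i ⟨j, hj⟩‖ ^ 2 else 0) := by
        rw [← Fin.sum_univ_eq_sum_range (fun j => if hj : j < K then ‖E i ⟨j, hj⟩‖ ^ 2 else 0) K]
        simp
      rw [h2]
      refine le_trans (le_of_eq ?_) (Finset.sum_le_sum_of_subset_of_nonneg
        (Finset.range_mono (min_le_left K q)) fun j _ _ => ?_)
      · rw [← this]
        refine Finset.sum_congr rfl fun j _ => ?_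
        split_ifs <;> rfl
      · split_ifs
        · positivity
        · exact le_rfl
    refine le_trans ?_ (add_le_add_right (mul_le_mul_of_nonneg_left hE' hc.le) _)
    have hf : frob (B - E * rectDiag K q h)
        = ∑ j, ∑ i, ‖(B - E * rectDiag K q h) i j‖ ^ 2 := Finset.sum_comm
    rw [hf, Finset.mul_sum, ← Finset.sum_add_distrib]
    refine Finset.sum_le_sum fun j _ => ?_
    rw [Finset.mul_sum, ← Finset.sum_add_distrib]
    by_cases hj : (j : ℕ) < K
    · simp only [hj, if_true, dif_pos, hα]
      rw [Finset.sum_mul, ← Finset.sum_sub_distrib]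
      refine Finset.sum_le_sum fun i _ => ?_
      rw [Matrix.sub_apply, mul_rectDiag_apply, dif_pos hj]
      exact norm_sub_mul_sq_ge hc
    · simp only [hj, if_false, dif_neg, hα, not_false_iff, sub_zero, mul_zero, add_zero]
      refine Finset.sum_le_sum fun i _ => ?_
      rw [Matrix.sub_apply, mul_rectDiag_apply, dif_neg hj, sub_zero]
  set φ : ℕ → ℝ := fun i => (max (σ i - τ) 0) ^ 2 with hφ
  have hφa : Antitone φ := fun i j hij => pow_le_pow_left₀ (le_max_right _ _)
    (max_le_max_right _ (sub_le_sub_right (singVal_antitone A hij) _)) 2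
  -- Column `j` of `Z` has unit norm, so the cost `l * h j ^ 2` can be spread over the same weights
  -- as the gain.
  have e7 : ∀ j : Fin q, α j * (h j ^ 2 / (h j ^ 2 + c)) - l * h j ^ 2
      ≤ ∑ i : Fin q, ‖Z i j‖ ^ 2 * φ i := by
    intro j
    have h1 : α j * (h j ^ 2 / (h j ^ 2 + c)) - l * h j ^ 2
        = ∑ i : Fin q, ‖Z i j‖ ^ 2 * (σ i ^ 2 * (h j ^ 2 / (h j ^ 2 + c)) - l * h j ^ 2) := by
      simp only [mul_sub, Finset.sum_sub_distrib]
      rw [← Finset.sum_mul, sum_norm_sq_col hZ1, one_mul, e5, Finset.sum_mul]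
      congr 1
      refine Finset.sum_congr rfl fun i _ => by ring
    rw [h1]
    exact Finset.sum_le_sum fun i _ => mul_le_mul_of_nonneg_left
      (soft_threshold_ge (singVal_nonneg A i) (sq_nonneg _) hc hl) (sq_nonneg _)
  -- Unit rows of `Z` bound each weight by one, and its unit columns make the total mass `min K q`.
  have e8 : ∑ j : Fin q, (if (j : ℕ) < K then ∑ i : Fin q, ‖Z i j‖ ^ 2 * φ i else 0)
      ≤ ∑ i ∈ Finset.range (min K q), φ i := by
    have h1 : ∑ j : Fin q, (if (j : ℕ) < K then ∑ i : Fin q, ‖Z i j‖ ^ 2 * φ i else 0)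
        = ∑ i : Fin q, (∑ j : Fin q, if (j : ℕ) < K then ‖Z i j‖ ^ 2 else 0) * φ i := by
      simp only [Finset.sum_mul]
      rw [Finset.sum_comm]
      refine Finset.sum_congr rfl fun j _ => ?_
      split_ifs <;> simp
    rw [h1]
    refine sum_weights_le (min_le_right _ _) (fun i => Finset.sum_nonneg fun j _ => ?_)
      (fun i => ?_) ?_ hφa
    · split_ifs <;> positivity
    · rw [← sum_norm_sq_row hZ2 i]
      refine Finset.sum_le_sum fun j _ => ?_
      split_ifs
      · exact le_rfl
      · positivity
    · rw [Finset.sum_comm]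
      have : ∀ j : Fin q, ∑ i : Fin q, (if (j : ℕ) < K then ‖Z i j‖ ^ 2 else 0)
          = if (j : ℕ) < K then (fun _ : ℕ => (1 : ℝ)) j else 0 := by
        intro j
        split_ifs
        · exact sum_norm_sq_col hZ1 j
        · simp
      simp only [this]
      rw [sum_fin_lt fun _ => 1]
      simp
  have e9 : ∑ j : Fin q, (if (j : ℕ) < K then α j * (h j ^ 2 / (h j ^ 2 + c)) else 0)
      - l * frob H ≤ ∑ i ∈ Finset.range (min K q), φ i := by
    refine le_trans ?_ e8
    rw [e3, Finset.mul_sum, ← Finset.sum_sub_distrib]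
    refine Finset.sum_le_sum fun j _ => ?_
    split_ifs
    · exact e7 j
    · simp
  rw [Finset.sum_sub_distrib, ← e4] at e6
  rw [e1, e2]
  linarith

/-- The minimizer of `G ↦ ‖A - G H‖² + c ‖G‖²`. -/
def wiener {p q K : ℕ} (c : ℝ) (A : Matrix (Fin p) (Fin q) ℂ) (H : Matrix (Fin K) (Fin q) ℂ) :
    Matrix (Fin p) (Fin K) ℂ :=
  A * H.conjTranspose * (H * H.conjTranspose + (c : ℂ) • (1 : Matrix (Fin K) (Fin K) ℂ))⁻¹

theorem gram_add_isUnit_det {q K : ℕ} {c : ℝ} (hc : 0 < c) (H : Matrix (Fin K) (Fin q) ℂ) :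
    IsUnit (H * H.conjTranspose + (c : ℂ) • (1 : Matrix (Fin K) (Fin K) ℂ)).det := by
  have h1 : ((c : ℂ) • (1 : Matrix (Fin K) (Fin K) ℂ)).PosDef :=
    Matrix.PosDef.one.smul (by simpa using hc)
  exact (Matrix.isUnit_iff_isUnit_det _).mp
    (h1.posSemidef_add (Matrix.posSemidef_self_mul_conjTranspose H)).isUnit

theorem rectDiag_congr {p q : ℕ} {d e : ℕ → ℝ} (h : ∀ i, i < p → i < q → d i = e i) :
    rectDiag p q d = rectDiag p q e := by
  ext i j
  simp only [rectDiag_apply]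
  split_ifs with hij
  · rw [h i i.2 (hij ▸ j.2)]
  · rfl

/-- Because `A` and `H` share `V`, the cross term `A Hᴴ` and the regularised Gram matrix are both
diagonal between `W` and `U`. The candidate is checked by multiplying back with the invertible Gram
matrix. -/
theorem wiener_of_svd {p q K : ℕ} {A : Matrix (Fin p) (Fin q) ℂ} {H : Matrix (Fin K) (Fin q) ℂ}
    {c : ℝ} (hc : 0 < c) {W : Matrix (Fin p) (Fin p) ℂ} {V : Matrix (Fin q) (Fin q) ℂ}
    {U : Matrix (Fin K) (Fin K) ℂ} (hV : V.conjTranspose * V = 1) (hU : U.conjTranspose * U = 1)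
    {h : ℕ → ℝ} (hA : A = W * rectDiag p q (singVal A) * V.conjTranspose)
    (hH : H = U * rectDiag K q h * V.conjTranspose) :
    wiener c A H
      = W * rectDiag p K (fun i => singVal A i * h i / (h i ^ 2 + c)) * U.conjTranspose := by
  have hU' : U * U.conjTranspose = 1 := mul_eq_one_comm.mp hU
  have hdet := gram_add_isUnit_det hc H
  set σ := singVal A with hσ
  have hAH : A * H.conjTranspose
      = W * rectDiag p K (fun i => trunc q σ i * h i) * U.conjTranspose := by
    conv_lhs => rw [hA, hH]
    rw [Matrix.conjTranspose_mul, Matrix.conjTranspose_mul, Matrix.conjTranspose_conjTranspose,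
      rectDiag_conjTranspose, ← rectDiag_mul_rectDiag]
    calc _ = W * rectDiag p q σ * (V.conjTranspose * V) * rectDiag q K h * U.conjTranspose := by
          simp only [Matrix.mul_assoc]
      _ = _ := by rw [hV, Matrix.mul_one]; simp only [Matrix.mul_assoc]
  have hHH : H * H.conjTranspose + (c : ℂ) • (1 : Matrix (Fin K) (Fin K) ℂ)
      = U * rectDiag K K (fun i => trunc q h i * h i + c) * U.conjTranspose := by
    have h1 : rectDiag K K (fun i => trunc q h i * h i + c)
        = rectDiag K K (fun i => trunc q h i * h i)
          + (c : ℂ) • (1 : Matrix (Fin K) (Fin K) ℂ) := by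
      ext i j
      rw [Matrix.add_apply, Matrix.smul_apply, Matrix.one_apply, rectDiag_apply, rectDiag_apply]
      by_cases hij : i = j
      · subst hij; simp
      · have hij' : (i : ℕ) ≠ j := fun h' => hij (Fin.ext h')
        simp [hij, hij']
    rw [h1, Matrix.mul_add, Matrix.add_mul]
    congr 1
    · conv_lhs => rw [hH]
      rw [Matrix.conjTranspose_mul, Matrix.conjTranspose_mul, Matrix.conjTranspose_conjTranspose,
        rectDiag_conjTranspose, ← rectDiag_mul_rectDiag]
      calc _ = U * rectDiag K q h * (V.conjTranspose * V) * rectDiag q K h * U.conjTranspose := by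
            simp only [Matrix.mul_assoc]
        _ = _ := by rw [hV, Matrix.mul_one]; simp only [Matrix.mul_assoc]
    · simp [hU']
  have hX : A * H.conjTranspose
      = W * rectDiag p K (fun i => σ i * h i / (h i ^ 2 + c)) * U.conjTranspose
        * (H * H.conjTranspose + (c : ℂ) • (1 : Matrix (Fin K) (Fin K) ℂ)) := by
    rw [hHH, hAH]
    -- The truncations at `q` come from the inner dimension. The sequence `h` need not vanish beyond
    -- `q`, but there `σ` does, so both sides are zero.
    have e : rectDiag p K (fun i => trunc q σ i * h i)
        = rectDiag p K (fun i => σ i * h i / (h i ^ 2 + c))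
          * rectDiag K K (fun i => trunc q h i * h i + c) := by
      rw [rectDiag_mul_rectDiag]
      refine rectDiag_congr fun i _ hi => ?_
      have hpos : h i ^ 2 + c ≠ 0 := by positivity
      simp only [trunc, hi, if_true]
      split_ifs with hq
      · field_simp
      · rw [hσ, singVal_of_le A (not_lt.mp hq)]; simp
    rw [e]
    calc _ = W * rectDiag p K (fun i => σ i * h i / (h i ^ 2 + c)) * (U.conjTranspose * U)
          * rectDiag K K (fun i => trunc q h i * h i + c) * U.conjTranspose := by
          rw [hU, Matrix.mul_one]; simp only [Matrix.mul_assoc]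
      _ = _ := by simp only [Matrix.mul_assoc]
  rw [wiener, hX, Matrix.mul_nonsing_inv_cancel_right _ _ hdet]

/-- With both matrices diagonal in common frames, each index contributes `(σ - g h)² + c g²` at `g =
σ h / (h² + c)`, which is the scalar minimum. -/
theorem wiener_value {p q K : ℕ} {A : Matrix (Fin p) (Fin q) ℂ} {H : Matrix (Fin K) (Fin q) ℂ}
    {c : ℝ} (hc : 0 < c) {W : Matrix (Fin p) (Fin p) ℂ} {V : Matrix (Fin q) (Fin q) ℂ}
    {U : Matrix (Fin K) (Fin K) ℂ} (hW : W.conjTranspose * W = 1)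
    (hV : V.conjTranspose * V = 1) (hU : U.conjTranspose * U = 1)
    {h : ℕ → ℝ} (hA : A = W * rectDiag p q (singVal A) * V.conjTranspose)
    (hH : H = U * rectDiag K q h * V.conjTranspose) :
    frob (A - wiener c A H * H) + c * frob (wiener c A H)
      = frob A - ∑ i ∈ Finset.range (min K q), singVal A i ^ 2 * h i ^ 2 / (h i ^ 2 + c) := by
  have hs0 := (exists_svd A).1
  rw [wiener_of_svd hc hV hU hA hH]
  set σ := singVal A with hσ
  set g : ℕ → ℝ := fun i => σ i * h i / (h i ^ 2 + c) with hg
  have hpos : ∀ i, h i ^ 2 + c ≠ 0 := fun i => by positivity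
  have e1 : A - W * rectDiag p K g * U.conjTranspose * H
      = W * rectDiag p q (fun i => σ i - trunc K g i * h i) * V.conjTranspose := by
    have h1 : rectDiag p q (fun i => σ i - trunc K g i * h i)
        = rectDiag p q σ - rectDiag p K g * rectDiag K q h := by
      rw [rectDiag_mul_rectDiag]
      ext i j
      simp only [Matrix.sub_apply, rectDiag_apply]
      split_ifs <;> simp
    rw [h1, Matrix.mul_sub, Matrix.sub_mul, ← hA]
    conv_lhs => rw [hH]
    congr 1
    calc _ = W * rectDiag p K g * (U.conjTranspose * U) * rectDiag K q h * V.conjTranspose := by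
          simp only [Matrix.mul_assoc]
      _ = _ := by rw [hU, Matrix.mul_one]; simp only [Matrix.mul_assoc]
  rw [e1, frob_mul_right _ (Q := V.conjTranspose) (by simpa using hV),
    frob_mul_right _ (Q := U.conjTranspose) (by simpa using hU), frob_mul_left _ hW, frob_mul_left _ hW,
    frob_rectDiag, frob_rectDiag, frob_eq_sum_singVal]
  rw [sum_range_min fun i hi => by simp [trunc, hg, hs0 i hi],
    sum_range_min (fun i hi => by simp [hg, hs0 i hi]),
    ← sum_range_min (r := q) (f := fun i => g i ^ 2)
      (fun i hi => by simp [hg, hσ, singVal_of_le A hi]),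
    min_comm q K, ← sum_fin_lt, ← sum_fin_lt,
    ← Fin.sum_univ_eq_sum_range (fun i => (σ i - trunc K g i * h i) ^ 2),
    ← Fin.sum_univ_eq_sum_range (fun i => σ i ^ 2), Finset.mul_sum, ← Finset.sum_add_distrib,
    ← Finset.sum_sub_distrib]
  refine Finset.sum_congr rfl fun i _ => ?_
  have := hpos i
  simp only [trunc, hg]
  split_ifs with hi
  · field_simp
    ring
  · simp

/-! ### The square root of the power spectral density -/

section

open scoped Matrix.Norms.L2Operator

theorem continuousOn_matrix_sqrt {n : ℕ} :
    ContinuousOn (CFC.sqrt : Matrix (Fin n) (Fin n) ℂ → _) {A | 0 ≤ A} := CFC.continuousOn_sqrt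

end

theorem sqrt_mul_sqrt {n : ℕ} {A : Matrix (Fin n) (Fin n) ℂ} (hA : A.PosSemidef) :
    CFC.sqrt A * CFC.sqrt A = A := CFC.sqrt_mul_sqrt_self A hA.nonneg

theorem sqrt_conjTranspose {n : ℕ} (A : Matrix (Fin n) (Fin n) ℂ) :
    (CFC.sqrt A).conjTranspose = CFC.sqrt A := (CFC.sqrt_nonneg A).isSelfAdjoint

/-- The square root is continuous on the positive semidefinite cone only, so measurability is passed
through the cone as a subtype of a finite product. -/
theorem EntryMeas.sqrt {α : Type*} [MeasurableSpace α] {n : ℕ}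
    {S : α → Matrix (Fin n) (Fin n) ℂ} (hm : EntryMeas S) (hS : ∀ a, (S a).PosSemidef) :
    EntryMeas fun a => CFC.sqrt (S a) := by
  intro i j
  let X := {A : Fin n → Fin n → ℂ // 0 ≤ Matrix.of A}
  have hc : Continuous fun A : X => CFC.sqrt (Matrix.of A.1) i j := by
    have h1 : Continuous fun A : X => CFC.sqrt (Matrix.of A.1) := by
      have := continuousOn_iff_continuous_domRestrict.mp (continuousOn_matrix_sqrt (n := n))
      exact this.comp (Continuous.subtype_mk (f := fun A : X => Matrix.of A.1)
        continuous_subtype_val fun A => A.2)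
    exact h1.matrix_elem i j
  have hf : Measurable fun a => (⟨fun i j => S a i j, (hS a).nonneg⟩ : X) :=
    Measurable.subtype_mk (measurable_pi_iff.mpr fun i => measurable_pi_iff.mpr fun j => hm i j)
  exact hc.measurable.comp hf

theorem trace_eq_frob_sqrt {p M : ℕ} (H : Matrix (Fin p) (Fin M) ℂ)
    {S : Matrix (Fin M) (Fin M) ℂ} (hS : S.PosSemidef) :
    (H * S * H.conjTranspose).trace = (frob (H * CFC.sqrt S) : ℂ) := by
  rw [← frob_eq_trace, Matrix.conjTranspose_mul, sqrt_conjTranspose]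
  conv_lhs => rw [← sqrt_mul_sqrt hS]
  simp only [Matrix.mul_assoc]

theorem eLpNorm_two_sq {α E : Type*} [MeasurableSpace α] [NormedAddCommGroup E] (μ : Measure α)
    (f : α → E) : eLpNorm f 2 μ ^ 2 = ∫⁻ a, ENNReal.ofReal (‖f a‖ ^ 2) ∂μ := by
  have := eLpNorm_nnreal_pow_eq_lintegral (f := f) (μ := μ) (p := 2) two_ne_zero
  simp only [NNReal.coe_ofNat, ENNReal.rpow_ofNat, ENNReal.coe_ofNat] at this
  rw [this]
  refine lintegral_congr fun a => ?_
  rw [ENNReal.ofReal_pow (norm_nonneg _), ofReal_norm]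

theorem filterPower_eq {p M : ℕ} {Cx : ℝ → Matrix (Fin M) (Fin M) ℂ}
    (hC : ∀ f, (Cx f).PosSemidef) (H : ℝ → Matrix (Fin p) (Fin M) ℂ) :
    filterPower Cx H = eLpNorm (fun f => fvec (H f * CFC.sqrt (Cx f))) 2 volume ^ 2 := by
  rw [eLpNorm_two_sq, filterPower]
  refine lintegral_congr fun f => ?_
  rw [trace_eq_frob_sqrt _ (hC f), norm_fvec_sq, Complex.ofReal_re]

theorem norm_toLp_sq {α E : Type*} [MeasurableSpace α] [NormedAddCommGroup E] {μ : Measure α}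
    {f : α → E} (hf : MemLp f 2 μ) : ‖hf.toLp f‖ ^ 2 = ∫ a, ‖f a‖ ^ 2 ∂μ := by
  rw [Lp.norm_toLp, ← ENNReal.toReal_pow, eLpNorm_two_sq, integral_eq_lintegral_of_nonneg_ae]
  · exact Eventually.of_forall fun a => sq_nonneg _
  · exact (hf.1.norm.pow 2)

theorem eLpNorm_eq_of_integral_eq {α β E F : Type*} [MeasurableSpace α] [MeasurableSpace β]
    [NormedAddCommGroup E] [NormedAddCommGroup F] {μ : Measure α} {ν : Measure β}
    {f : α → E} {g : β → F} (hf : MemLp f 2 μ) (hg : MemLp g 2 ν)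
    (h : ∫ a, ‖f a‖ ^ 2 ∂μ = ∫ b, ‖g b‖ ^ 2 ∂ν) : eLpNorm f 2 μ = eLpNorm g 2 ν := by
  rw [← norm_toLp_sq hf, ← norm_toLp_sq hg, Lp.norm_toLp, Lp.norm_toLp] at h
  have := (sq_eq_sq₀ ENNReal.toReal_nonneg ENNReal.toReal_nonneg).mp h
  exact (ENNReal.toReal_eq_toReal_iff' hf.2.ne hg.2.ne).mp this

theorem tendsto_integral_norm_sq {α E : Type*} [MeasurableSpace α] [NormedAddCommGroup E]
    {μ : Measure α} {f : ℕ → α → E} {g : α → E} (hf : ∀ j, MemLp (f j) 2 μ) (hg : MemLp g 2 μ)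
    (h : Tendsto (fun j => eLpNorm (fun a => g a - f j a) 2 μ) atTop (𝓝 0)) :
    Tendsto (fun j => ∫ a, ‖f j a‖ ^ 2 ∂μ) atTop (𝓝 (∫ a, ‖g a‖ ^ 2 ∂μ)) := by
  have h1 : Tendsto (fun j => (hf j).toLp (f j)) atTop (𝓝 (hg.toLp g)) := by
    rw [Lp.tendsto_Lp_iff_tendsto_eLpNorm'']
    refine h.congr fun j => ?_
    rw [eLpNorm_sub_comm]
    rfl
  have h2 := (h1.norm).pow 2
  simpa only [norm_toLp_sq] using h2

/-! ### Finite impulse response filters -/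

/-- Output `∑ c_n z_n` of a delay line with matrix gains. -/
def firOut {ι Ω : Type*} {r p : ℕ} (z : ι → Ω → Fin p → ℝ) (c : ι →₀ Matrix (Fin r) (Fin p) ℝ)
    (ω : Ω) : Fin r → ℝ := c.sum fun n C => C.mulVec (z n ω)

/-- A random vector with values in Euclidean space. -/
abbrev evec {r : ℕ} (y : Fin r → ℝ) : EuclideanSpace ℝ (Fin r) := WithLp.toLp 2 y

theorem norm_evec_sq {r : ℕ} (y : Fin r → ℝ) : ‖evec y‖ ^ 2 = ∑ i, y i ^ 2 := by
  rw [EuclideanSpace.norm_sq_eq]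
  simp

theorem memLp_evec_iff {Ω : Type*} [MeasurableSpace Ω] {P : Measure Ω} {r : ℕ}
    {Y : Ω → Fin r → ℝ} :
    MemLp (fun ω => evec (Y ω)) 2 P ↔ ∀ i, MemLp (fun ω => Y ω i) 2 P := memLp_piLp_iff

section

variable {ι Ω : Type*} {r p q : ℕ} (z : ι → Ω → Fin p → ℝ)

theorem firOut_apply (c : ι →₀ Matrix (Fin r) (Fin p) ℝ) (ω : Ω) (i : Fin r) :
    firOut z c ω i = ∑ a ∈ c.support ×ˢ Finset.univ, c a.1 i a.2 * z a.1 ω a.2 := by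
  simp [firOut, Finsupp.sum, Finset.sum_apply, Matrix.mulVec, dotProduct, Finset.sum_product]

theorem firOut_add (c d : ι →₀ Matrix (Fin r) (Fin p) ℝ) (ω : Ω) :
    firOut z (c + d) ω = firOut z c ω + firOut z d ω := by
  classical
  exact Finsupp.sum_add_index' (fun a => by simp) fun a b₁ b₂ => Matrix.add_mulVec _ _ _

theorem firOut_neg (c : ι →₀ Matrix (Fin r) (Fin p) ℝ) (ω : Ω) :
    firOut z (-c) ω = -firOut z c ω := by
  rw [firOut, Finsupp.sum_neg_index (fun a => by simp), firOut]
  simp [Finsupp.sum, Matrix.neg_mulVec]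

theorem firOut_sub (c d : ι →₀ Matrix (Fin r) (Fin p) ℝ) (ω : Ω) :
    firOut z (c - d) ω = firOut z c ω - firOut z d ω := by
  rw [sub_eq_add_neg, firOut_add, firOut_neg, sub_eq_add_neg]

theorem tapFreq_mul_apply (t : ι → ℝ) (c : ι →₀ Matrix (Fin r) (Fin p) ℝ) (f : ℝ)
    (D : Matrix (Fin p) (Fin q) ℂ) (i : Fin r) (j : Fin q) :
    (tapFreq t c f * D) i j
      = ∑ a ∈ c.support ×ˢ Finset.univ, (c a.1 i a.2 : ℂ) * (chr f (t a.1) * D a.2 j) := by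
  simp only [Matrix.mul_apply, tapFreq_apply, Finset.sum_mul]
  rw [Finset.sum_comm, Finset.sum_product]
  refine Finset.sum_congr rfl fun a _ => Finset.sum_congr rfl fun b _ => by ring

variable [MeasurableSpace Ω] {P : Measure Ω}

variable {z} in
theorem memLp_firOut (hz : ∀ n m, MemLp (fun ω => z n ω m) 2 P)
    (c : ι →₀ Matrix (Fin r) (Fin p) ℝ) (i : Fin r) : MemLp (fun ω => firOut z c ω i) 2 P := by
  simp only [firOut_apply]
  exact memLp_finsetSum _ fun a _ => (hz a.1 a.2).const_mul _

variable {z} in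
/-- If the correlations of `z` are the Fourier coefficients of `B Bᴴ`, then the mean power of a
delay line output is the weighted power of its frequency response. -/
theorem fir_isometry {t : ι → ℝ} {μ : Measure ℝ} {B : ℝ → Matrix (Fin p) (Fin q) ℂ}
    (hB : MemLp (fun f => fvec (B f)) 2 μ) (hz : ∀ n m, MemLp (fun ω => z n ω m) 2 P)
    (hgram : ∀ n n' m l, ((∫ ω, z n ω m * z n' ω l ∂P : ℝ) : ℂ)
      = ∫ f, chr f (t n - t n') * (B f * (B f).conjTranspose) m l ∂μ)
    (c : ι →₀ Matrix (Fin r) (Fin p) ℝ) :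
    ∫ ω, ‖evec (firOut z c ω)‖ ^ 2 ∂P = ∫ f, ‖fvec (tapFreq t c f * B f)‖ ^ 2 ∂μ := by
  have hBB : ∀ m l, Integrable (fun f => (B f * (B f).conjTranspose) m l) μ := by
    intro m l
    simp only [Matrix.mul_apply, Matrix.conjTranspose_apply]
    exact integrable_finsetSum _ fun j _ =>
      (memLp_fvec_iff.mp hB m j).integrable_mul (memLp_fvec_iff.mp hB l j).star
  have hchr : ∀ τ m l, Integrable (fun f => chr f τ * (B f * (B f).conjTranspose) m l) μ :=
    fun τ m l => Integrable.bdd_mul (c := 1) (hBB m l) (continuous_chr _).aestronglyMeasurable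
      (Eventually.of_forall fun f => (norm_chr _ _).le)
  set s := c.support ×ˢ (Finset.univ : Finset (Fin p)) with hs
  -- Both sides are expanded into the same double sum over taps, with the correlations on one side
  -- and their spectral integrals on the other.
  have hL : ∀ i, ((∫ ω, firOut z c ω i ^ 2 ∂P : ℝ) : ℂ) = ∑ a ∈ s, ∑ b ∈ s,
      (c a.1 i a.2 : ℂ) * (c b.1 i b.2 : ℂ)
        * ∫ f, chr f (t a.1 - t b.1) * (B f * (B f).conjTranspose) a.2 b.2 ∂μ := by
    intro i
    have h1 : ∀ ω, firOut z c ω i ^ 2 = ∑ a ∈ s, ∑ b ∈ s,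
        c a.1 i a.2 * c b.1 i b.2 * (z a.1 ω a.2 * z b.1 ω b.2) := by
      intro ω
      rw [firOut_apply, sq, Finset.sum_mul_sum]
      refine Finset.sum_congr rfl fun a _ => Finset.sum_congr rfl fun b _ => by ring
    simp only [h1]
    have hint : ∀ a b : ι × Fin p, Integrable
        (fun ω => c a.1 i a.2 * c b.1 i b.2 * (z a.1 ω a.2 * z b.1 ω b.2)) P := fun a b =>
      ((hz a.1 a.2).integrable_mul (hz b.1 b.2)).const_mul _
    rw [integral_finsetSum _ fun a _ => integrable_finsetSum _ fun b _ => hint a b]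
    push_cast
    refine Finset.sum_congr rfl fun a _ => ?_
    rw [integral_finsetSum _ fun b _ => hint a b]
    push_cast
    refine Finset.sum_congr rfl fun b _ => ?_
    rw [integral_const_mul, ← hgram]
    push_cast
    rfl
  have hR : ∀ f i, ((∑ j, ‖(tapFreq t c f * B f) i j‖ ^ 2 : ℝ) : ℂ) = ∑ a ∈ s, ∑ b ∈ s,
      (c a.1 i a.2 : ℂ) * (c b.1 i b.2 : ℂ)
        * (chr f (t a.1 - t b.1) * (B f * (B f).conjTranspose) a.2 b.2) := by
    intro f i
    push_cast
    have h1 : ∀ j, (‖(tapFreq t c f * B f) i j‖ : ℂ) ^ 2 = ∑ a ∈ s, ∑ b ∈ s,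
        (c a.1 i a.2 : ℂ) * (c b.1 i b.2 : ℂ)
        * (chr f (t a.1 - t b.1) * (B f a.2 j * star (B f b.2 j))) := by
      intro j
      rw [← Complex.mul_conj', tapFreq_mul_apply, map_sum, Finset.sum_mul_sum]
      refine Finset.sum_congr rfl fun a _ => Finset.sum_congr rfl fun b _ => ?_
      rw [sub_eq_add_neg, chr_add, ← star_chr]
      simp
      ring
    simp only [h1]
    rw [Finset.sum_comm]
    refine Finset.sum_congr rfl fun a _ => ?_
    rw [Finset.sum_comm]
    refine Finset.sum_congr rfl fun b _ => ?_
    rw [Matrix.mul_apply, Finset.mul_sum, Finset.mul_sum]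
    rfl
  have hint2 : ∀ a b : ι × Fin p, ∀ i : Fin r, Integrable (fun f => (c a.1 i a.2 : ℂ)
      * (c b.1 i b.2 : ℂ) * (chr f (t a.1 - t b.1) * (B f * (B f).conjTranspose) a.2 b.2)) μ :=
    fun a b i => (hchr _ _ _).const_mul _
  have e : ((∫ ω, ‖evec (firOut z c ω)‖ ^ 2 ∂P : ℝ) : ℂ)
      = ((∫ f, ‖fvec (tapFreq t c f * B f)‖ ^ 2 ∂μ : ℝ) : ℂ) := by
    simp only [norm_evec_sq, norm_fvec_sq]
    rw [integral_finsetSum _ fun i _ => (memLp_firOut hz c i).integrable_sq]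
    push_cast
    simp only [hL, frob]
    rw [← integral_complex_ofReal]
    have h2 : ∀ f, ((∑ i, ∑ j, ‖(tapFreq t c f * B f) i j‖ ^ 2 : ℝ) : ℂ)
        = ∑ i, ∑ a ∈ s, ∑ b ∈ s, (c a.1 i a.2 : ℂ) * (c b.1 i b.2 : ℂ)
        * (chr f (t a.1 - t b.1) * (B f * (B f).conjTranspose) a.2 b.2) := by
      intro f
      rw [Complex.ofReal_sum]
      exact Finset.sum_congr rfl fun i _ => hR f i
    simp only [h2]
    rw [integral_finsetSum _ fun i _ => integrable_finsetSum _ fun a _ =>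
      integrable_finsetSum _ fun b _ => hint2 a b i]
    refine Finset.sum_congr rfl fun i _ => ?_
    rw [integral_finsetSum _ fun a _ => integrable_finsetSum _ fun b _ => hint2 a b i]
    refine Finset.sum_congr rfl fun a _ => ?_
    rw [integral_finsetSum _ fun b _ => hint2 a b i]
    refine Finset.sum_congr rfl fun b _ => ?_
    rw [integral_const_mul]
  exact_mod_cast e

end

/-! ### Filter outputs in the mean-square sense -/

theorem ENNReal_tendsto_zero_of_sq {u : ℕ → ENNReal}
    (h : Tendsto (fun j => u j ^ 2) atTop (𝓝 0)) : Tendsto u atTop (𝓝 0) := by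
  have h1 := h.ennrpow_const (1 / 2 : ℝ)
  rw [ENNReal.zero_rpow_of_pos (by norm_num)] at h1
  refine h1.congr fun j => ?_
  rw [← ENNReal.rpow_natCast, ← ENNReal.rpow_mul]
  norm_num

theorem eLpNorm_evec_sq {Ω : Type*} [MeasurableSpace Ω] {P : Measure Ω} {r : ℕ}
    {Y : Ω → Fin r → ℝ} (hY : ∀ i, AEStronglyMeasurable (fun ω => Y ω i) P) :
    eLpNorm (fun ω => evec (Y ω)) 2 P ^ 2 = ∑ i, eLpNorm (fun ω => Y ω i) 2 P ^ 2 := by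
  simp only [eLpNorm_two_sq, norm_evec_sq]
  rw [← lintegral_finsetSum' _ fun i _ => ((hY i).norm.aemeasurable.pow_const 2).ennreal_ofReal]
  refine lintegral_congr fun ω => ?_
  rw [ENNReal.ofReal_sum_of_nonneg fun i _ => sq_nonneg _]
  simp

theorem tendsto_evec_iff {Ω : Type*} [MeasurableSpace Ω] {P : Measure Ω} {r : ℕ}
    {Y : ℕ → Ω → Fin r → ℝ} (hY : ∀ j i, AEStronglyMeasurable (fun ω => Y j ω i) P) :
    Tendsto (fun j => eLpNorm (fun ω => evec (Y j ω)) 2 P) atTop (𝓝 0)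
      ↔ ∀ i, Tendsto (fun j => eLpNorm (fun ω => Y j ω i) 2 P) atTop (𝓝 0) := by
  constructor
  · intro h i
    refine tendsto_of_tendsto_of_tendsto_of_le_of_le tendsto_const_nhds h (fun _ => zero_le)
      fun j => eLpNorm_mono fun ω => ?_
    exact PiLp.norm_apply_le (evec (Y j ω)) i
  · intro h
    refine ENNReal_tendsto_zero_of_sq ?_
    simp only [eLpNorm_evec_sq (hY _)]
    have := tendsto_finsetSum Finset.univ fun i (_ : i ∈ Finset.univ) =>
      (ENNReal.continuous_pow 2).tendsto _ |>.comp (h i)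
    simpa using this

theorem firOut_mapRange {Ω ι : Type*} {r r' p : ℕ} (z : ι → Ω → Fin p → ℝ)
    (C : Matrix (Fin r') (Fin r) ℝ) (c : ι →₀ Matrix (Fin r) (Fin p) ℝ) (ω : Ω) :
    firOut z (c.mapRange (fun D => C * D) (Matrix.mul_zero _)) ω = C.mulVec (firOut z c ω) := by
  rw [firOut, Finsupp.sum_mapRange_index (fun a => by simp), firOut, Finsupp.sum, Finsupp.sum,
    Matrix.mulVec_sum]
  simp only [Matrix.mulVec_mulVec]

section

variable {Ω : Type*} [MeasurableSpace Ω] {P : Measure Ω} {M : ℕ} {x : Proc ℝ Ω M}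
  {Cx : ℝ → Matrix (Fin M) (Fin M) ℂ}

theorem IsWSS.entryMeas_sqrt (hx : IsWSS P x Cx) : EntryMeas fun f => CFC.sqrt (Cx f) :=
  EntryMeas.sqrt hx.psd_measurable hx.psd_posSemidef

theorem IsWSS.memLp_sqrt (hx : IsWSS P x Cx) :
    MemLp (fun f => fvec (CFC.sqrt (Cx f))) 2 volume := by
  rw [memLp_two_iff_integrable_sq_norm
    (aesm_fvec fun i j => (hx.entryMeas_sqrt i j).aestronglyMeasurable)]
  have : ∀ f, ‖fvec (CFC.sqrt (Cx f))‖ ^ 2 = ∑ m, (Cx f m m).re := by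
    intro f
    have h := trace_eq_frob_sqrt (1 : Matrix (Fin M) (Fin M) ℂ) (hx.psd_posSemidef f)
    rw [norm_fvec_sq]
    simp only [Matrix.one_mul, Matrix.conjTranspose_one, Matrix.mul_one] at h
    rw [← Complex.ofReal_re (frob _), ← h, Matrix.trace, Complex.re_sum]
    rfl
  simp only [this]
  exact integrable_finsetSum _ fun m _ => (hx.psd_integrable m m).re

theorem IsWSS.gram (hx : IsWSS P x Cx) (t τ τ' : ℝ) (m l : Fin M) :
    ((∫ ω, x (t - τ) ω m * x (t - τ') ω l ∂P : ℝ) : ℂ) = ∫ f, chr f (τ - τ')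
      * (CFC.sqrt (Cx f) * (CFC.sqrt (Cx f)).conjTranspose) m l := by
  have h := hx.correlation (t - τ') (τ' - τ) m l
  rw [show t - τ' + (τ' - τ) = t - τ by ring] at h
  rw [h]
  congr 1
  ext f
  rw [sqrt_conjTranspose, sqrt_mul_sqrt (hx.psd_posSemidef f), chr]
  congr 2
  push_cast
  ring

theorem IsWSS.fir_isometry (hx : IsWSS P x Cx) (t : ℝ) {r : ℕ} (A : Taps r M) :
    ∫ ω, ‖evec (firOut (fun τ => x (t - τ)) A ω)‖ ^ 2 ∂P
      = ∫ f, ‖fvec (tapFreq (fun τ => τ) A f * CFC.sqrt (Cx f))‖ ^ 2 :=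
  TaskADC.fir_isometry hx.memLp_sqrt (fun _ m => hx.memLp _ m) (fun τ τ' m l => hx.gram t τ τ' m l) A

theorem IsWSS.memLp_fir (hx : IsWSS P x Cx) (t : ℝ) {r : ℕ} (A : Taps r M) :
    MemLp (fun ω => evec (firOut (fun τ => x (t - τ)) A ω)) 2 P :=
  memLp_evec_iff.mpr (memLp_firOut (fun _ m => hx.memLp _ m) A)

theorem isFilterOutput_iff (hx : IsWSS P x Cx) {r : ℕ} {H : ℝ → Matrix (Fin r) (Fin M) ℂ} {t : ℝ}
    {Y : Ω → Fin r → ℝ} : IsFilterOutput P x Cx H t Y ↔ MemLp (fun ω => evec (Y ω)) 2 P ∧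
      ∃ A : ℕ → Taps r M,
        Tendsto (fun j => eLpNorm (fun f => fvec ((H f - tapFreq (fun τ => τ) (A j) f)
          * CFC.sqrt (Cx f))) 2 volume) atTop (𝓝 0) ∧
        Tendsto (fun j => eLpNorm (fun ω => evec (Y ω - firOut (fun τ => x (t - τ)) (A j) ω)) 2 P)
          atTop (𝓝 0) := by
  rw [IsFilterOutput, memLp_evec_iff]
  refine and_congr_right fun hY => exists_congr fun A => and_congr ?_ ?_
  · simp only [filterPower_eq hx.psd_posSemidef]
    constructor
    · exact ENNReal_tendsto_zero_of_sq
    · intro h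
      have := ((ENNReal.continuous_pow 2).tendsto _).comp h
      rw [zero_pow two_ne_zero] at this
      exact this
  · exact (tendsto_evec_iff fun j i =>
      (hY i).1.sub (memLp_evec_iff.mp (hx.memLp_fir t (A j)) i).1).symm

/-- Finite output power is automatic: some tapped delay line is within finite weighted distance of
`H`, and its own response has finite power. -/
theorem IsFilterOutput.memLp_weighted (hx : IsWSS P x Cx) {r : ℕ}
    {H : ℝ → Matrix (Fin r) (Fin M) ℂ} (hH : EntryMeas H) {t : ℝ} {Y : Ω → Fin r → ℝ}
    (h : IsFilterOutput P x Cx H t Y) :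
    MemLp (fun f => fvec (H f * CFC.sqrt (Cx f))) 2 volume := by
  obtain ⟨-, A, hA, -⟩ := (isFilterOutput_iff hx).mp h
  have hm : EntryMeas fun f => H f * CFC.sqrt (Cx f) := hH.mul hx.entryMeas_sqrt
  obtain ⟨j, hj⟩ := ((tendsto_order.mp hA).2 1 one_pos).exists
  have h1 : MemLp (fun f => fvec ((H f - tapFreq (fun τ => τ) (A j) f) * CFC.sqrt (Cx f))) 2
      volume := by
    refine ⟨aesm_fvec fun i k => ?_, hj.trans ENNReal.one_lt_top⟩
    exact ((hH.sub fun i k => (continuous_tapFreq _ (A j) i k).measurable).mul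
      hx.entryMeas_sqrt i k).aestronglyMeasurable
  have h2 := h1.add (memLp_tapFreq_mul (fun τ => τ) hx.memLp_sqrt (A j))
  refine h2.ae_eq (Eventually.of_forall fun f => ?_)
  simp only [Pi.add_apply, ← fvec_add, ← Matrix.add_mul, sub_add_cancel]

/-- The mean power of a filter output. -/
theorem IsFilterOutput.isometry (hx : IsWSS P x Cx) {r : ℕ}
    {H : ℝ → Matrix (Fin r) (Fin M) ℂ} (hH : EntryMeas H) {t : ℝ} {Y : Ω → Fin r → ℝ}
    (h : IsFilterOutput P x Cx H t Y) :
    ∫ ω, ‖evec (Y ω)‖ ^ 2 ∂P = ∫ f, ‖fvec (H f * CFC.sqrt (Cx f))‖ ^ 2 := by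
  have hm := h.memLp_weighted hx hH
  obtain ⟨hY, A, hA, hA'⟩ := (isFilterOutput_iff hx).mp h
  have h1 := tendsto_integral_norm_sq
    (f := fun j ω => evec (firOut (fun τ => x (t - τ)) (A j) ω)) (fun j => hx.memLp_fir t (A j)) hY
    (hA'.congr fun j => rfl)
  have h2 := tendsto_integral_norm_sq
    (f := fun j f => fvec (tapFreq (fun τ => τ) (A j) f * CFC.sqrt (Cx f)))
    (fun j => memLp_tapFreq_mul (fun τ => τ) hx.memLp_sqrt (A j)) hm
    (hA.congr fun j => by simp only [Matrix.sub_mul, fvec_sub])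
  simp only [hx.fir_isometry] at h1
  exact tendsto_nhds_unique h1 h2

/-- Advancing all delays by `t` multiplies the response by a phase. All samples thus become outputs
at the one time `0`, where they can be combined linearly. -/
theorem IsFilterOutput.shift (hx : IsWSS P x Cx) {r : ℕ}
    {H : ℝ → Matrix (Fin r) (Fin M) ℂ} {t : ℝ} {Y : Ω → Fin r → ℝ}
    (h : IsFilterOutput P x Cx H t Y) :
    IsFilterOutput P x Cx (fun f => chr f (-t) • H f) 0 Y := by
  obtain ⟨hY, A, hA, hA'⟩ := (isFilterOutput_iff hx).mp h
  refine (isFilterOutput_iff hx).mpr ⟨hY, fun j => (A j).mapDomain (fun τ => τ - t), ?_, ?_⟩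
  · refine hA.congr fun j => eLpNorm_congr_norm_ae (Eventually.of_forall fun f => ?_)
    have e : tapFreq (fun τ => τ) ((A j).mapDomain (fun τ => τ - t)) f
        = chr f (-t) • tapFreq (fun τ => τ) (A j) f := by
      rw [tapFreq, Finsupp.sum_mapDomain_index (fun a => by ext; simp)
        (fun a b c => by ext; simp [mul_add]), tapFreq, Finsupp.smul_sum]
      refine Finsupp.sum_congr fun τ _ => ?_
      rw [sub_eq_add_neg, chr_add, smul_smul, mul_comm]
    rw [e, ← smul_sub, Matrix.smul_mul]
    have : ∀ M' : Matrix (Fin r) (Fin M) ℂ, fvec (chr f (-t) • M') = chr f (-t) • fvec M' :=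
      fun _ => rfl
    rw [this, norm_smul, norm_chr, one_mul]
  · refine hA'.congr fun j => ?_
    congr 1
    ext1 ω
    congr 2
    rw [firOut, firOut, Finsupp.sum_mapDomain_index (fun a => by simp)
      (fun a b c => Matrix.add_mulVec _ _ _)]
    refine Finsupp.sum_congr fun τ _ => ?_
    rw [show (0 : ℝ) - (τ - t) = t - τ by ring]

theorem eLpNorm_add_tendsto_zero {α E : Type*} [MeasurableSpace α] [NormedAddCommGroup E]
    {μ : Measure α} {u v w : ℕ → α → E} (hu : Tendsto (fun j => eLpNorm (u j) 2 μ) atTop (𝓝 0))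
    (hv : Tendsto (fun j => eLpNorm (v j) 2 μ) atTop (𝓝 0))
    (hum : ∀ j, AEStronglyMeasurable (u j) μ) (hvm : ∀ j, AEStronglyMeasurable (v j) μ)
    (hw : ∀ j a, w j a = u j a + v j a) : Tendsto (fun j => eLpNorm (w j) 2 μ) atTop (𝓝 0) := by
  have := hu.add hv
  rw [add_zero] at this
  refine tendsto_of_tendsto_of_tendsto_of_le_of_le tendsto_const_nhds this
    (fun _ => zero_le) fun j => ?_
  rw [show w j = u j + v j from funext (hw j)]
  exact eLpNorm_add_le (hum j) (hvm j) (by norm_num)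

theorem aesm_weighted (hx : IsWSS P x Cx) {r : ℕ} {H : ℝ → Matrix (Fin r) (Fin M) ℂ}
    (hH : EntryMeas H) (A : Taps r M) : AEStronglyMeasurable (fun f =>
      fvec ((H f - tapFreq (fun τ => τ) A f) * CFC.sqrt (Cx f))) volume :=
  aesm_fvec fun i k => ((hH.sub fun i k => (continuous_tapFreq _ A i k).measurable).mul
    hx.entryMeas_sqrt i k).aestronglyMeasurable

theorem IsFilterOutput.add (hx : IsWSS P x Cx) {r : ℕ}
    {H H' : ℝ → Matrix (Fin r) (Fin M) ℂ} (hH : EntryMeas H) (hH' : EntryMeas H')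
    {t : ℝ} {Y Y' : Ω → Fin r → ℝ}
    (h : IsFilterOutput P x Cx H t Y) (h' : IsFilterOutput P x Cx H' t Y') :
    IsFilterOutput P x Cx (fun f => H f + H' f) t (fun ω => Y ω + Y' ω) := by
  obtain ⟨hY, A, hA, hAY⟩ := (isFilterOutput_iff hx).mp h
  obtain ⟨hY', A', hA', hAY'⟩ := (isFilterOutput_iff hx).mp h'
  refine (isFilterOutput_iff hx).mpr ⟨hY.add hY', fun j => A j + A' j, ?_, ?_⟩
  · refine eLpNorm_add_tendsto_zero hA hA' (fun j => aesm_weighted hx hH _)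
      (fun j => aesm_weighted hx hH' _) fun j f => ?_
    rw [← fvec_add, ← Matrix.add_mul, tapFreq_add]
    congr 2
    abel
  · refine eLpNorm_add_tendsto_zero hAY hAY' (fun j => (hY.sub (hx.memLp_fir t (A j))).1)
      (fun j => (hY'.sub (hx.memLp_fir t (A' j))).1) fun j ω => ?_
    rw [firOut_add, ← WithLp.toLp_add]
    congr 1
    abel

theorem tapFreq_mapRange {ι : Type*} (t : ι → ℝ) {r r' p : ℕ}
    (C : Matrix (Fin r') (Fin r) ℝ) (c : ι →₀ Matrix (Fin r) (Fin p) ℝ) (f : ℝ) :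
    tapFreq t (c.mapRange (fun D => C * D) (Matrix.mul_zero _)) f
      = C.map (fun a : ℝ => (a : ℂ)) * tapFreq t c f := by
  rw [tapFreq, Finsupp.sum_mapRange_index (fun a => by ext; simp), tapFreq, Finsupp.sum,
    Finsupp.sum, Matrix.mul_sum]
  refine Finset.sum_congr rfl fun τ _ => ?_
  rw [Matrix.mul_smul]
  congr 1
  exact Matrix.map_mul (f := Complex.ofRealHom)

theorem norm_fvec_mul_le {r r' p : ℕ} (C : Matrix (Fin r') (Fin r) ℂ)
    (D : Matrix (Fin r) (Fin p) ℂ) : ‖fvec (C * D)‖ ≤ ‖fvec C‖ * ‖fvec D‖ := by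
  refine le_of_sq_le_sq ?_ (by positivity)
  rw [mul_pow, norm_fvec_sq, norm_fvec_sq, norm_fvec_sq, frob, frob, Finset.sum_mul]
  refine Finset.sum_le_sum fun i _ => ?_
  have hD : frob D = ∑ j, ∑ k, ‖D k j‖ ^ 2 := Finset.sum_comm
  rw [hD, Finset.mul_sum]
  refine Finset.sum_le_sum fun j _ => ?_
  rw [Matrix.mul_apply]
  calc ‖∑ k, C i k * D k j‖ ^ 2 ≤ (∑ k, ‖C i k‖ * ‖D k j‖) ^ 2 := by
        refine pow_le_pow_left₀ (norm_nonneg _) ((norm_sum_le _ _).trans ?_) 2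
        simp
    _ ≤ _ := Finset.sum_mul_sq_le_sq_mul_sq _ _ _

theorem norm_evec_mulVec_le {r r' : ℕ} (C : Matrix (Fin r') (Fin r) ℝ) (y : Fin r → ℝ) :
    ‖evec (C.mulVec y)‖ ≤ ‖fvec (C.map (fun a : ℝ => (a : ℂ)))‖ * ‖evec y‖ := by
  have h := norm_fvec_mul_le (C.map (fun a : ℝ => (a : ℂ)))
    (Matrix.of fun (k : Fin r) (_ : Fin 1) => ((y k : ℝ) : ℂ))
  have e1 : ‖fvec (Matrix.of fun (k : Fin r) (_ : Fin 1) => ((y k : ℝ) : ℂ))‖ = ‖evec y‖ := by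
    rw [← sq_eq_sq₀ (norm_nonneg _) (norm_nonneg _), norm_fvec_sq, norm_evec_sq]
    simp [frob]
  have e2 : ‖fvec (C.map (fun a : ℝ => (a : ℂ))
      * (Matrix.of fun (k : Fin r) (_ : Fin 1) => ((y k : ℝ) : ℂ)))‖ = ‖evec (C.mulVec y)‖ := by
    rw [← sq_eq_sq₀ (norm_nonneg _) (norm_nonneg _), norm_fvec_sq, norm_evec_sq]
    simp only [frob, Matrix.mul_apply, Matrix.map_apply, Matrix.of_apply, Matrix.mulVec,
      dotProduct, ← Complex.ofReal_mul, ← Complex.ofReal_sum, Complex.norm_real]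
    simp
  rw [e1, e2] at h
  exact h

theorem eLpNorm_tendsto_zero_of_le {α E F : Type*} [MeasurableSpace α] [NormedAddCommGroup E]
    [NormedAddCommGroup F] {μ : Measure α} {u : ℕ → α → E} {v : ℕ → α → F} {c : ℝ}
    (hu : Tendsto (fun j => eLpNorm (u j) 2 μ) atTop (𝓝 0))
    (h : ∀ j a, ‖v j a‖ ≤ c * ‖u j a‖) : Tendsto (fun j => eLpNorm (v j) 2 μ) atTop (𝓝 0) := by
  have := ENNReal.Tendsto.const_mul (a := ENNReal.ofReal c) hu (Or.inr ENNReal.ofReal_ne_top)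
  rw [mul_zero] at this
  exact tendsto_of_tendsto_of_tendsto_of_le_of_le tendsto_const_nhds this (fun _ => zero_le)
    fun j => eLpNorm_le_mul_eLpNorm_of_ae_le_mul (Eventually.of_forall (h j)) 2

theorem IsFilterOutput.mulVec (hx : IsWSS P x Cx) {r r' : ℕ} (C : Matrix (Fin r') (Fin r) ℝ)
    {H : ℝ → Matrix (Fin r) (Fin M) ℂ} {t : ℝ} {Y : Ω → Fin r → ℝ}
    (h : IsFilterOutput P x Cx H t Y) :
    IsFilterOutput P x Cx (fun f => C.map (fun a : ℝ => (a : ℂ)) * H f) t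
      (fun ω => C.mulVec (Y ω)) := by
  obtain ⟨hY, A, hA, hAY⟩ := (isFilterOutput_iff hx).mp h
  refine (isFilterOutput_iff hx).mpr ⟨?_,
    fun j => (A j).mapRange (fun D => C * D) (Matrix.mul_zero _), ?_, ?_⟩
  · rw [memLp_evec_iff] at hY ⊢
    intro i
    simp only [Matrix.mulVec, dotProduct]
    exact memLp_finsetSum _ fun k _ => (hY k).const_mul _
  · refine eLpNorm_tendsto_zero_of_le (c := ‖fvec (C.map (fun a : ℝ => (a : ℂ)))‖) hA
      fun j f => ?_
    rw [tapFreq_mapRange, ← Matrix.mul_sub, Matrix.mul_assoc]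
    exact norm_fvec_mul_le _ _
  · refine eLpNorm_tendsto_zero_of_le (c := ‖fvec (C.map (fun a : ℝ => (a : ℂ)))‖) hAY
      fun j ω => ?_
    rw [firOut_mapRange, ← Matrix.mulVec_sub]
    exact norm_evec_mulVec_le _ _

theorem IsFilterOutput.zero (hx : IsWSS P x Cx) {r : ℕ} (t : ℝ) :
    IsFilterOutput P x Cx (fun _ => (0 : Matrix (Fin r) (Fin M) ℂ)) t (fun _ => 0) := by
  refine (isFilterOutput_iff hx).mpr ⟨MemLp.zero, fun _ => 0, ?_, ?_⟩
  · refine tendsto_const_nhds.congr fun j => ?_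
    simp [tapFreq, fvec]
    symm
    exact eLpNorm_zero
  · refine tendsto_const_nhds.congr fun j => ?_
    simp [firOut]

theorem IsFilterOutput.sum (hx : IsWSS P x Cx) {r : ℕ} {κ : Type*} (s : Finset κ)
    {H : κ → ℝ → Matrix (Fin r) (Fin M) ℂ} (hH : ∀ k, EntryMeas (H k))
    {t : ℝ} {Y : κ → Ω → Fin r → ℝ} (h : ∀ k, IsFilterOutput P x Cx (H k) t (Y k)) :
    IsFilterOutput P x Cx (fun f => ∑ k ∈ s, H k f) t (fun ω => ∑ k ∈ s, Y k ω) := by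
  classical
  induction s using Finset.induction_on with
  | empty => simpa using IsFilterOutput.zero hx t
  | insert a s ha ih =>
    simp only [Finset.sum_insert ha]
    exact (h a).add hx (hH a) (EntryMeas.sum s hH) ih

/-- Filter outputs are determined by the driving process. -/
theorem IsFilterOutput.aesm (hx : IsWSS P x Cx) {r : ℕ}
    {H : ℝ → Matrix (Fin r) (Fin M) ℂ} {t : ℝ} {Y : Ω → Fin r → ℝ}
    (h : IsFilterOutput P x Cx H t Y) (i : Fin r) :
    AEStronglyMeasurable[sigmaOf x] (fun ω => Y ω i) P := by
  obtain ⟨hY, A, -, hA⟩ := h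
  have hle : sigmaOf x ≤ ‹MeasurableSpace Ω› := iSup_le fun t => (hx.measurable t).comap_le
  -- Measurability with respect to a sub-σ-algebra is a closed condition in `L²`, and finite delay
  -- lines satisfy it.
  have hcl := isClosed_aestronglyMeasurable (F := ℝ) (p := 2) (μ := P) hle
  have hout : ∀ j, MemLp (fun ω => (A j).out x t ω i) 2 P := fun j =>
    memLp_evec_iff.mp (hx.memLp_fir t (A j)) i
  have hlim : Tendsto (fun j => (hout j).toLp _) atTop (𝓝 ((hY i).toLp _)) := by
    rw [Lp.tendsto_Lp_iff_tendsto_eLpNorm'']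
    refine (hA i).congr fun j => ?_
    rw [eLpNorm_sub_comm]
    rfl
  have := hcl.mem_of_tendsto hlim (Eventually.of_forall fun j => ?_)
  · exact AEStronglyMeasurable.congr this (hY i).coeFn_toLp
  · refine AEStronglyMeasurable.congr ?_ (hout j).coeFn_toLp.symm
    refine StronglyMeasurable.aestronglyMeasurable (Measurable.stronglyMeasurable ?_)
    have hxm : ∀ t m, Measurable[sigmaOf x] fun ω => x t ω m := fun t m =>
      (measurable_pi_apply m).comp (Measurable.of_comap_le (le_iSup
        (fun t => MeasurableSpace.comap (x t) inferInstance) t))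
    have e : (fun ω => (A j).out x t ω i) = fun ω => ∑ a ∈ (A j).support ×ˢ Finset.univ,
        A j a.1 i a.2 * x (t - a.1) ω a.2 :=
      funext fun ω => firOut_apply (fun τ => x (t - τ)) (A j) ω i
    rw [e]
    exact Finset.measurable_sum _ fun a _ => (hxm _ _).const_mul _

/-- Conjugate-symmetric filters with finite output power have outputs. -/
theorem exists_isFilterOutput (hx : IsWSS P x Cx) {R : ℝ} (hR : 0 < R)
    (hband : ∀ f : ℝ, R < |f| → Cx f = 0) {r : ℕ} {H : ℝ → Matrix (Fin r) (Fin M) ℂ}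
    (hH : IsFreqResponse H) (hpow : MemLp (fun f => fvec (H f * CFC.sqrt (Cx f))) 2 volume)
    (t : ℝ) : ∃ Y : Ω → Fin r → ℝ, IsFilterOutput P x Cx H t Y := by
  -- Outside the band the weight vanishes, so approximation on a bounded interval suffices.
  have hsupp : ∀ F : ℝ → Matrix (Fin r) (Fin M) ℂ,
      eLpNorm (fun f => fvec (F f * CFC.sqrt (Cx f))) 2 (volume.restrict (Set.Icc (-R) R))
        = eLpNorm (fun f => fvec (F f * CFC.sqrt (Cx f))) 2 volume := by
    intro F
    refine eLpNorm_restrict_eq_of_support_subset fun f hf => ?_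
    by_contra hfR
    refine hf ?_
    have : R < |f| := by
      rw [Set.mem_Icc, ← abs_le, not_le] at hfR
      exact hfR
    simp only [hband f this, CFC.sqrt_zero, Matrix.mul_zero]
    rfl
  have happ : ∀ j : ℕ, ∃ A : Taps r M, eLpNorm (fun f => fvec ((H f - tapFreq (fun τ => τ) A f)
      * CFC.sqrt (Cx f))) 2 volume < ((j : ENNReal) + 1)⁻¹ := by
    intro j
    obtain ⟨A, hA⟩ := exists_tapFreq_approx (t := fun τ : ℝ => τ) hR (fun n => ⟨_, rfl⟩)
      (hx.memLp_sqrt.restrict _) (hpow.restrict _) (ae_restrict_of_ae hH.conj_symm)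
      (ε := ((j : ENNReal) + 1)⁻¹) (by simp)
    exact ⟨A, by rwa [hsupp fun f => H f - tapFreq (fun τ => τ) A f] at hA⟩
  choose A hA using happ
  have hA0 : Tendsto (fun j => eLpNorm (fun f => fvec ((H f - tapFreq (fun τ => τ) (A j) f)
      * CFC.sqrt (Cx f))) 2 volume) atTop (𝓝 0) := by
    refine tendsto_of_tendsto_of_tendsto_of_le_of_le tendsto_const_nhds
      (ENNReal.tendsto_inv_nat_nhds_zero.comp (tendsto_add_atTop_nat 1)) (fun _ => zero_le)
      fun j => ?_
    simpa using (hA j).le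
  have hout := fun j => hx.memLp_fir t (A j)
  have hfr := fun j => memLp_tapFreq_mul (fun τ : ℝ => τ) hx.memLp_sqrt (A j)
  have hlim : Tendsto (fun j => (hfr j).toLp _) atTop (𝓝 (hpow.toLp _)) := by
    rw [Lp.tendsto_Lp_iff_tendsto_eLpNorm'']
    refine hA0.congr fun j => ?_
    rw [eLpNorm_sub_comm]
    refine eLpNorm_congr_ae (Eventually.of_forall fun f => ?_)
    simp only [Pi.sub_apply, ← fvec_sub, Matrix.sub_mul]
  -- The isometry transports the Cauchy property from the frequency domain to the outputs;
  -- completeness then supplies the limit.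
  have hdist : ∀ j k, dist ((hout j).toLp _) ((hout k).toLp _)
      = dist ((hfr j).toLp _) ((hfr k).toLp _) := by
    intro j k
    rw [dist_eq_norm, dist_eq_norm, ← MemLp.toLp_sub, ← MemLp.toLp_sub, Lp.norm_toLp,
      Lp.norm_toLp]
    congr 1
    refine eLpNorm_eq_of_integral_eq ((hout j).sub (hout k)) ((hfr j).sub (hfr k)) ?_
    have := hx.fir_isometry t (A j - A k)
    simp only [firOut_sub, tapFreq_sub, Matrix.sub_mul, fvec_sub] at this
    exact this
  have hcauchy : CauchySeq fun j => (hout j).toLp _ := by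
    have := hlim.cauchySeq
    rw [Metric.cauchySeq_iff] at this ⊢
    simpa only [hdist] using this
  obtain ⟨y, hy⟩ := cauchySeq_tendsto_of_complete hcauchy
  refine ⟨fun ω => WithLp.ofLp (y ω), (isFilterOutput_iff hx).mpr ⟨Lp.memLp y, A, hA0, ?_⟩⟩
  rw [← Lp.toLp_coeFn y (Lp.memLp y), Lp.tendsto_Lp_iff_tendsto_eLpNorm''] at hy
  refine hy.congr fun j => ?_
  rw [eLpNorm_sub_comm]
  rfl

end

/-! ### Triangular dither -/

/-- The triangular law. -/
def triLaw (Δ : ℝ) : Measure ℝ :=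
  volume.withDensity fun u => ENNReal.ofReal (triangularPdf Δ u)

theorem triangularPdf_eq {Δ : ℝ} (hΔ : 0 < Δ) (s : ℝ) :
    triangularPdf Δ (Δ * s) = Δ⁻¹ * Set.indicator (Set.Icc (-1) 1) (fun s => 1 - |s|) s := by
  have h1 : |Δ * s| = Δ * |s| := by rw [abs_mul, abs_of_pos hΔ]
  rw [triangularPdf, h1]
  by_cases h : |s| ≤ 1
  · rw [if_pos (by nlinarith), Set.indicator_of_mem (show s ∈ Set.Icc (-1 : ℝ) 1 from abs_le.mp h)]
    field_simp
  · rw [if_neg (by rw [not_le] at h ⊢; nlinarith), Set.indicator_of_notMem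
      (show s ∉ Set.Icc (-1 : ℝ) 1 from fun h' => h (abs_le.mpr h')), mul_zero]

theorem triangularPdf_nonneg {Δ : ℝ} (hΔ : 0 < Δ) (u : ℝ) : 0 ≤ triangularPdf Δ u := by
  rw [triangularPdf]
  split_ifs with h
  · have : |u| / Δ ≤ 1 := (div_le_one hΔ).mpr h
    have : 0 < 1 / Δ := by positivity
    nlinarith
  · exact le_rfl

theorem measurable_triangularPdf (Δ : ℝ) : Measurable (triangularPdf Δ) := by
  unfold triangularPdf
  refine Measurable.ite (measurableSet_le (by fun_prop) measurable_const) ?_ measurable_const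
  fun_prop

theorem integral_triLaw {Δ : ℝ} (hΔ : 0 < Δ) (F : ℝ → ℝ) :
    ∫ u, F u ∂(triLaw Δ) = ∫ s in (-1 : ℝ)..1, (1 - |s|) * F (Δ * s) := by
  rw [triLaw, integral_withDensity_eq_integral_toReal_smul
    (measurable_triangularPdf Δ).ennreal_ofReal (Eventually.of_forall fun _ => ENNReal.ofReal_lt_top)]
  have h1 := Measure.integral_comp_mul_left
    (fun u => (ENNReal.ofReal (triangularPdf Δ u)).toReal • F u) Δ
  have h2 : ∫ u, (ENNReal.ofReal (triangularPdf Δ u)).toReal • F u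
      = Δ * ∫ s, (ENNReal.ofReal (triangularPdf Δ (Δ * s))).toReal • F (Δ * s) := by
    rw [h1, abs_of_pos (inv_pos.mpr hΔ), smul_eq_mul, ← mul_assoc, mul_inv_cancel₀ hΔ.ne', one_mul]
  rw [h2, intervalIntegral.integral_of_le (by norm_num), ← integral_Icc_eq_integral_Ioc,
    ← integral_indicator measurableSet_Icc, ← integral_const_mul]
  congr 1
  ext s
  rw [ENNReal.toReal_ofReal (triangularPdf_nonneg hΔ _), triangularPdf_eq hΔ]
  by_cases hs : s ∈ Set.Icc (-1 : ℝ) 1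
  · rw [Set.indicator_of_mem hs, Set.indicator_of_mem hs, smul_eq_mul]
    field_simp
  · rw [Set.indicator_of_notMem hs, Set.indicator_of_notMem hs]; simp

theorem ae_triLaw_abs_le {Δ : ℝ} : ∀ᵐ u ∂(triLaw Δ), |u| ≤ Δ := by
  rw [triLaw, ae_withDensity_iff (measurable_triangularPdf Δ).ennreal_ofReal]
  refine Eventually.of_forall fun u hu => ?_
  by_contra h
  exact hu (by simp [triangularPdf, h])

theorem granular_sub_abs_le {Δ : ℝ} (hΔ : 0 < Δ) (v : ℝ) : |granular Δ v - v| ≤ Δ / 2 := by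
  have h1 := Int.floor_le (v / Δ)
  have h2 := Int.lt_floor_add_one (v / Δ)
  have h3 : v = Δ * (v / Δ) := by field_simp
  rw [granular, abs_le]
  constructor <;> nlinarith

theorem measurable_granular (Δ : ℝ) : Measurable (granular Δ) := by
  unfold granular
  have : Measurable fun u : ℝ => ((⌊u / Δ⌋ : ℤ) : ℝ) :=
    (measurable_from_top (f := fun n : ℤ => (n : ℝ))).comp
      (Int.measurable_floor.comp (measurable_id.div_const Δ))
  exact (this.add_const _).const_mul _

/-- With the input at fractional position `r` of its cell, a dither of at most one step reaches just
three cells, with breaks at `-r` and `1 - r`. The coefficients are their triangular masses; the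
middle piece is also split at `0` to remove the absolute value. -/
theorem integral_tri_step {r : ℝ} (hr0 : 0 ≤ r) (hr1 : r < 1) {F : ℝ → ℝ} (a b c : ℝ)
    (ha : ∀ s, -1 < s → s < -r → F s = a) (hb : ∀ s, -r < s → s < 1 - r → F s = b)
    (hc : ∀ s, 1 - r < s → s < 1 → F s = c) :
    ∫ s in (-1 : ℝ)..1, (1 - |s|) * F s
      = a * ((1 - r) ^ 2 / 2) + b * (1 - (1 - r) ^ 2 / 2 - r ^ 2 / 2) + c * (r ^ 2 / 2) := by
  have piece : ∀ (p q v e : ℝ), p ≤ q → (∀ s, p < s → s < q → F s = v) →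
      (∀ s, p < s → s < q → |s| = e * s) →
      IntervalIntegrable (fun s => (1 - |s|) * F s) volume p q ∧
      ∫ s in p..q, (1 - |s|) * F s = v * ((q - p) - e * (q ^ 2 - p ^ 2) / 2) := by
    intro p q v e hpq hv he
    have hae : ∀ᵐ s : ℝ, s ∈ Set.uIoc p q → (1 - e * s) * v = (1 - |s|) * F s := by
      have hq : ∀ᵐ s : ℝ, s ≠ q := by simp [ae_iff]
      filter_upwards [hq] with s hs hm
      rw [Set.uIoc_of_le hpq] at hm
      have hlt := lt_of_le_of_ne hm.2 hs
      rw [hv s hm.1 hlt, he s hm.1 hlt]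
    constructor
    · refine IntervalIntegrable.congr_ae ?_ ((ae_restrict_iff' measurableSet_uIoc).mpr hae)
      exact Continuous.intervalIntegrable (by fun_prop) _ _
    · rw [← intervalIntegral.integral_congr_ae hae, intervalIntegral.integral_mul_const,
        intervalIntegral.integral_sub (by simp) (Continuous.intervalIntegrable (by fun_prop) _ _),
        intervalIntegral.integral_const_mul, integral_id]
      simp
      ring
  obtain ⟨i1, e1⟩ := piece (-1) (-r) a (-1) (by linarith) ha
    (fun s _ h => by rw [abs_of_neg (by linarith)]; ring)
  obtain ⟨i2, e2⟩ := piece (-r) 0 b (-1) (by linarith) (fun s h1 h2 => hb s h1 (by linarith))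
    (fun s _ h => by rw [abs_of_neg (by linarith)]; ring)
  obtain ⟨i3, e3⟩ := piece 0 (1 - r) b 1 (by linarith) (fun s h1 h2 => hb s (by linarith) h2)
    (fun s h _ => by rw [abs_of_pos h]; ring)
  obtain ⟨i4, e4⟩ := piece (1 - r) 1 c 1 (by linarith) hc
    (fun s h _ => by rw [abs_of_pos (by linarith)]; ring)
  rw [← intervalIntegral.integral_add_adjacent_intervals i1 (i2.trans (i3.trans i4)),
    ← intervalIntegral.integral_add_adjacent_intervals i2 (i3.trans i4),
    ← intervalIntegral.integral_add_adjacent_intervals i3 i4, e1, e2, e3, e4]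
  ring

/-- Subtractive moments of the dithered quantizer. -/
theorem integral_granular {Δ : ℝ} (hΔ : 0 < Δ) (a : ℝ) :
    ∫ u, granular Δ (a + u) ∂(triLaw Δ) = a ∧
    ∫ u, granular Δ (a + u) ^ 2 ∂(triLaw Δ) = a ^ 2 + Δ ^ 2 / 4 := by
  -- The input is `Δ * (m + r)` with `0 ≤ r < 1`; the reachable outputs are the midpoints of cells
  -- `m - 1`, `m` and `m + 1`.
  set m : ℤ := ⌊a / Δ⌋ with hm
  set r : ℝ := a / Δ - m with hr
  have hr0 : 0 ≤ r := sub_nonneg.mpr (Int.floor_le _)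
  have hr1 : r < 1 := by have := Int.lt_floor_add_one (a / Δ); simp only [hr]; linarith
  have ha : a = Δ * (m + r) := by simp only [hr]; field_simp; ring
  have hdiv : ∀ s, (a + Δ * s) / Δ = m + r + s := fun s => by rw [ha]; field_simp
  have hfl : ∀ (k : ℤ) s, k ≤ r + s → r + s < k + 1 →
      granular Δ (a + Δ * s) = Δ * (m + k + 1 / 2) := by
    intro k s h1 h2
    rw [granular, hdiv]
    have : ⌊(m : ℝ) + r + s⌋ = m + k := by
      rw [Int.floor_eq_iff]
      push_cast
      constructor <;> linarith
    rw [this]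
    push_cast
    ring
  have h1 : ∀ s, -1 < s → s < -r → granular Δ (a + Δ * s) = Δ * (m - 1 + 1 / 2) := by
    intro s h1 h2
    rw [hfl (-1) s (by push_cast; linarith) (by push_cast; linarith)]
    push_cast; ring
  have h2 : ∀ s, -r < s → s < 1 - r → granular Δ (a + Δ * s) = Δ * (m + 1 / 2) := by
    intro s h1 h2
    rw [hfl 0 s (by push_cast; linarith) (by push_cast; linarith)]
    push_cast; ring
  have h3 : ∀ s, 1 - r < s → s < 1 → granular Δ (a + Δ * s) = Δ * (m + 1 + 1 / 2) := by
    intro s h1 h2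
    rw [hfl 1 s (by push_cast; linarith) (by push_cast; linarith)]
    push_cast; ring
  constructor
  · rw [integral_triLaw hΔ, integral_tri_step hr0 hr1 _ _ _ h1 h2 h3, ha]
    ring
  · rw [integral_triLaw hΔ, integral_tri_step hr0 hr1 (F := fun s => granular Δ (a + Δ * s) ^ 2)
      _ _ _ (fun s x y => by rw [h1 s x y]) (fun s x y => by rw [h2 s x y])
      (fun s x y => by rw [h3 s x y]), ha]
    ring

theorem integral_tri_moments {Δ : ℝ} (hΔ : 0 < Δ) :
    ∫ u, u ∂(triLaw Δ) = 0 ∧ ∫ u, u ^ 2 ∂(triLaw Δ) = Δ ^ 2 / 6 := by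
  have hc : ∀ k : ℕ, ∀ p q : ℝ,
      IntervalIntegrable (fun s : ℝ => (1 - |s|) * (Δ * s) ^ k) volume p q :=
    fun k p q => Continuous.intervalIntegrable (by fun_prop) _ _
  have key : ∀ k : ℕ, ∫ s in (-1 : ℝ)..1, (1 - |s|) * (Δ * s) ^ k
      = (∫ s in (-1 : ℝ)..0, (1 + s) * (Δ * s) ^ k) + ∫ s in (0 : ℝ)..1, (1 - s) * (Δ * s) ^ k := by
    intro k
    rw [← intervalIntegral.integral_add_adjacent_intervals (hc k (-1) 0) (hc k 0 1)]
    congr 1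
    · refine intervalIntegral.integral_congr fun s hs => ?_
      rw [Set.uIcc_of_le (by norm_num)] at hs
      simp only [abs_of_nonpos hs.2]
      ring
    · refine intervalIntegral.integral_congr fun s hs => ?_
      rw [Set.uIcc_of_le (by norm_num)] at hs
      simp only [abs_of_nonneg hs.1]
  constructor
  · have := integral_triLaw hΔ fun u => u
    have h1 := key 1
    simp only [pow_one] at h1
    rw [this, h1]
    have e1 : ∀ s : ℝ, (1 + s) * (Δ * s) = Δ * s + Δ * s ^ 2 := fun s => by ring
    have e2 : ∀ s : ℝ, (1 - s) * (Δ * s) = Δ * s - Δ * s ^ 2 := fun s => by ring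
    simp only [e1, e2]
    rw [intervalIntegral.integral_add (Continuous.intervalIntegrable (by fun_prop) _ _)
      (Continuous.intervalIntegrable (by fun_prop) _ _),
      intervalIntegral.integral_sub (Continuous.intervalIntegrable (by fun_prop) _ _)
      (Continuous.intervalIntegrable (by fun_prop) _ _)]
    rw [intervalIntegral.integral_const_mul, intervalIntegral.integral_const_mul,
      intervalIntegral.integral_const_mul, intervalIntegral.integral_const_mul]
    simp only [integral_id, integral_pow]
    ring
  · rw [integral_triLaw hΔ, key 2]
    have e1 : ∀ s : ℝ, (1 + s) * (Δ * s) ^ 2 = Δ ^ 2 * s ^ 2 + Δ ^ 2 * s ^ 3 := fun s => by ring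
    have e2 : ∀ s : ℝ, (1 - s) * (Δ * s) ^ 2 = Δ ^ 2 * s ^ 2 - Δ ^ 2 * s ^ 3 := fun s => by ring
    simp only [e1, e2]
    rw [intervalIntegral.integral_add (Continuous.intervalIntegrable (by fun_prop) _ _)
      (Continuous.intervalIntegrable (by fun_prop) _ _),
      intervalIntegral.integral_sub (Continuous.intervalIntegrable (by fun_prop) _ _)
      (Continuous.intervalIntegrable (by fun_prop) _ _)]
    simp only [intervalIntegral.integral_const_mul, integral_pow]
    ring

/-- The quantization error of a dithered quantizer at input `a` and dither `u`. -/
def qerr (Δ a u : ℝ) : ℝ := granular Δ (a + u) - a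

theorem qerr_abs_le {Δ : ℝ} (hΔ : 0 < Δ) {a u : ℝ} (hu : |u| ≤ Δ) : |qerr Δ a u| ≤ 2 * Δ := by
  have h1 := granular_sub_abs_le hΔ (a + u)
  rw [abs_le] at h1 hu
  rw [qerr, abs_le]
  constructor <;> linarith

/-- Neither moment depends on `a`. This is the whole use of the triangular density: conditionally on
the input, the noise always has the same mean and power. -/
theorem integral_qerr {Δ : ℝ} (hΔ : 0 < Δ) [IsProbabilityMeasure (triLaw Δ)] (a : ℝ) :
    ∫ u, qerr Δ a u ∂(triLaw Δ) = 0 ∧ ∫ u, qerr Δ a u ^ 2 ∂(triLaw Δ) = Δ ^ 2 / 4 := by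
  obtain ⟨h1, h2⟩ := integral_granular hΔ a
  have hb : ∀ᵐ u ∂(triLaw Δ), ‖granular Δ (a + u)‖ ≤ 2 * Δ + |a| := by
    filter_upwards [ae_triLaw_abs_le (Δ := Δ)] with u hu
    have := qerr_abs_le hΔ (a := a) hu
    calc ‖granular Δ (a + u)‖ = |qerr Δ a u + a| := by rw [qerr]; simp
      _ ≤ _ := (abs_add_le _ _).trans (by linarith)
  have hmeas : AEStronglyMeasurable (fun u => granular Δ (a + u)) (triLaw Δ) :=
    ((measurable_granular Δ).comp (measurable_const.add measurable_id)).aestronglyMeasurable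
  have hi1 : Integrable (fun u => granular Δ (a + u)) (triLaw Δ) :=
    Integrable.of_bound hmeas _ hb
  have hi2 : Integrable (fun u => granular Δ (a + u) ^ 2) (triLaw Δ) := by
    refine Integrable.of_bound (hmeas.pow 2) ((2 * Δ + |a|) ^ 2) ?_
    filter_upwards [hb] with u hu
    rw [norm_pow]
    exact pow_le_pow_left₀ (norm_nonneg _) hu 2
  constructor
  · simp only [qerr]
    rw [integral_sub hi1 (integrable_const _), h1]
    simp
  · have e : ∀ u, qerr Δ a u ^ 2
        = granular Δ (a + u) ^ 2 - 2 * a * granular Δ (a + u) + a ^ 2 := fun u => by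
      rw [qerr]; ring
    simp only [e]
    refine (integral_add (hi2.sub (hi1.const_mul (2 * a))) (integrable_const _)).trans ?_
    rw [show (fun u => granular Δ (a + u) ^ 2) - (fun u => 2 * a * granular Δ (a + u))
      = fun u => granular Δ (a + u) ^ 2 - 2 * a * granular Δ (a + u) from rfl,
      integral_sub hi2 (hi1.const_mul _), integral_const_mul, h1, h2]
    simp
    ring

/-! ### Second-order statistics of the quantization noise -/

theorem Measurable.qerr {α : Type*} [MeasurableSpace α] (Δ : ℝ) {f g : α → ℝ} (hf : Measurable f)
    (hg : Measurable g) : Measurable fun a => TaskADC.qerr Δ (f a) (g a) := by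
  unfold TaskADC.qerr
  exact ((measurable_granular Δ).comp (hf.add hg)).sub hf

/-- By independence the joint law is a product, and Fubini integrates out `W` with `X` frozen. -/
theorem integral_of_indepFun {Ω α β : Type*} [MeasurableSpace Ω] [MeasurableSpace α]
    [MeasurableSpace β] {P : Measure Ω} [IsProbabilityMeasure P] {X : Ω → α} {W : Ω → β}
    (hX : Measurable X) (hW : Measurable W) (h : IndepFun X W P) {F : α × β → ℝ}
    (hF : Measurable F) (hi : Integrable (fun ω => F (X ω, W ω)) P) :
    ∫ ω, F (X ω, W ω) ∂P = ∫ ω, ∫ u, F (X ω, u) ∂(P.map W) ∂P := by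
  have : IsProbabilityMeasure (P.map W) := Measure.isProbabilityMeasure_map hW.aemeasurable
  have : IsProbabilityMeasure (P.map X) := Measure.isProbabilityMeasure_map hX.aemeasurable
  have h1 := (indepFun_iff_map_prod_eq_prod_map_map hX.aemeasurable hW.aemeasurable).mp h
  have h2 : ∫ ω, F (X ω, W ω) ∂P = ∫ p, F p ∂((P.map X).prod (P.map W)) := by
    rw [← h1, integral_map (hX.prodMk hW).aemeasurable hF.aestronglyMeasurable]
  have h3 : Integrable F ((P.map X).prod (P.map W)) := by
    rw [← h1, integrable_map_measure hF.aestronglyMeasurable (hX.prodMk hW).aemeasurable]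
    exact hi
  rw [h2, integral_prod _ h3, integral_map hX.aemeasurable]
  exact h3.integral_prod_left.1

section

variable {Ω : Type*} [mΩ : MeasurableSpace Ω] {P : Measure Ω} {M N K : ℕ}
  {x : Proc ℝ Ω M} {Cx : ℝ → Matrix (Fin M) (Fin M) ℂ} {s : Ω → Fin N → ℝ}
  {Γ : ℝ → Matrix (Fin N) (Fin M) ℂ} {Δ : ℝ} {w : Proc ℤ Ω K}

theorem IsSignalModel.sigma_le (hm : IsSignalModel P x Cx s Γ) :
    sigmaOf x ⊔ MeasurableSpace.comap s inferInstance ≤ mΩ :=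
  sup_le (iSup_le fun t => (hm.wss.measurable t).comap_le) hm.task_measurable.comap_le

theorem IsDither.measurable_apply (hd : IsDither P x s Δ w) (n : ℤ) (k : Fin K) :
    Measurable fun ω => w n ω k := (measurable_pi_apply k).comp (hd.measurable n)

theorem IsDither.map_eq (hd : IsDither P x s Δ w) (n : ℤ) (k : Fin K) :
    P.map (fun ω => w n ω k) = triLaw Δ := hd.law n k

theorem IsDither.isProbabilityMeasure [IsProbabilityMeasure P]
    (hd : IsDither P x s Δ w) (n : ℤ) (k : Fin K) :
    IsProbabilityMeasure (triLaw Δ) :=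
  hd.map_eq n k ▸ Measure.isProbabilityMeasure_map (hd.measurable_apply n k).aemeasurable

theorem IsDither.ae_abs_le (hd : IsDither P x s Δ w) (n : ℤ) (k : Fin K) :
    ∀ᵐ ω ∂P, |w n ω k| ≤ Δ := by
  have h := ae_triLaw_abs_le (Δ := Δ)
  rw [← hd.map_eq n k] at h
  exact ae_of_ae_map (hd.measurable_apply n k).aemeasurable h

omit mΩ in
theorem IsDither.measurable_sigmaOf (n : ℤ) (k : Fin K) :
    Measurable[sigmaOf w] fun ω => w n ω k := by
  have h : Measurable[sigmaOf w] (w n) := by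
    exact measurable_iff_comap_le.mpr (le_iSup (fun n => MeasurableSpace.comap (w n) _) n)
  exact (measurable_pi_apply k).comp h

theorem IsDither.indepFun {α β : Type*} [MeasurableSpace α] [MeasurableSpace β]
    (hd : IsDither P x s Δ w) {X : Ω → α} {W : Ω → β}
    (hX : Measurable[sigmaOf x ⊔ MeasurableSpace.comap s inferInstance] X)
    (hW : Measurable[sigmaOf w] W) : IndepFun X W P := by
  have h := indep_of_indep_of_le_left (indep_of_indep_of_le_right hd.indep hX.comap_le) hW.comap_le
  exact (IndepFun_iff_Indep _ _ _).mpr h.symm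

variable [IsProbabilityMeasure P] {y z : Proc ℤ Ω K}

theorem IsDither.memLp (hd : IsDither P x s Δ w) (n : ℤ) (k : Fin K) :
    MemLp (fun ω => w n ω k) 2 P :=
  MemLp.of_bound (hd.measurable_apply n k).aestronglyMeasurable Δ (hd.ae_abs_le n k)

-- Samples are mean-square limits, so they are measurable with respect to the input only up to null
-- sets. The version `y'` is the one to which independence of the dither applies.
omit [IsProbabilityMeasure P] in
theorem qerr_ae_eq {n : ℤ} {k : Fin K} {y' : Ω → ℝ} (hy' : (fun ω => y n ω k) =ᵐ[P] y')
    (hz : (fun ω => z n ω k) =ᵐ[P] fun ω => granular Δ (y n ω k + w n ω k)) :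
    (fun ω => z n ω k - y n ω k) =ᵐ[P] fun ω => qerr Δ (y' ω) (w n ω k) := by
  filter_upwards [hy', hz] with ω h1 h2
  rw [h2, h1, qerr]

theorem IsDither.qerr_memLp (hd : IsDither P x s Δ w) (hΔ : 0 < Δ) {n : ℤ} {k : Fin K} {y' : Ω → ℝ}
    (hy' : Measurable y') : MemLp (fun ω => qerr Δ (y' ω) (w n ω k)) 2 P := by
  refine MemLp.of_bound (Measurable.qerr Δ hy' (hd.measurable_apply n k)).aestronglyMeasurable (2 * Δ) ?_
  filter_upwards [hd.ae_abs_le n k] with ω h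
  exact qerr_abs_le hΔ h

/-- With input and task frozen, the error averages to zero over the dither. -/
theorem IsDither.integral_mul_qerr (hm : IsSignalModel P x Cx s Γ) (hd : IsDither P x s Δ w)
    (hΔ : 0 < Δ) (n : ℤ) (k : Fin K) {y' ξ : Ω → ℝ}
    (hy' : Measurable[sigmaOf x ⊔ MeasurableSpace.comap s inferInstance] y')
    (hξ : Measurable[sigmaOf x ⊔ MeasurableSpace.comap s inferInstance] ξ) (hξ2 : MemLp ξ 2 P) :
    ∫ ω, ξ ω * qerr Δ (y' ω) (w n ω k) ∂P = 0 := by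
  have hp := hd.isProbabilityMeasure n k
  have hyξ : Measurable[sigmaOf x ⊔ MeasurableSpace.comap s inferInstance] fun ω => (ξ ω, y' ω) :=
    hξ.prodMk hy'
  have hi := hd.indepFun hyξ (IsDither.measurable_sigmaOf n k)
  have hmyξ : Measurable fun ω => (ξ ω, y' ω) := hyξ.mono hm.sigma_le le_rfl
  have hmy : Measurable y' := hy'.mono hm.sigma_le le_rfl
  have hF : Measurable fun p : (ℝ × ℝ) × ℝ => p.1.1 * qerr Δ p.1.2 p.2 :=
    measurable_fst.fst.mul (Measurable.qerr Δ measurable_fst.snd measurable_snd)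
  have h := integral_of_indepFun hmyξ (hd.measurable_apply n k) hi hF
    (hξ2.integrable_mul (hd.qerr_memLp hΔ hmy))
  rw [h, hd.map_eq]
  simp only [integral_const_mul, (integral_qerr hΔ _).1, mul_zero, integral_zero]

/-- At equal indices this is the conditional second moment, for which the two inputs must coincide.
At distinct indices the two dithers are independent even with the inputs frozen, and the product of
the conditional means vanishes. -/
theorem IsDither.integral_qerr_mul_qerr (hm : IsSignalModel P x Cx s Γ) (hd : IsDither P x s Δ w)
    (hΔ : 0 < Δ) (q q' : ℤ × Fin K) {y' y'' : Ω → ℝ}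
    (hy' : Measurable[sigmaOf x ⊔ MeasurableSpace.comap s inferInstance] y')
    (hy'' : Measurable[sigmaOf x ⊔ MeasurableSpace.comap s inferInstance] y'')
    (heq : q = q' → y' = y'') :
    ∫ ω, qerr Δ (y' ω) (w q.1 ω q.2) * qerr Δ (y'' ω) (w q'.1 ω q'.2) ∂P
      = if q = q' then Δ ^ 2 / 4 else 0 := by
  have hp := hd.isProbabilityMeasure q.1 q.2
  have hmy : Measurable y' := hy'.mono hm.sigma_le le_rfl
  have hmy' : Measurable y'' := hy''.mono hm.sigma_le le_rfl
  have hq := Measurable.qerr Δ measurable_fst measurable_snd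
  split_ifs with h
  · subst h
    rw [← heq rfl]
    have h := integral_of_indepFun hmy (hd.measurable_apply q.1 q.2)
      (hd.indepFun hy' (IsDither.measurable_sigmaOf q.1 q.2))
      (F := fun p => qerr Δ p.1 p.2 * qerr Δ p.1 p.2) (hq.mul hq)
      ((hd.qerr_memLp hΔ hmy).integrable_mul (hd.qerr_memLp hΔ hmy))
    rw [h, hd.map_eq]
    simp only [← pow_two, (integral_qerr hΔ _).2]
    simp
  · have hyy : Measurable[sigmaOf x ⊔ MeasurableSpace.comap s inferInstance]
        fun ω => (y' ω, y'' ω) := hy'.prodMk hy''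
    have hww : Measurable[sigmaOf w] fun ω => (w q.1 ω q.2, w q'.1 ω q'.2) :=
      (IsDither.measurable_sigmaOf q.1 q.2).prodMk (IsDither.measurable_sigmaOf q'.1 q'.2)
    have hww' : Measurable fun ω => (w q.1 ω q.2, w q'.1 ω q'.2) :=
      (hd.measurable_apply q.1 q.2).prodMk (hd.measurable_apply q'.1 q'.2)
    have hF : Measurable fun p : (ℝ × ℝ) × ℝ × ℝ => qerr Δ p.1.1 p.2.1 * qerr Δ p.1.2 p.2.2 :=
      (Measurable.qerr Δ measurable_fst.fst measurable_snd.fst).mul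
        (Measurable.qerr Δ measurable_fst.snd measurable_snd.snd)
    have h := integral_of_indepFun (hmy.prodMk hmy') hww' (hd.indepFun hyy hww) hF
      ((hd.qerr_memLp hΔ hmy).integrable_mul (hd.qerr_memLp hΔ hmy'))
    have hmap : P.map (fun ω => (w q.1 ω q.2, w q'.1 ω q'.2)) = (triLaw Δ).prod (triLaw Δ) := by
      rw [(indepFun_iff_map_prod_eq_prod_map_map (hd.measurable_apply q.1 q.2).aemeasurable
        (hd.measurable_apply q'.1 q'.2).aemeasurable).mp (hd.iid.indepFun ‹q ≠ q'›), hd.map_eq,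
        hd.map_eq]
    rw [h, hmap]
    have : ∀ a c : ℝ, ∫ u, qerr Δ a u.1 * qerr Δ c u.2 ∂((triLaw Δ).prod (triLaw Δ)) = 0 := by
      intro a c
      rw [integral_prod_mul (fun u => qerr Δ a u) (fun u => qerr Δ c u), (integral_qerr hΔ a).1,
        zero_mul]
    simp only [this, integral_zero]

section

variable (hm : IsSignalModel P x Cx s Γ) (hd : IsDither P x s Δ w) (hΔ : 0 < Δ)
  (hy : ∀ n k, AEStronglyMeasurable[sigmaOf x] (fun ω => y n ω k) P)
  (hz : ∀ n k, (fun ω => z n ω k) =ᵐ[P] fun ω => granular Δ (y n ω k + w n ω k))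

include hm hd hΔ hy hz

theorem noise_memLp (n : ℤ) (k : Fin K) : MemLp (fun ω => z n ω k - y n ω k) 2 P :=
  (hd.qerr_memLp hΔ ((hy n k).stronglyMeasurable_mk.measurable.mono
    (le_sup_left.trans hm.sigma_le) le_rfl)).ae_eq (qerr_ae_eq (hy n k).ae_eq_mk (hz n k)).symm

theorem integral_mul_noise (n : ℤ) (k : Fin K) {ξ : Ω → ℝ}
    (hξ : AEStronglyMeasurable[sigmaOf x ⊔ MeasurableSpace.comap s inferInstance] ξ P)
    (hξ2 : MemLp ξ 2 P) : ∫ ω, ξ ω * (z n ω k - y n ω k) ∂P = 0 := by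
  rw [← hd.integral_mul_qerr hm hΔ n k
    ((hy n k).stronglyMeasurable_mk.measurable.mono le_sup_left le_rfl)
    hξ.stronglyMeasurable_mk.measurable (hξ2.ae_eq hξ.ae_eq_mk)]
  refine integral_congr_ae ?_
  filter_upwards [qerr_ae_eq (hy n k).ae_eq_mk (hz n k), hξ.ae_eq_mk] with ω h1 h2
  rw [h1, h2]

theorem integral_noise_mul_noise (n n' : ℤ) (k k' : Fin K) :
    ∫ ω, (z n ω k - y n ω k) * (z n' ω k' - y n' ω k') ∂P
      = if n = n' ∧ k = k' then Δ ^ 2 / 4 else 0 := by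
  have h := hd.integral_qerr_mul_qerr hm hΔ (n, k) (n', k')
    ((hy n k).stronglyMeasurable_mk.measurable.mono le_sup_left le_rfl)
    ((hy n' k').stronglyMeasurable_mk.measurable.mono le_sup_left le_rfl)
    (by rintro ⟨⟩; rfl)
  simp only [Prod.mk.injEq] at h
  rw [← h]
  refine integral_congr_ae ?_
  filter_upwards [qerr_ae_eq (hy n k).ae_eq_mk (hz n k),
    qerr_ae_eq (hy n' k').ae_eq_mk (hz n' k')] with ω h1 h2
  rw [h1, h2]

end

theorem IsDither.integral_add_sq (hm : IsSignalModel P x Cx s Γ) (hd : IsDither P x s Δ w)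
    (hΔ : 0 < Δ) {n : ℤ} {k : Fin K} {y : Ω → ℝ} (hy2 : MemLp y 2 P)
    (hy : AEStronglyMeasurable[sigmaOf x] y P) :
    ∫ ω, (y ω + w n ω k) ^ 2 ∂P = ∫ ω, y ω ^ 2 ∂P + Δ ^ 2 / 6 := by
  have hw := hd.memLp n k
  have hs := hy.stronglyMeasurable_mk.measurable.mono
    (le_sup_left (b := MeasurableSpace.comap s inferInstance)) le_rfl
  have h0 : ∫ ω, y ω * w n ω k ∂P = 0 := by
    have hi := hd.indepFun hs (IsDither.measurable_sigmaOf n k)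
    have hmean : ∫ ω, w n ω k ∂P = 0 := by
      rw [← (integral_tri_moments hΔ).1, ← hd.map_eq n k]
      exact (integral_map (hd.measurable_apply n k).aemeasurable aestronglyMeasurable_id).symm
    have h := hi.integral_fun_mul_eq_mul_integral
      (hs.mono hm.sigma_le le_rfl).aestronglyMeasurable hw.1
    rw [hmean, mul_zero] at h
    rw [← h]
    refine integral_congr_ae ?_
    filter_upwards [hy.ae_eq_mk] with ω h1
    rw [h1]
  have h2 : ∫ ω, w n ω k ^ 2 ∂P = Δ ^ 2 / 6 := by
    rw [← (integral_tri_moments hΔ).2, ← hd.map_eq n k,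
      integral_map (hd.measurable_apply n k).aemeasurable
        (continuous_pow 2).measurable.aestronglyMeasurable]
  have e : ∀ ω, (y ω + w n ω k) ^ 2 = y ω ^ 2 + 2 * (y ω * w n ω k) + w n ω k ^ 2 := fun ω => by ring
  simp only [e]
  have i1 := hy2.integrable_sq
  have i2 : Integrable (fun ω => 2 * (y ω * w n ω k)) P := (hy2.integrable_mul hw).const_mul 2
  refine (integral_add (i1.add i2) hw.integrable_sq).trans ?_
  rw [h2]
  congr 1
  refine (integral_add i1 i2).trans ?_
  rw [integral_const_mul, h0, mul_zero, add_zero]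

end

/-! ### Folding the frequency axis onto the base band -/

/-- The base band. -/
abbrev base (fs : ℝ) : Measure ℝ := volume.restrict (Set.Icc (-(fs / 2)) (fs / 2))

theorem lintegral_Ioc_fold {fs : ℝ} (hfs : 0 < fs) (a : ℝ) (φ : ℝ → ENNReal) (n : ℕ) :
    ∫⁻ g in Set.Ioc a (a + n * fs), φ g
      = ∑ k ∈ Finset.range n, ∫⁻ f, φ (f + (a + fs / 2 + k * fs)) ∂(base fs) := by
  induction n with
  | zero => simp
  | succ n ih =>
    have hu : Set.Ioc a (a + (n + 1 : ℕ) * fs)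
        = Set.Ioc a (a + n * fs) ∪ Set.Ioc (a + n * fs) (a + (n + 1 : ℕ) * fs) := by
      rw [Set.Ioc_union_Ioc_eq_Ioc] <;> push_cast <;> nlinarith [mul_nonneg n.cast_nonneg hfs.le]
    rw [hu, lintegral_union measurableSet_Ioc (Set.Ioc_disjoint_Ioc_of_le le_rfl), ih,
      Finset.sum_range_succ]
    congr 1
    rw [base, Measure.restrict_congr_set Ioc_ae_eq_Icc.symm, ← lintegral_indicator measurableSet_Ioc,
      ← lintegral_indicator measurableSet_Ioc, ← lintegral_add_right_eq_self _ (a + fs / 2 + n * fs)]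
    refine lintegral_congr fun f => ?_
    have : f + (a + fs / 2 + n * fs) ∈ Set.Ioc (a + n * fs) (a + (n + 1 : ℕ) * fs)
        ↔ f ∈ Set.Ioc (-(fs / 2)) (fs / 2) := by
      simp only [Set.mem_Ioc]
      push_cast
      constructor <;> rintro ⟨h1, h2⟩ <;> constructor <;> linarith
    by_cases hf : f ∈ Set.Ioc (-(fs / 2)) (fs / 2)
    · rw [Set.indicator_of_mem (this.mpr hf), Set.indicator_of_mem hf]
    · rw [Set.indicator_of_notMem (fun h => hf (this.mp h)), Set.indicator_of_notMem hf]

/-- The `k`-th alias of the base-band frequency `f`. -/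
def shiftBand (Υ : ℕ) (fs f : ℝ) (k : ℕ) : ℝ := f - ((k : ℝ) - (Υ : ℝ)) * fs

/-- The band has length `(2 * Υ + 1) * fs` and is tiled, up to null sets, by that many translates of
the base band. -/
theorem lintegral_fold {fs : ℝ} (hfs : 0 < fs) (Υ : ℕ) {φ : ℝ → ENNReal}
    (hφ : ∀ f : ℝ, ((Υ : ℝ) + 1 / 2) * fs < |f| → φ f = 0) :
    ∫⁻ g, φ g = ∑ k ∈ Finset.range (2 * Υ + 1), ∫⁻ f, φ (shiftBand Υ fs f k) ∂(base fs) := by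
  have h1 : ∫⁻ g, φ g = ∫⁻ g in Set.Icc (-(((Υ : ℝ) + 1 / 2) * fs)) (((Υ : ℝ) + 1 / 2) * fs), φ g := by
    rw [← lintegral_indicator measurableSet_Icc]
    refine lintegral_congr fun g => ?_
    by_cases h : g ∈ Set.Icc (-(((Υ : ℝ) + 1 / 2) * fs)) (((Υ : ℝ) + 1 / 2) * fs)
    · rw [Set.indicator_of_mem h]
    · rw [Set.indicator_of_notMem h]
      refine hφ g ?_
      by_contra h'
      exact h (abs_le.mp (not_lt.mp h'))
  have h2 := lintegral_Ioc_fold hfs (-(((Υ : ℝ) + 1 / 2) * fs)) φ (2 * Υ + 1)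
  rw [show -(((Υ : ℝ) + 1 / 2) * fs) + ((2 * Υ + 1 : ℕ) : ℝ) * fs = ((Υ : ℝ) + 1 / 2) * fs by
    push_cast; ring] at h2
  -- The sum is reversed because `shiftBand` moves downwards in frequency as its index grows.
  rw [h1, Measure.restrict_congr_set Ioc_ae_eq_Icc.symm, h2, ← Finset.sum_range_reflect]
  refine Finset.sum_congr rfl fun k hk => lintegral_congr fun f => ?_
  have hk' : k ≤ 2 * Υ := by have := Finset.mem_range.mp hk; omega
  rw [shiftBand, show 2 * Υ + 1 - 1 - k = 2 * Υ - k by omega]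
  push_cast [Nat.cast_sub hk']
  congr 1
  ring

/-- Stacking of the aliases of a matrix-valued function of frequency. -/
def stack {p M : ℕ} (Υ : ℕ) (fs : ℝ) (B : ℝ → Matrix (Fin p) (Fin M) ℂ) (f : ℝ) :
    Matrix (Fin p) (Fin ((2 * Υ + 1) * M)) ℂ :=
  Matrix.of fun i j => B (shiftBand Υ fs f (finProdFinEquiv.symm j).1) i (finProdFinEquiv.symm j).2

section

variable {p q M : ℕ} {Υ : ℕ} {fs : ℝ}

theorem stacked_eq (Cx : ℝ → Matrix (Fin M) (Fin M) ℂ) (A : ℝ → Matrix (Fin p) (Fin M) ℂ) (f : ℝ) :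
    stacked Υ fs Cx A f = stack Υ fs (fun g => A g * CFC.sqrt (Cx g)) f := rfl

theorem sum_stack {E : Type*} [AddCommMonoid E] (F : Fin (2 * Υ + 1) → Fin M → E) :
    ∑ j : Fin ((2 * Υ + 1) * M), F (finProdFinEquiv.symm j).1 (finProdFinEquiv.symm j).2
      = ∑ k, ∑ m, F k m := by
  rw [← Fintype.sum_prod_type' F]
  exact Equiv.sum_comp finProdFinEquiv.symm fun x : Fin (2 * Υ + 1) × Fin M => F x.1 x.2

theorem frob_stack (B : ℝ → Matrix (Fin p) (Fin M) ℂ) (f : ℝ) :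
    frob (stack Υ fs B f) = ∑ k ∈ Finset.range (2 * Υ + 1), frob (B (shiftBand Υ fs f k)) := by
  rw [Finset.sum_range, frob]
  simp only [frob]
  conv_rhs => rw [Finset.sum_comm]
  refine Finset.sum_congr rfl fun i _ => ?_
  exact sum_stack fun k m => ‖B (shiftBand Υ fs f k) i m‖ ^ 2

theorem stack_mul_conjTranspose (B : ℝ → Matrix (Fin p) (Fin M) ℂ)
    (B' : ℝ → Matrix (Fin q) (Fin M) ℂ) (f : ℝ) :
    stack Υ fs B f * (stack Υ fs B' f).conjTranspose
      = ∑ k ∈ Finset.range (2 * Υ + 1), B (shiftBand Υ fs f k)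
        * (B' (shiftBand Υ fs f k)).conjTranspose := by
  rw [Finset.sum_range]
  ext i j
  rw [Matrix.mul_apply, Matrix.sum_apply]
  simp only [Matrix.mul_apply, Matrix.conjTranspose_apply]
  exact sum_stack fun k m => B (shiftBand Υ fs f k) i m * star (B' (shiftBand Υ fs f k) j m)

/-- A filter taking the same value at all aliases of `f` factors out of the stack; this is how a
digital filter acts on the aliased signal. -/
theorem stack_mul_left {G : ℝ → Matrix (Fin q) (Fin p) ℂ} {B : ℝ → Matrix (Fin p) (Fin M) ℂ} {f : ℝ}
    (hG : ∀ k : ℕ, k < 2 * Υ + 1 → G (shiftBand Υ fs f k) = G f) :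
    stack Υ fs (fun g => G g * B g) f = G f * stack Υ fs B f := by
  ext i j
  simp only [stack, Matrix.of_apply, Matrix.mul_apply]
  rw [hG _ (finProdFinEquiv.symm j).1.2]

theorem stack_sub (B B' : ℝ → Matrix (Fin p) (Fin M) ℂ) (f : ℝ) :
    stack Υ fs (fun g => B g - B' g) f = stack Υ fs B f - stack Υ fs B' f := rfl

theorem shiftBand_eq (f : ℝ) (k : ℕ) :
    shiftBand Υ fs f k = f + (((Υ : ℤ) - (k : ℤ) : ℤ) : ℝ) * fs := by
  rw [shiftBand]; push_cast; ring

theorem shiftBand_neg (f : ℝ) {k : ℕ} (hk : k < 2 * Υ + 1) :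
    shiftBand Υ fs (-f) k = -shiftBand Υ fs f (2 * Υ - k) := by
  rw [shiftBand, shiftBand, Nat.cast_sub (by omega)]; push_cast; ring

theorem chr_periodic (hfs : 0 < fs) (f : ℝ) (m n : ℤ) :
    chr (f + m * fs) (n / fs) = chr f (n / fs) := by
  rw [chr, chr, Complex.exp_eq_exp_iff_exists_int]
  refine ⟨-(m * n), ?_⟩
  have : (fs : ℂ) ≠ 0 := Complex.ofReal_ne_zero.mpr hfs.ne'
  push_cast
  field_simp
  ring

theorem EntryMeas.stack {B : ℝ → Matrix (Fin p) (Fin M) ℂ} (hB : EntryMeas B) :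
    EntryMeas (stack Υ fs B) := fun i j => by
  have : Measurable fun f => shiftBand Υ fs f (finProdFinEquiv.symm j).1 := by
    unfold shiftBand; fun_prop
  exact (hB i _).comp this

theorem eLpNorm_stack (hfs : 0 < fs) {B : ℝ → Matrix (Fin p) (Fin M) ℂ} (hB : EntryMeas B)
    (hband : ∀ f : ℝ, ((Υ : ℝ) + 1 / 2) * fs < |f| → B f = 0) :
    eLpNorm (fun f => fvec (stack Υ fs B f)) 2 (base fs) = eLpNorm (fun f => fvec (B f)) 2 volume := by
  have hm : ∀ k, Measurable fun f => frob (B (shiftBand Υ fs f k)) := by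
    intro k
    have : Measurable fun f => shiftBand Υ fs f k := by unfold shiftBand; fun_prop
    unfold frob
    exact Finset.measurable_sum _ fun i _ => Finset.measurable_sum _ fun j _ =>
      ((hB i j).comp this).norm.pow_const 2
  have h : eLpNorm (fun f => fvec (stack Υ fs B f)) 2 (base fs) ^ 2
      = eLpNorm (fun f => fvec (B f)) 2 volume ^ 2 := by
    rw [eLpNorm_two_sq, eLpNorm_two_sq]
    simp only [norm_fvec_sq]
    rw [lintegral_fold hfs Υ (φ := fun f => ENNReal.ofReal (frob (B f)))
      (fun f hf => by simp [hband f hf, frob]), ← lintegral_finsetSum _ fun k _ =>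
      (hm k).ennreal_ofReal]
    refine lintegral_congr fun f => ?_
    rw [frob_stack, ENNReal.ofReal_sum_of_nonneg fun _ _ => frob_nonneg _]
  exact (ENNReal.pow_right_strictMono two_ne_zero).injective h

theorem memLp_stack (hfs : 0 < fs) {B : ℝ → Matrix (Fin p) (Fin M) ℂ} (hB : EntryMeas B)
    (hband : ∀ f : ℝ, ((Υ : ℝ) + 1 / 2) * fs < |f| → B f = 0) :
    MemLp (fun f => fvec (stack Υ fs B f)) 2 (base fs) ↔ MemLp (fun f => fvec (B f)) 2 volume := by
  rw [MemLp, MemLp, eLpNorm_stack hfs hB hband]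
  refine and_congr_left fun _ => ⟨fun _ => ?_, fun _ => ?_⟩
  · exact aesm_fvec fun i j => (hB i j).aestronglyMeasurable
  · exact aesm_fvec fun i j => (hB.stack i j).aestronglyMeasurable

theorem integral_stack (hfs : 0 < fs) {B : ℝ → Matrix (Fin p) (Fin M) ℂ} (hB : EntryMeas B)
    (hband : ∀ f : ℝ, ((Υ : ℝ) + 1 / 2) * fs < |f| → B f = 0)
    (h2 : MemLp (fun f => fvec (B f)) 2 volume) :
    ∫ f, frob (stack Υ fs B f) ∂(base fs) = ∫ f, frob (B f) := by
  have h1 := (memLp_stack hfs hB hband).mpr h2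
  have e1 := norm_toLp_sq h1
  have e2 := norm_toLp_sq h2
  simp only [norm_fvec_sq] at e1 e2
  rw [← e1, ← e2, Lp.norm_toLp, Lp.norm_toLp, eLpNorm_stack hfs hB hband]

theorem ae_shiftBand {pr : ℝ → Prop} (h : ∀ᵐ f : ℝ, pr f) :
    ∀ᵐ f : ℝ, ∀ k : ℕ, pr (shiftBand Υ fs f k) := by
  rw [ae_all_iff]
  intro k
  exact (measurePreserving_sub_right volume (((k : ℝ) - (Υ : ℝ)) * fs)).quasiMeasurePreserving.ae h

end

/-- A power spectral density of a real process is conjugate symmetric. -/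
theorem IsWSS.psd_conj {Ω : Type*} [MeasurableSpace Ω] {P : Measure Ω} {M : ℕ} {x : Proc ℝ Ω M}
    {Cx : ℝ → Matrix (Fin M) (Fin M) ℂ} (hx : IsWSS P x Cx) {R : ℝ} (hR : 0 < R)
    (hband : ∀ f : ℝ, R < |f| → Cx f = 0) :
    ∀ᵐ f : ℝ, ∀ i j, Cx (-f) i j = star (Cx f i j) := by
  have key : ∀ i j, ∀ᵐ f ∂(volume.restrict (Set.Icc (-R) R)), Cx (-f) i j = star (Cx f i j) := by
    intro i j
    -- Multiplication by `i` turns real correlations into coefficients with zero real part. The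
    -- delays are negated to match the positive exponent in the correlation formula.
    have h := ae_antisymm_of_fourier_re (t := fun τ : ℝ => -τ) (φ := fun f => Complex.I * Cx f i j) hR
      (fun n => ⟨-(n / (2 * R)), by ring⟩) ((hx.psd_integrable i j).const_mul _).integrableOn
      fun τ => by
        have h1 : ∫ f in Set.Icc (-R) R, chr f (-τ) * (Complex.I * Cx f i j)
            = ∫ f, chr f (-τ) * (Complex.I * Cx f i j) := by
          refine setIntegral_eq_integral_of_forall_compl_eq_zero fun f hf => ?_
          rw [hband f (by by_contra h'; exact hf (abs_le.mp (not_lt.mp h')))]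
          simp
        have h2 : ∫ f, chr f (-τ) * (Complex.I * Cx f i j)
            = Complex.I * ∫ f : ℝ, Complex.exp (2 * Real.pi * Complex.I * f * τ) * Cx f i j := by
          rw [← integral_const_mul]
          congr 1
          ext f
          rw [chr]
          push_cast
          rw [mul_neg, neg_neg]
          ring
        rw [h1, h2, ← hx.correlation 0 τ i j]
        simp
    filter_upwards [h] with f hf
    simp only [star_mul', Complex.star_def, Complex.conj_I] at hf ⊢
    have : Complex.I * (Cx (-f) i j - (starRingEnd ℂ) (Cx f i j)) = 0 := by rw [mul_sub, hf]; ring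
    exact sub_eq_zero.mp ((mul_eq_zero.mp this).resolve_left Complex.I_ne_zero)
  have key' := ae_all_iff.mpr fun i => ae_all_iff.mpr fun j => key i j
  rw [ae_restrict_iff' measurableSet_Icc] at key'
  filter_upwards [key'] with f hf
  by_cases h : f ∈ Set.Icc (-R) R
  · exact hf h
  · have h' : R < |f| := by by_contra h'; exact h (abs_le.mp (not_lt.mp h'))
    intro i j
    rw [hband f h', hband (-f) (by rwa [abs_neg])]
    simp

/-! ### Mean-squared error of finite impulse response recovery -/

section

variable {Ω : Type*} [MeasurableSpace Ω] {P : Measure Ω}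

theorem integral_norm_add_sq_of_orthogonal {r : ℕ} {U V : Ω → Fin r → ℝ}
    (hU : ∀ i, MemLp (fun ω => U ω i) 2 P) (hV : ∀ i, MemLp (fun ω => V ω i) 2 P)
    (h : ∀ i, ∫ ω, U ω i * V ω i ∂P = 0) :
    ∫ ω, ‖evec (U ω + V ω)‖ ^ 2 ∂P = ∫ ω, ‖evec (U ω)‖ ^ 2 ∂P + ∫ ω, ‖evec (V ω)‖ ^ 2 ∂P := by
  simp only [norm_evec_sq, Pi.add_apply]
  have hUV : ∀ i, Integrable (fun ω => (U ω i + V ω i) ^ 2) P := fun i =>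
    ((hU i).add (hV i)).integrable_sq
  rw [integral_finsetSum _ fun i _ => hUV i,
    integral_finsetSum _ fun i _ => (hU i).integrable_sq,
    integral_finsetSum _ fun i _ => (hV i).integrable_sq, ← Finset.sum_add_distrib]
  refine Finset.sum_congr rfl fun i _ => ?_
  have e : ∀ ω, (U ω i + V ω i) ^ 2 = U ω i ^ 2 + 2 * (U ω i * V ω i) + V ω i ^ 2 := fun ω => by ring
  simp only [e]
  have i2 : Integrable (fun ω => 2 * (U ω i * V ω i)) P := ((hU i).integrable_mul (hV i)).const_mul 2
  refine (integral_add ((hU i).integrable_sq.add i2) (hV i).integrable_sq).trans ?_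
  congr 1
  refine (integral_add (hU i).integrable_sq i2).trans ?_
  rw [integral_const_mul, h i, mul_zero, add_zero]

theorem mse_eq {r : ℕ} {U V : Ω → Fin r → ℝ} (hU : ∀ i, MemLp (fun ω => U ω i) 2 P)
    (hV : ∀ i, MemLp (fun ω => V ω i) 2 P) :
    mse P U V = ∫ ω, ‖evec (U ω - V ω)‖ ^ 2 ∂P := by
  simp only [norm_evec_sq, Pi.sub_apply]
  have hUV : ∀ i, Integrable (fun ω => (U ω i - V ω i) ^ 2) P := fun i =>
    ((hU i).sub (hV i)).integrable_sq
  rw [mse, integral_finsetSum _ fun i _ => hUV i]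

end

/-- The tapped delay line with delays in multiples of the sampling period. -/
abbrev dtft {r p : ℕ} (fs : ℝ) (c : ℤ →₀ Matrix (Fin r) (Fin p) ℝ) (f : ℝ) :
    Matrix (Fin r) (Fin p) ℂ := tapFreq (fun n : ℤ => (n : ℝ) / fs) c f

theorem dtft_shiftBand {r p : ℕ} {fs : ℝ} (hfs : 0 < fs) (c : ℤ →₀ Matrix (Fin r) (Fin p) ℝ)
    (Υ : ℕ) (f : ℝ) (k : ℕ) : dtft fs c (shiftBand Υ fs f k) = dtft fs c f := by
  simp only [dtft, tapFreq, shiftBand_eq, chr_periodic hfs]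

theorem integral_chr_base {fs : ℝ} (hfs : 0 < fs) (n : ℤ) :
    ∫ f, chr f (n / fs) ∂(base fs) = if n = 0 then (fs : ℂ) else 0 := by
  rw [base, integral_Icc_eq_integral_Ioc, ← intervalIntegral.integral_of_le (by linarith)]
  have hfs' : (fs : ℂ) ≠ 0 := Complex.ofReal_ne_zero.mpr hfs.ne'
  split_ifs with h
  · subst h
    simp [chr]
  · have hn : (n : ℂ) ≠ 0 := Int.cast_ne_zero.mpr h
    have hc : -(2 * Real.pi * Complex.I * (n / fs) : ℂ) ≠ 0 := by
      simp [hn, hfs', Real.pi_ne_zero]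
    have e : ∀ f : ℝ, chr f (n / fs) = Complex.exp (-(2 * Real.pi * Complex.I * (n / fs)) * f) := by
      intro f
      rw [chr]
      congr 1
      push_cast
      ring
    simp only [e]
    rw [integral_exp_mul_complex hc, div_eq_zero_iff]
    left
    rw [sub_eq_zero, Complex.exp_eq_exp_iff_exists_int]
    refine ⟨-n, ?_⟩
    push_cast
    field_simp
    ring

/-- White noise of variance `v` has the flat spectral density `v / fs` on the base band, since the
characters with integer multiples of the sampling period are orthogonal there. -/
theorem fir_noise_isometry {Ω : Type*} [MeasurableSpace Ω] {P : Measure Ω} {K r : ℕ} {fs v : ℝ}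
    (hfs : 0 < fs) (hv : 0 ≤ v) {e : ℤ → Ω → Fin K → ℝ} (he : ∀ n k, MemLp (fun ω => e n ω k) 2 P)
    (hcov : ∀ n n' k k', ∫ ω, e n ω k * e n' ω k' ∂P = if n = n' ∧ k = k' then v else 0)
    (c : ℤ →₀ Matrix (Fin r) (Fin K) ℝ) :
    ∫ ω, ‖evec (firOut e c ω)‖ ^ 2 ∂P = v / fs * ∫ f, frob (dtft fs c f) ∂(base fs) := by
  have hsq : (√(v / fs) : ℂ) * (√(v / fs) : ℂ) = ((v / fs : ℝ) : ℂ) := by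
    rw [← Complex.ofReal_mul, Real.mul_self_sqrt (by positivity)]
  have h := fir_isometry (P := P) (z := e) (t := fun n : ℤ => (n : ℝ) / fs) (μ := base fs)
    (B := fun _ => (√(v / fs) : ℂ) • (1 : Matrix (Fin K) (Fin K) ℂ)) (memLp_const _) he
    (fun n n' m l => by
      rw [hcov]
      have e1 : ∀ f, chr f ((n : ℝ) / fs - (n' : ℝ) / fs) = chr f ((n - n' : ℤ) / fs) := fun f => by
        congr 1; push_cast; ring
      simp only [e1, Matrix.conjTranspose_smul, Matrix.conjTranspose_one, Matrix.smul_mul,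
        Matrix.one_mul, smul_smul]
      rw [integral_mul_const, integral_chr_base hfs, Complex.star_def, Complex.conj_ofReal, hsq,
        Matrix.smul_apply, Matrix.one_apply]
      have hfs' : (fs : ℂ) ≠ 0 := Complex.ofReal_ne_zero.mpr hfs.ne'
      by_cases h1 : n = n' <;> by_cases h2 : m = l <;> simp [h1, h2, sub_eq_zero]
      field_simp) c
  rw [h, ← integral_const_mul]
  congr 1
  ext f
  rw [Matrix.mul_smul, Matrix.mul_one, norm_fvec_sq]
  simp only [frob, Matrix.smul_apply, norm_smul, mul_pow, Finset.mul_sum, Complex.norm_real,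
    Real.norm_eq_abs, sq_abs, Real.sq_sqrt (show 0 ≤ v / fs by positivity)]

theorem entryMeas_dtft {r p : ℕ} (fs : ℝ) (c : ℤ →₀ Matrix (Fin r) (Fin p) ℝ) :
    EntryMeas fun f => ((1 / fs : ℝ) : ℂ) • dtft fs c f := fun i j =>
  (continuous_tapFreq _ c i j).measurable.const_mul _

theorem firOut_noise {Ω : Type*} {K : ℕ} (y z : Proc ℤ Ω K) {r : ℕ}
    (c : ℤ →₀ Matrix (Fin r) (Fin K) ℝ) (ω : Ω) :
    firOut (fun n ω => z (-n) ω - y (-n) ω) c ω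
      = firOut (fun n => z (-n)) c ω - firOut (fun n => y (-n)) c ω := by
  ext i
  simp only [firOut_apply, Pi.sub_apply, mul_sub, Finset.sum_sub_distrib]

section

variable {Ω : Type*} [mΩ : MeasurableSpace Ω] {P : Measure Ω} {M N K : ℕ}
  {x : Proc ℝ Ω M} {Cx : ℝ → Matrix (Fin M) (Fin M) ℂ} {s : Ω → Fin N → ℝ}
  {Γ : ℝ → Matrix (Fin N) (Fin M) ℂ} {fs η γ : ℝ} {b Υ : ℕ} {H : ℝ → Matrix (Fin K) (Fin M) ℂ}
  {y w z : Proc ℤ Ω K}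

theorem IsAcquisition.memLp_sample (h : IsAcquisition P x Cx s fs b η H y γ w z) (n : ℤ)
    (k : Fin K) : MemLp (fun ω => y n ω k) 2 P := by
  obtain ⟨Y, hY, hy⟩ := h.samples
  simp only [hy]
  exact ((hY n).1 k).const_mul _

theorem IsAcquisition.aesm_sample (hm : IsSignalModel P x Cx s Γ)
    (h : IsAcquisition P x Cx s fs b η H y γ w z) (n : ℤ) (k : Fin K) :
    AEStronglyMeasurable[sigmaOf x] (fun ω => y n ω k) P := by
  obtain ⟨Y, hY, hy⟩ := h.samples
  simp only [hy]
  exact ((hY n).aesm hm.wss k).const_mul _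

theorem IsAcquisition.stepSize_pos (h : IsAcquisition P x Cx s fs b η H y γ w z) :
    0 < stepSize γ b := by
  have := h.range_pos
  rw [stepSize]
  positivity

theorem IsAcquisition.memLp_out [IsProbabilityMeasure P] (hm : IsSignalModel P x Cx s Γ)
    (h : IsAcquisition P x Cx s fs b η H y γ w z) (n : ℤ) (k : Fin K) :
    MemLp (fun ω => z n ω k) 2 P := by
  have := (noise_memLp hm h.dither h.stepSize_pos (h.aesm_sample hm) h.quantized n k).add
    (h.memLp_sample n k)
  refine this.ae_eq (Eventually.of_forall fun ω => ?_)
  simp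

/-- The variance of the quantization noise. -/
theorem stepSize_sq (γ : ℝ) (b : ℕ) : stepSize γ b ^ 2 / 4 = γ ^ 2 / 2 ^ (2 * b) := by
  rw [stepSize, div_pow, ← pow_mul, mul_comm b 2]
  ring

/-- Sampling followed by an FIR filter is one analog filter evaluated at time `0`: the sample with
index `-n` acquires the phase `chr f (n / fs)`, and the phases sum to the digital response. -/
theorem IsAcquisition.isFilterOutput_fir (hm : IsSignalModel P x Cx s Γ)
    (h : IsAcquisition P x Cx s fs b η H y γ w z) {r : ℕ} (c : ℤ →₀ Matrix (Fin r) (Fin K) ℝ) :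
    IsFilterOutput P x Cx (fun f => ((1 / fs : ℝ) : ℂ) • dtft fs c f * H f) 0
      (firOut (fun n => y (-n)) c) := by
  obtain ⟨Y, hY, hy⟩ := h.samples
  have h1 : ∀ n : ℤ, IsFilterOutput P x Cx (fun f => ((1 / fs) • c n).map (fun a : ℝ => (a : ℂ))
      * (chr f (n / fs) • H f)) 0 (fun ω => ((1 / fs) • c n).mulVec (Y (-n) ω)) := by
    intro n
    have h2 := ((hY (-n)).shift hm.wss).mulVec hm.wss ((1 / fs) • c n)
    have e : -(((-n : ℤ) : ℝ) * (1 / fs)) = n / fs := by push_cast; ring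
    rw [e] at h2
    exact h2
  have h3 := IsFilterOutput.sum hm.wss c.support (fun n => EntryMeas.mul (EntryMeas.const _)
    (EntryMeas.smul (continuous_chr _).measurable h.freqResponse.measurable)) h1
  convert h3 using 1
  · ext f : 1
    rw [dtft, tapFreq, Finsupp.sum, Finset.smul_sum, Matrix.sum_mul]
    refine Finset.sum_congr rfl fun n _ => ?_
    rw [Matrix.mul_smul, Matrix.smul_mul, Matrix.smul_mul, smul_comm]
    congr 1
    rw [← Matrix.smul_mul]
    congr 1
    ext i j
    simp
  · ext ω : 1
    rw [firOut, Finsupp.sum]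
    refine Finset.sum_congr rfl fun n _ => ?_
    rw [Matrix.smul_mulVec, ← Matrix.mulVec_smul]
    congr 1
    ext k
    simp [hy]

section

variable [IsProbabilityMeasure P] (hm : IsSignalModel P x Cx s Γ) (h : IsAcquisition P x Cx s fs b η H y γ w z)

include hm h

omit [IsProbabilityMeasure P] in
theorem IsAcquisition.isFilterOutput_error {r : ℕ} {F : ℝ → Matrix (Fin r) (Fin M) ℂ}
    (hFm : EntryMeas F) {U : Ω → Fin r → ℝ} (hU : IsFilterOutput P x Cx F 0 U)
    (c : ℤ →₀ Matrix (Fin r) (Fin K) ℝ) :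
    IsFilterOutput P x Cx (fun f => F f - ((1 / fs : ℝ) : ℂ) • dtft fs c f * H f) 0
      (fun ω => U ω - firOut (fun n => y (-n)) c ω) := by
  have h1 := h.isFilterOutput_fir hm (-c)
  have h2 := hU.add hm.wss hFm (EntryMeas.mul (entryMeas_dtft fs (-c))
      h.freqResponse.measurable) h1
  convert h2 using 1
  · ext f : 1
    have : dtft fs (-c) f = -dtft fs c f := by
      rw [dtft, ← zero_sub, tapFreq_sub, dtft]
      simp [tapFreq]
    rw [this, smul_neg, Matrix.neg_mul, sub_eq_add_neg]
  · ext ω : 1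
    rw [firOut_neg, sub_eq_add_neg]

theorem IsAcquisition.integral_mul_fir_noise {r : ℕ} (c : ℤ →₀ Matrix (Fin r) (Fin K) ℝ) (i : Fin r)
    {ξ : Ω → ℝ} (hξ : AEStronglyMeasurable[sigmaOf x ⊔ MeasurableSpace.comap s inferInstance] ξ P)
    (hξ2 : MemLp ξ 2 P) : ∫ ω, ξ ω * firOut (fun n ω => z (-n) ω - y (-n) ω) c ω i ∂P = 0 := by
  simp only [firOut_apply, Finset.mul_sum, Pi.sub_apply]
  have hn := noise_memLp hm h.dither h.stepSize_pos (h.aesm_sample hm) h.quantized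
  have e : ∀ (a : ℤ × Fin K) ω, ξ ω * (c a.1 i a.2 * (z (-a.1) ω a.2 - y (-a.1) ω a.2))
      = c a.1 i a.2 * (ξ ω * (z (-a.1) ω a.2 - y (-a.1) ω a.2)) := fun a ω => by ring
  simp only [e]
  rw [integral_finsetSum _ fun a _ => (hξ2.integrable_mul (hn (-a.1) a.2)).const_mul _]
  refine Finset.sum_eq_zero fun a _ => ?_
  rw [integral_const_mul, integral_mul_noise hm h.dither h.stepSize_pos (h.aesm_sample hm)
    h.quantized _ _ hξ hξ2, mul_zero]

theorem IsAcquisition.memLp_fir_noise {r : ℕ} (c : ℤ →₀ Matrix (Fin r) (Fin K) ℝ) (i : Fin r) :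
    MemLp (fun ω => firOut (fun n ω => z (-n) ω - y (-n) ω) c ω i) 2 P :=
  memLp_firOut (z := fun (n : ℤ) ω => z (-n) ω - y (-n) ω) (fun n k =>
    noise_memLp hm h.dither h.stepSize_pos (h.aesm_sample hm) h.quantized (-n) k) c i

/-- Mean-squared error of a finite impulse response digital filter in the frequency domain. -/
theorem IsAcquisition.integral_fir_error (hfs : 0 < fs)
    (hband : ∀ f : ℝ, ((Υ : ℝ) + 1 / 2) * fs < |f| → Cx f = 0) {r : ℕ}
    {F : ℝ → Matrix (Fin r) (Fin M) ℂ} (hFm' : EntryMeas F) {U : Ω → Fin r → ℝ}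
    (hU : IsFilterOutput P x Cx F 0 U) (c : ℤ →₀ Matrix (Fin r) (Fin K) ℝ) :
    ∫ ω, ‖evec (U ω - firOut (fun n => z (-n)) c ω)‖ ^ 2 ∂P
      = ∫ f, frob (stacked Υ fs Cx F f - ((1 / fs : ℝ) : ℂ) • dtft fs c f * stacked Υ fs Cx H f)
          ∂(base fs)
        + γ ^ 2 / 2 ^ (2 * b) * fs * ∫ f, frob (((1 / fs : ℝ) : ℂ) • dtft fs c f) ∂(base fs) := by
  have hF := h.isFilterOutput_error hm hFm' hU c
  have hFm : EntryMeas fun f => F f - ((1 / fs : ℝ) : ℂ) • dtft fs c f * H f :=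
    EntryMeas.sub hFm' (EntryMeas.mul (entryMeas_dtft fs c) h.freqResponse.measurable)
  have h1 : ∫ ω, ‖evec (U ω - firOut (fun n => y (-n)) c ω)‖ ^ 2 ∂P
      = ∫ f, frob (stacked Υ fs Cx F f
        - ((1 / fs : ℝ) : ℂ) • dtft fs c f * stacked Υ fs Cx H f) ∂(base fs) := by
    rw [hF.isometry hm.wss hFm]
    simp only [norm_fvec_sq]
    rw [← integral_stack hfs (hFm.mul hm.wss.entryMeas_sqrt)
      (fun f hf => by rw [hband f hf, CFC.sqrt_zero, Matrix.mul_zero])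
      (hF.memLp_weighted hm.wss hFm)]
    refine integral_congr_ae (Eventually.of_forall fun f => ?_)
    simp only [Matrix.sub_mul, Matrix.mul_assoc, stacked_eq]
    rw [stack_sub, stack_mul_left (G := fun f => ((1 / fs : ℝ) : ℂ) • dtft fs c f)]
    intro k _
    rw [dtft_shiftBand hfs]
  have hn := noise_memLp hm h.dither h.stepSize_pos (h.aesm_sample hm) h.quantized
  have h2 := fir_noise_isometry hfs (v := stepSize γ b ^ 2 / 4) (by positivity)
    (e := fun n ω => z (-n) ω - y (-n) ω) (P := P) (fun n k => hn (-n) k)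
    (fun n n' k k' => by
      have := integral_noise_mul_noise hm h.dither h.stepSize_pos (h.aesm_sample hm) h.quantized
        (-n) (-n') k k'
      simpa only [neg_inj, Pi.sub_apply] using this) c
  -- The error made with the noiseless samples is a function of `x`, hence orthogonal to the
  -- filtered quantization noise.
  have h3 := integral_norm_add_sq_of_orthogonal (P := P)
    (U := fun ω => U ω - firOut (fun n => y (-n)) c ω)
    (V := fun ω => -firOut (fun n ω => z (-n) ω - y (-n) ω) c ω) hF.1
    (fun i => (h.memLp_fir_noise hm c i).neg) (fun i => by
      have h4 := h.integral_mul_fir_noise hm c i ((hF.aesm hm.wss i).mono le_sup_left) (hF.1 i)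
      simp only [Pi.neg_apply, mul_neg]
      rw [integral_neg, h4, neg_zero])
  have e : ∀ ω, U ω - firOut (fun n => y (-n)) c ω
      + -firOut (fun n ω => z (-n) ω - y (-n) ω) c ω
      = U ω - firOut (fun n => z (-n)) c ω := fun ω => by
    rw [firOut_noise]; abel
  simp only [e, WithLp.toLp_neg, norm_neg] at h3
  rw [h3, h1, h2, stepSize_sq]
  congr 1
  -- Normalising the digital response by `1 / fs` turns the noise density `v / fs` into the weight
  -- `v * fs`.
  have e2 : ∀ f, frob (((1 / fs : ℝ) : ℂ) • dtft fs c f) = (1 / fs) ^ 2 * frob (dtft fs c f) := by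
    intro f
    simp only [frob, Matrix.smul_apply, norm_smul, mul_pow, Finset.mul_sum, Complex.norm_real,
      Real.norm_eq_abs, sq_abs]
  simp only [e2]
  rw [integral_const_mul]
  field_simp

theorem IsAcquisition.memLp_fir {r : ℕ} (c : ℤ →₀ Matrix (Fin r) (Fin K) ℝ) (i : Fin r) :
    MemLp (fun ω => firOut (fun n => z (-n)) c ω i) 2 P :=
  memLp_firOut (z := fun n : ℤ => z (-n)) (fun n k => h.memLp_out hm (-n) k) c i

/-- The estimation error of the analog MMSE estimate is orthogonal to the digital error. -/
theorem IsAcquisition.integral_task_fir_error (c : ℤ →₀ Matrix (Fin N) (Fin K) ℝ) :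
    ∫ ω, ‖evec (s ω - firOut (fun n => z (-n)) c ω)‖ ^ 2 ∂P
      = ∫ ω, ‖evec (s ω - mmseEst P x s ω)‖ ^ 2 ∂P
        + ∫ ω, ‖evec (mmseEst P x s ω - firOut (fun n => z (-n)) c ω)‖ ^ 2 ∂P := by
  have hF := h.isFilterOutput_error hm hm.freqResponse.measurable hm.linear_mmse c
  have hle : sigmaOf x ≤ mΩ := le_sup_left.trans hm.sigma_le
  have hs2 : ∀ i, MemLp (fun ω => s ω i - mmseEst P x s ω i) 2 P := fun i =>
    (hm.task_memLp i).sub (hm.linear_mmse.1 i)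
  have hsm : ∀ i, AEStronglyMeasurable[sigmaOf x ⊔ MeasurableSpace.comap s inferInstance]
      (fun ω => s ω i - mmseEst P x s ω i) P := fun i => by
    have h1 : Measurable[sigmaOf x ⊔ MeasurableSpace.comap s inferInstance] s :=
      measurable_iff_comap_le.mpr le_sup_right
    have h2 : Measurable[sigmaOf x ⊔ MeasurableSpace.comap s inferInstance] fun ω => s ω i :=
      (measurable_pi_apply i).comp h1
    exact h2.stronglyMeasurable.aestronglyMeasurable.sub
      ((hm.linear_mmse.aesm hm.wss i).mono le_sup_left)
  have horth : ∀ i, ∫ ω, (s ω i - mmseEst P x s ω i)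
      * (mmseEst P x s ω i - firOut (fun n => y (-n)) c ω i) ∂P = 0 := by
    intro i
    have hg := hF.aesm hm.wss i
    have hg2 := hF.1 i
    have hi : Integrable (fun ω => s ω i * (mmseEst P x s ω i - firOut (fun n => y (-n)) c ω i)) P :=
      (hm.task_memLp i).integrable_mul hg2
    have hi' : Integrable (fun ω => mmseEst P x s ω i
        * (mmseEst P x s ω i - firOut (fun n => y (-n)) c ω i)) P :=
      (hm.linear_mmse.1 i).integrable_mul hg2
    -- The error formed with the unquantized samples is determined by `x`, so it can be pulled out
    -- of the conditional expectation of `s`.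
    have hc := condExp_mul_of_aestronglyMeasurable_right (m := sigmaOf x) (μ := P)
      (f := fun ω => s ω i) hg hi ((hm.task_memLp i).integrable one_le_two)
    have h1 := integral_condExp hle (μ := P)
      (f := (fun ω => s ω i) * (fun ω => mmseEst P x s ω i - firOut (fun n => y (-n)) c ω i))
    simp only [sub_mul]
    rw [integral_sub hi hi', sub_eq_zero]
    refine Eq.trans h1.symm ?_
    exact integral_congr_ae hc
  have h3 := integral_norm_add_sq_of_orthogonal (P := P)
    (U := fun ω => s ω - mmseEst P x s ω)
    (V := fun ω => mmseEst P x s ω - firOut (fun n => z (-n)) c ω) hs2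
    (fun i => (hm.linear_mmse.1 i).sub (h.memLp_fir hm c i)) (fun i => by
      have h4 := h.integral_mul_fir_noise hm c i (hsm i) (hs2 i)
      have e : ∀ ω, (s ω i - mmseEst P x s ω i) * (mmseEst P x s ω i - firOut (fun n => z (-n)) c ω i)
          = (s ω i - mmseEst P x s ω i) * (mmseEst P x s ω i - firOut (fun n => y (-n)) c ω i)
            - (s ω i - mmseEst P x s ω i) * firOut (fun n ω => z (-n) ω - y (-n) ω) c ω i := by
        intro ω
        rw [firOut_noise, Pi.sub_apply]
        ring
      simp only [Pi.sub_apply, e]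
      refine (integral_sub ((hs2 i).integrable_mul (hF.1 i))
        ((hs2 i).integrable_mul (h.memLp_fir_noise hm c i))).trans ?_
      exact (congrArg₂ (· - ·) (horth i) h4).trans (sub_zero 0))
  simpa only [sub_add_sub_cancel] using h3

end

end

/-! ### Square-summable digital filters as limits -/

theorem sum_support_eq_firOut {Ω : Type*} {K r : ℕ} {z : Proc ℤ Ω K}
    (c : ℤ →₀ Matrix (Fin r) (Fin K) ℝ) (ω : Ω) (i : Fin r) :
    ∑ n ∈ c.support, (c n).mulVec (z (-n) ω) i = firOut (fun n => z (-n)) c ω i := by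
  rw [firOut, Finsupp.sum, Finset.sum_apply]

section

variable {Ω : Type*} [mΩ : MeasurableSpace Ω] {P : Measure Ω} {M N K : ℕ}
  {x : Proc ℝ Ω M} {Cx : ℝ → Matrix (Fin M) (Fin M) ℂ} {s : Ω → Fin N → ℝ}
  {Γ : ℝ → Matrix (Fin N) (Fin M) ℂ} {fs η γ : ℝ} {b Υ : ℕ} {H : ℝ → Matrix (Fin K) (Fin M) ℂ}
  {y w z : Proc ℤ Ω K}

theorem tendsto_mse (hz : ∀ n k, MemLp (fun ω => z n ω k) 2 P) {r u : Ω → Fin N → ℝ}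
    (hr : ∀ i, MemLp (fun ω => r ω i) 2 P) (hu : ∀ i, MemLp (fun ω => u ω i) 2 P)
    {c : ℕ → (ℤ →₀ Matrix (Fin N) (Fin K) ℝ)}
    (hc : ∀ i, Tendsto (fun j => eLpNorm (fun ω => r ω i - firOut (fun n => z (-n)) (c j) ω i) 2 P)
      atTop (𝓝 0)) :
    Tendsto (fun j => ∫ ω, ‖evec (u ω - firOut (fun n => z (-n)) (c j) ω)‖ ^ 2 ∂P) atTop
        (𝓝 (mse P u r)) := by
  have hf : ∀ j i, MemLp (fun ω => firOut (fun n => z (-n)) (c j) ω i) 2 P := fun j =>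
    memLp_firOut (z := fun n : ℤ => z (-n)) (fun n k => hz (-n) k) (c j)
  rw [mse_eq hu hr]
  refine tendsto_integral_norm_sq
    (f := fun j ω => evec (u ω - firOut (fun n => z (-n)) (c j) ω)) (g := fun ω => evec (u ω - r ω))
    (fun j => memLp_evec_iff.mpr fun i => (hu i).sub (hf j i))
    (memLp_evec_iff.mpr fun i => (hu i).sub (hr i)) ?_
  have := (tendsto_evec_iff (Y := fun j ω => r ω - firOut (fun n => z (-n)) (c j) ω)
    fun j i => (hr i).1.sub (hf j i).1).mpr hc
  refine this.congr fun j => ?_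
  rw [← eLpNorm_neg]
  refine eLpNorm_congr_ae (Eventually.of_forall fun ω => ?_)
  simp only [Pi.neg_apply, ← WithLp.toLp_neg, ← WithLp.toLp_sub]
  congr 1
  abel

theorem IsDigitalOutput.tendsto_mse (hz : ∀ n k, MemLp (fun ω => z n ω k) 2 P)
    {G : ℤ → Matrix (Fin N) (Fin K) ℝ} {r : Ω → Fin N → ℝ} (h : IsDigitalOutput P z G r) :
    ∃ c : ℕ → (ℤ →₀ Matrix (Fin N) (Fin K) ℝ), ∀ u : Ω → Fin N → ℝ,
      (∀ i, MemLp (fun ω => u ω i) 2 P) → Tendsto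
        (fun j => ∫ ω, ‖evec (u ω - firOut (fun n => z (-n)) (c j) ω)‖ ^ 2 ∂P) atTop
        (𝓝 (mse P u r)) := by
  obtain ⟨-, hr, c, -, hc⟩ := h
  simp only [sum_support_eq_firOut] at hc
  exact ⟨c, fun u hu => TaskADC.tendsto_mse hz hr hu hc⟩

/-- The error with respect to the task splits into the error of the analog MMSE estimate and
the digital error. -/
theorem IsAcquisition.mse_task [IsProbabilityMeasure P] (hm : IsSignalModel P x Cx s Γ)
    (h : IsAcquisition P x Cx s fs b η H y γ w z) {G : ℤ → Matrix (Fin N) (Fin K) ℝ}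
    {r : Ω → Fin N → ℝ} (hr : IsDigitalOutput P z G r) :
    mse P s r = mse P s (mmseEst P x s) + mse P (mmseEst P x s) r := by
  obtain ⟨c, hc⟩ := hr.tendsto_mse (h.memLp_out hm)
  have h1 := hc s hm.task_memLp
  have h2 := hc _ hm.linear_mmse.1
  simp only [h.integral_task_fir_error hm] at h1
  rw [mse_eq hm.task_memLp hm.linear_mmse.1]
  exact tendsto_nhds_unique h1 (h2.const_add _)

theorem IsDigitalOutput.le_mse (hz : ∀ n k, MemLp (fun ω => z n ω k) 2 P)
    {G : ℤ → Matrix (Fin N) (Fin K) ℝ} {r u : Ω → Fin N → ℝ} (h : IsDigitalOutput P z G r)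
    (hu : ∀ i, MemLp (fun ω => u ω i) 2 P) {L : ℝ}
    (hL : ∀ c, L ≤ ∫ ω, ‖evec (u ω - firOut (fun n => z (-n)) c ω)‖ ^ 2 ∂P) : L ≤ mse P u r := by
  obtain ⟨c, hc⟩ := h.tendsto_mse hz
  exact ge_of_tendsto' (hc u hu) fun j => hL _

end

/-- Completeness of `L²`, transported along a family of norm bounds. -/
theorem exists_limit_of_integral_le {α β E F : Type*} [MeasurableSpace α] [MeasurableSpace β]
    [NormedAddCommGroup E] [CompleteSpace E] [NormedAddCommGroup F] {μ : Measure α} {ν : Measure β}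
    {u : ℕ → α → E} {v : ℕ → β → F} {g : β → F} {C : ℝ} (hu : ∀ j, MemLp (u j) 2 μ)
    (hv : ∀ j, MemLp (v j) 2 ν) (hg : MemLp g 2 ν)
    (hlim : Tendsto (fun j => eLpNorm (fun b => g b - v j b) 2 ν) atTop (𝓝 0))
    (hle : ∀ j l, ∫ a, ‖u j a - u l a‖ ^ 2 ∂μ ≤ C ^ 2 * ∫ b, ‖v j b - v l b‖ ^ 2 ∂ν) :
    ∃ U : α → E, MemLp U 2 μ ∧ Tendsto (fun j => eLpNorm (fun a => U a - u j a) 2 μ) atTop (𝓝 0) := by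
  have h1 : Tendsto (fun j => (hv j).toLp (v j)) atTop (𝓝 (hg.toLp g)) := by
    rw [Lp.tendsto_Lp_iff_tendsto_eLpNorm'']
    refine hlim.congr fun j => ?_
    rw [eLpNorm_sub_comm]
    rfl
  have hd : ∀ j l, dist ((hu j).toLp (u j)) ((hu l).toLp (u l))
      ≤ |C| * dist ((hv j).toLp (v j)) ((hv l).toLp (v l)) := by
    intro j l
    rw [dist_eq_norm, dist_eq_norm, ← MemLp.toLp_sub, ← MemLp.toLp_sub]
    refine le_of_sq_le_sq ?_ (by positivity)
    rw [mul_pow, sq_abs, norm_toLp_sq, norm_toLp_sq]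
    exact hle j l
  have hc : CauchySeq fun j => (hu j).toLp (u j) := by
    have h2 := h1.cauchySeq
    rw [Metric.cauchySeq_iff] at h2 ⊢
    intro ε hε
    obtain ⟨n, hn⟩ := h2 (ε / (|C| + 1)) (by positivity)
    refine ⟨n, fun j hj l hl => (hd j l).trans_lt ?_⟩
    have h3 := hn j hj l hl
    rw [lt_div_iff₀ (by positivity)] at h3
    nlinarith [dist_nonneg (x := (hv j).toLp (v j)) (y := (hv l).toLp (v l))]
  obtain ⟨U, hU⟩ := cauchySeq_tendsto_of_complete hc
  refine ⟨U, Lp.memLp U, ?_⟩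
  rw [Lp.tendsto_Lp_iff_tendsto_eLpNorm'] at hU
  refine hU.congr fun j => ?_
  rw [eLpNorm_sub_comm]
  refine eLpNorm_congr_ae ?_
  filter_upwards [(hu j).coeFn_toLp] with a ha
  simp [ha]

/-! ### Taps as a square-summable family -/

/-- The unit impulses. -/
def impulse (K : ℕ) (n : ℤ) (p : ℤ × Fin K) (k : Fin K) : ℝ := if p = (n, k) then 1 else 0

theorem memLp_impulse {K : ℕ} (n : ℤ) (k : Fin K) :
    MemLp (fun p => impulse K n p k) 2 Measure.count := by
  have h := memLp_indicator_const (μ := (Measure.count : Measure (ℤ × Fin K))) 2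
    (measurableSet_singleton (n, k)) (1 : ℝ) (Or.inr (by simp))
  refine h.ae_eq (Eventually.of_forall fun p => ?_)
  simp [impulse, Set.indicator_apply]

/-- The impulses act as white noise of unit variance over the counting measure, and filtering them
returns the taps. Convergence of impulse responses in `ℓ²` is thereby a case of
`fir_noise_isometry`. -/
theorem firOut_impulse {K r : ℕ} (c : ℤ →₀ Matrix (Fin r) (Fin K) ℝ) (p : ℤ × Fin K) (i : Fin r) :
    firOut (impulse K) c p i = c p.1 i p.2 := by
  simp only [firOut, Finsupp.sum, Finset.sum_apply, Matrix.mulVec, dotProduct, impulse]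
  rw [Finset.sum_eq_single p.1]
  · rw [Finset.sum_eq_single p.2] <;> simp
    intro k hk h
    exact absurd (congrArg Prod.snd h).symm hk
  · intro n _ hn
    refine Finset.sum_eq_zero fun k _ => ?_
    rw [if_neg, mul_zero]
    intro h
    exact hn (congrArg Prod.fst h).symm
  · intro hn
    simp [Finsupp.notMem_support_iff.mp hn]

theorem integral_impulse {K : ℕ} (n n' : ℤ) (k k' : Fin K) :
    ∫ p, impulse K n p k * impulse K n' p k' ∂Measure.count
      = if n = n' ∧ k = k' then 1 else 0 := by
  have e : ∀ p, impulse K n p k * impulse K n' p k'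
      = Set.indicator {(n, k)} (fun _ => if n = n' ∧ k = k' then (1 : ℝ) else 0) p := by
    intro p
    by_cases hp : p = (n, k)
    · subst hp
      simp [impulse]
    · simp [impulse, hp]
  simp only [e]
  rw [integral_indicator_const _ (measurableSet_singleton _)]
  simp [Measure.real]

/-! ### Existence of square-summable digital filters with a given frequency response -/

/-- Horizontal concatenation. -/
def hcat {r q q' : ℕ} (A : Matrix (Fin r) (Fin q) ℂ) (B : Matrix (Fin r) (Fin q') ℂ) :
    Matrix (Fin r) (Fin (q + q')) ℂ := Matrix.of fun i => Fin.append (A i) (B i)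

section

variable {r p q q' : ℕ}

theorem hcat_sub (A A' : Matrix (Fin r) (Fin q) ℂ) (B B' : Matrix (Fin r) (Fin q') ℂ) :
    hcat A B - hcat A' B' = hcat (A - A') (B - B') := by
  ext i j
  refine Fin.addCases (fun k => ?_) (fun k => ?_) j <;> simp [hcat]

theorem mul_hcat (D : Matrix (Fin p) (Fin r) ℂ) (A : Matrix (Fin r) (Fin q) ℂ)
    (B : Matrix (Fin r) (Fin q') ℂ) : D * hcat A B = hcat (D * A) (D * B) := by
  ext i j
  refine Fin.addCases (fun k => ?_) (fun k => ?_) j <;> simp [hcat, Matrix.mul_apply]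

/-- Concatenation turns a signal cost plus a noise cost into one norm: with `B = [H, √c 1]`, the
squared norm of `D B` is that of `D H` plus `c` times that of `D`. -/
theorem frob_hcat (A : Matrix (Fin r) (Fin q) ℂ) (B : Matrix (Fin r) (Fin q') ℂ) :
    frob (hcat A B) = frob A + frob B := by
  simp [frob, hcat, Fin.sum_univ_add, Finset.sum_add_distrib]

theorem memLp_hcat {α : Type*} [MeasurableSpace α] {μ : Measure α}
    {A : α → Matrix (Fin r) (Fin q) ℂ} {B : α → Matrix (Fin r) (Fin q') ℂ}
    (hA : MemLp (fun a => fvec (A a)) 2 μ) (hB : MemLp (fun a => fvec (B a)) 2 μ) :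
    MemLp (fun a => fvec (hcat (A a) (B a))) 2 μ := by
  rw [memLp_fvec_iff] at *
  intro i j
  refine Fin.addCases (fun k => ?_) (fun k => ?_) j
  · simpa [hcat] using hA i k
  · simpa [hcat] using hB i k

theorem frob_smul (a : ℝ) (A : Matrix (Fin r) (Fin q) ℂ) : frob ((a : ℂ) • A) = a ^ 2 * frob A := by
  simp only [frob, Matrix.smul_apply, norm_smul, mul_pow, Finset.mul_sum, Complex.norm_real,
    Real.norm_eq_abs, sq_abs]

end

theorem summable_of_memLp_count {K r : ℕ} {g : ℤ × Fin K → EuclideanSpace ℝ (Fin r)}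
    (hg : MemLp g 2 Measure.count) (i : Fin r) (k : Fin K) :
    Summable (fun n => g (n, k) i ^ 2) ∧ ∑' n, g (n, k) i ^ 2 ≤ ∫ p, ‖g p‖ ^ 2 ∂Measure.count := by
  have h1 : Integrable (fun p => ‖g p‖ ^ 2) Measure.count := hg.norm.integrable_sq
  have h2 : Summable fun p => ‖g p‖ ^ 2 := by
    have := integrable_count_iff.mp h1
    simpa using this
  have hinj : Function.Injective fun n : ℤ => (n, k) := fun a c h => congrArg Prod.fst h
  have hle : ∀ n, g (n, k) i ^ 2 ≤ ‖g (n, k)‖ ^ 2 := fun n => by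
    have := PiLp.norm_apply_le (g (n, k)) i
    rw [← sq_abs, ← Real.norm_eq_abs]
    exact pow_le_pow_left₀ (norm_nonneg _) this 2
  have h3 : Summable fun n => ‖g (n, k)‖ ^ 2 := h2.comp_injective hinj
  have h4 : Summable fun n => g (n, k) i ^ 2 := h3.of_nonneg_of_le (fun _ => sq_nonneg _) hle
  refine ⟨h4, ?_⟩
  rw [integral_countable h1]
  refine (h4.tsum_le_tsum hle h3).trans ?_
  simp only [Measure.real, Measure.count_singleton, ENNReal.toReal_one, one_smul]
  exact tsum_comp_le_tsum_of_inj h2 (fun _ => sq_nonneg _) hinj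

theorem tendsto_integral_norm_sq_zero {α E : Type*} [MeasurableSpace α] [NormedAddCommGroup E]
    {μ : Measure α} {f : ℕ → α → E} (hf : ∀ j, MemLp (f j) 2 μ)
    (h : Tendsto (fun j => eLpNorm (f j) 2 μ) atTop (𝓝 0)) :
    Tendsto (fun j => ∫ a, ‖f j a‖ ^ 2 ∂μ) atTop (𝓝 0) := by
  have := tendsto_integral_norm_sq (g := fun _ => (0 : E)) hf MemLp.zero
    (h.congr fun j => by simp only [zero_sub]; exact (eLpNorm_neg (f j) 2 μ).symm)
  simpa using this

section

variable {Ω : Type*} [mΩ : MeasurableSpace Ω] {P : Measure Ω} [IsProbabilityMeasure P] {M N K : ℕ}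
  {x : Proc ℝ Ω M} {Cx : ℝ → Matrix (Fin M) (Fin M) ℂ} {s : Ω → Fin N → ℝ}
  {Γ : ℝ → Matrix (Fin N) (Fin M) ℂ} {fs η γ : ℝ} {b Υ : ℕ} {H : ℝ → Matrix (Fin K) (Fin M) ℂ}
  {y w z : Proc ℤ Ω K}

omit [IsProbabilityMeasure P] in
theorem memLp_stacked (hfs : 0 < fs) (hm : IsSignalModel P x Cx s Γ)
    (hband : ∀ f : ℝ, ((Υ : ℝ) + 1 / 2) * fs < |f| → Cx f = 0) {r : ℕ} {t : ℝ}
    {F : ℝ → Matrix (Fin r) (Fin M) ℂ} (hF : EntryMeas F) {U : Ω → Fin r → ℝ}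
    (hU : IsFilterOutput P x Cx F t U) :
    MemLp (fun f => fvec (stacked Υ fs Cx F f)) 2 (base fs) :=
  (memLp_stack hfs (hF.mul hm.wss.entryMeas_sqrt)
    (fun f hf => by rw [hband f hf, CFC.sqrt_zero, Matrix.mul_zero])).mpr
    (hU.memLp_weighted hm.wss hF)

/-- FIR responses approximate `fs • G` in the norm weighted by `B = [H̄, √c' 1]`. This single norm
governs both the digital outputs in `L²(P)` and, through the identity block, the taps in `ℓ²`. Both
sequences are therefore Cauchy, and their limits are the output and the impulse response; the
frequency-domain error formula passes to the limit. -/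
theorem IsAcquisition.exists_digitalOutput (hm : IsSignalModel P x Cx s Γ) (hfs : 0 < fs)
    (hband : ∀ f : ℝ, ((Υ : ℝ) + 1 / 2) * fs < |f| → Cx f = 0)
    (h : IsAcquisition P x Cx s fs b η H y γ w z) {G : ℝ → Matrix (Fin N) (Fin K) ℂ}
    (hG : MemLp (fun f => fvec (G f)) 2 (base fs))
    (hGH : MemLp (fun f => fvec (G f * stacked Υ fs Cx H f)) 2 (base fs))
    (hsym : ∀ᵐ f ∂(base fs), ∀ i k, G (-f) i k = star (G f i k)) :
    ∃ (D : ℤ → Matrix (Fin N) (Fin K) ℝ) (r : Ω → Fin N → ℝ), IsDigitalOutput P z D r ∧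
      mse P (mmseEst P x s) r
        = ∫ f, (frob (stacked Υ fs Cx Γ f - G f * stacked Υ fs Cx H f)
          + γ ^ 2 / 2 ^ (2 * b) * fs * frob (G f)) ∂(base fs) := by
  set c' : ℝ := γ ^ 2 / 2 ^ (2 * b) * fs with hc'
  have hγ := h.range_pos
  have hc0 : 0 < c' := by positivity
  obtain ⟨Y, hY, -⟩ := h.samples
  have hHs := memLp_stacked hfs hm hband h.freqResponse.measurable (hY 0)
  have hΓs := memLp_stacked hfs hm hband hm.freqResponse.measurable hm.linear_mmse
  set B : ℝ → Matrix (Fin K) (Fin ((2 * Υ + 1) * M + K)) ℂ := fun f =>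
    hcat (stacked Υ fs Cx H f) ((√c' : ℂ) • (1 : Matrix (Fin K) (Fin K) ℂ)) with hBdef
  have hB : MemLp (fun f => fvec (B f)) 2 (base fs) := memLp_hcat hHs (memLp_const _)
  have hmulB : ∀ (r : ℕ) (D : Matrix (Fin r) (Fin K) ℂ) f,
      D * B f = hcat (D * stacked Υ fs Cx H f) ((√c' : ℂ) • D) := by
    intro r D f
    rw [hBdef, mul_hcat, Matrix.mul_smul, Matrix.mul_one]
  have hGs : MemLp (fun f => fvec ((√c' : ℂ) • G f)) 2 (base fs) := by
    rw [memLp_fvec_iff] at hG ⊢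
    exact fun i j => (hG i j).const_mul _
  have hGB : MemLp (fun f => fvec (G f * B f)) 2 (base fs) := by
    simp only [hmulB]
    exact memLp_hcat hGH hGs
  have hfs0 : (fs : ℂ) ≠ 0 := Complex.ofReal_ne_zero.mpr hfs.ne'
  set h' : ℝ → Matrix (Fin N) (Fin K) ℂ := fun f => (fs : ℂ) • G f with hh'
  have hh'B : MemLp (fun f => fvec (h' f * B f)) 2 (base fs) := by
    rw [memLp_fvec_iff] at hGB ⊢
    intro i j
    simp only [hh', Matrix.smul_mul, Matrix.smul_apply]
    exact (hGB i j).const_mul _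
  have happ : ∀ j : ℕ, ∃ c : ℤ →₀ Matrix (Fin N) (Fin K) ℝ,
      eLpNorm (fun f => fvec ((h' f - dtft fs c f) * B f)) 2 (base fs) < ((j : ENNReal) + 1)⁻¹ := by
    intro j
    refine exists_tapFreq_approx (by positivity : 0 < fs / 2) (fun n => ⟨n, ?_⟩) hB hh'B ?_ (by simp)
    · congr 1; ring
    · filter_upwards [hsym] with f hf i k
      simp [hh', hf i k]
  choose c hc using happ
  have hv : ∀ j, MemLp (fun f => fvec (dtft fs (c j) f * B f)) 2 (base fs) := fun j =>
    memLp_tapFreq_mul _ hB (c j)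
  have hlim : Tendsto (fun j => eLpNorm (fun f => fvec (h' f * B f) - fvec (dtft fs (c j) f * B f)) 2
      (base fs)) atTop (𝓝 0) := by
    have h1 : Tendsto (fun j : ℕ => ((j : ENNReal) + 1)⁻¹) atTop (𝓝 0) := by
      have := (tendsto_add_atTop_iff_nat 1).mpr ENNReal.tendsto_inv_nat_nhds_zero
      simpa using this
    refine tendsto_of_tendsto_of_tendsto_of_le_of_le tendsto_const_nhds h1 (fun _ => zero_le)
      fun j => ?_
    have := (hc j).le
    simpa only [Matrix.sub_mul, fvec_sub] using this
  have hfv : ∀ j l f, ‖fvec (dtft fs (c j) f * B f) - fvec (dtft fs (c l) f * B f)‖ ^ 2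
      = frob (dtft fs (c j - c l) f * stacked Υ fs Cx H f) + c' * frob (dtft fs (c j - c l) f) := by
    intro j l f
    rw [← fvec_sub, norm_fvec_sq, ← Matrix.sub_mul, dtft, dtft, ← tapFreq_sub, hmulB, frob_hcat,
      frob_smul, Real.sq_sqrt hc0.le]
  have hint1 : ∀ d : ℤ →₀ Matrix (Fin N) (Fin K) ℝ,
      Integrable (fun f => frob (dtft fs d f * stacked Υ fs Cx H f)) (base fs) := by
    intro d
    have := (memLp_tapFreq_mul (fun n : ℤ => (n : ℝ) / fs) hHs d).norm.integrable_sq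
    simpa only [norm_fvec_sq] using this
  have hint2 : ∀ d : ℤ →₀ Matrix (Fin N) (Fin K) ℝ,
      Integrable (fun f => frob (dtft fs d f)) (base fs) := by
    intro d
    have := (memLp_tapFreq_mul (μ := base fs) (fun n : ℤ => (n : ℝ) / fs)
      (B := fun _ => (1 : Matrix (Fin K) (Fin K) ℂ)) (memLp_const _) d).norm.integrable_sq
    simpa only [norm_fvec_sq, Matrix.mul_one] using this
  -- the recovered signal
  obtain ⟨U, hU, hUlim⟩ := exists_limit_of_integral_le (C := 1 / fs)
    (u := fun j ω => evec (firOut (fun n => z (-n)) (c j) ω)) (μ := P)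
    (fun j => memLp_evec_iff.mpr (h.memLp_fir hm (c j))) hv hh'B hlim (fun j l => by
      -- With zero target the error formula is the power of the digital output, equal to `1 / fs ^
      -- 2` times the weighted norm squared.
      have h1 := h.integral_fir_error hm hfs hband (r := N) (F := fun _ => 0)
        (fun _ _ => measurable_const) (IsFilterOutput.zero hm.wss 0) (c j - c l)
      have e1 : ∀ ω, ‖evec (0 - firOut (fun n => z (-n)) (c j - c l) ω)‖
          = ‖evec (firOut (fun n => z (-n)) (c j) ω) - evec (firOut (fun n => z (-n)) (c l) ω)‖ := by
        intro ω
        rw [firOut_sub, zero_sub, neg_sub]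
        exact norm_sub_rev (evec (firOut (fun n => z (-n)) (c l) ω)) _
      have e2 : ∀ f, stacked Υ fs Cx (fun _ => (0 : Matrix (Fin N) (Fin M) ℂ)) f = 0 := by
        intro f
        ext i j
        simp [stacked]
      simp only [e1] at h1
      simp only [e2, zero_sub, Matrix.smul_mul, ← smul_neg, frob_smul] at h1
      have e3 : ∀ A : Matrix (Fin N) (Fin ((2 * Υ + 1) * M)) ℂ, frob (-A) = frob A := fun A => by
        simp [frob]
      simp only [e3, integral_const_mul] at h1
      rw [h1]
      simp only [hfv]
      rw [integral_add (hint1 _) ((hint2 _).const_mul _), integral_const_mul]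
      apply le_of_eq
      ring)
  -- the impulse response
  obtain ⟨V, hV, hVlim⟩ := exists_limit_of_integral_le (C := √(1 / (fs * c')))
    (u := fun j p => evec (firOut (impulse K) (c j) p)) (μ := Measure.count)
    (fun j => memLp_evec_iff.mpr (memLp_firOut (fun n k => memLp_impulse n k) (c j))) hv hh'B hlim
    (fun j l => by
      -- The `ℓ²` norm squared of the taps is `1 / fs` times the plain spectral energy, of which the
      -- weighted norm squared contains `c'` times; hence the constant `1 / (fs * c')`.
      have h1 := fir_noise_isometry hfs zero_le_one (fun n k => memLp_impulse n k)
        integral_impulse (c j - c l)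
      simp only [firOut_sub, WithLp.toLp_sub] at h1
      rw [h1, Real.sq_sqrt (by positivity)]
      simp only [hfv]
      rw [integral_add (hint1 _) ((hint2 _).const_mul _), integral_const_mul]
      have h2 : 0 ≤ ∫ f, frob (dtft fs (c j - c l) f * stacked Υ fs Cx H f) ∂(base fs) :=
        integral_nonneg fun f => frob_nonneg _
      have h3 : 1 / (fs * c') * (c' * ∫ f, frob (dtft fs (c j - c l) f) ∂(base fs))
          = 1 / fs * ∫ f, frob (dtft fs (c j - c l) f) ∂(base fs) := by
        field_simp
      rw [mul_add, h3]
      have : 0 ≤ 1 / (fs * c') := by positivity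
      nlinarith [mul_nonneg this h2])
  have hUi : ∀ i, MemLp (fun ω => U ω i) 2 P := fun i => memLp_piLp_iff.mp hU i
  have hUc : ∀ i, Tendsto (fun j => eLpNorm (fun ω => U ω i - firOut (fun n => z (-n)) (c j) ω i) 2 P)
      atTop (𝓝 0) := by
    refine (tendsto_evec_iff (Y := fun j ω i => U ω i - firOut (fun n => z (-n)) (c j) ω i)
      fun j i => (hUi i).1.sub (h.memLp_fir hm (c j) i).1).mp ?_
    exact hUlim
  have hdig : IsDigitalOutput P z (fun n => Matrix.of fun i k => V (n, k) i) (fun ω i => U ω i) := by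
    refine ⟨fun i k => ?_, hUi, c, fun i k => ?_, ?_⟩
    · exact (summable_of_memLp_count hV i k).1
    · have hVj : ∀ j, MemLp (fun p => V p - evec (firOut (impulse K) (c j) p)) 2 Measure.count :=
        fun j => hV.sub (memLp_evec_iff.mpr (memLp_firOut (fun n k => memLp_impulse n k) (c j)))
      have h1 := tendsto_integral_norm_sq_zero hVj hVlim
      refine squeeze_zero (fun j => tsum_nonneg fun n => sq_nonneg _) (fun j => ?_) h1
      have h2 := (summable_of_memLp_count (hVj j) i k).2
      simp only [PiLp.sub_apply, firOut_impulse] at h2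
      exact h2
    · simp only [sum_support_eq_firOut]
      exact hUc
  refine ⟨_, _, hdig, ?_⟩
  have hm1 := tendsto_mse (h.memLp_out hm) hUi hm.linear_mmse.1 hUc
  simp only [h.integral_fir_error hm hfs hband hm.freqResponse.measurable hm.linear_mmse] at hm1
  refine tendsto_nhds_unique hm1 ?_
  -- Padding the target with a zero block matches the noise block of `B`, so that the error and
  -- noise terms converge together as one norm.
  have hz0 : MemLp (fun f => fvec (hcat (stacked Υ fs Cx Γ f) (0 : Matrix (Fin N) (Fin K) ℂ))) 2
      (base fs) := memLp_hcat hΓs (memLp_const _)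
  have hsc : ∀ j, MemLp (fun f => fvec (((1 / fs : ℝ) : ℂ) • dtft fs (c j) f * B f)) 2 (base fs) := by
    intro j
    have := hv j
    rw [memLp_fvec_iff] at this ⊢
    intro i k
    simp only [Matrix.smul_mul, Matrix.smul_apply]
    exact (this i k).const_mul _
  have h2 := tendsto_integral_norm_sq (μ := base fs)
    (f := fun j f => fvec (hcat (stacked Υ fs Cx Γ f) (0 : Matrix (Fin N) (Fin K) ℂ))
      - fvec (((1 / fs : ℝ) : ℂ) • dtft fs (c j) f * B f))
    (g := fun f => fvec (hcat (stacked Υ fs Cx Γ f) (0 : Matrix (Fin N) (Fin K) ℂ))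
      - fvec (G f * B f)) (fun j => hz0.sub (hsc j)) (hz0.sub hGB) (by
      refine eLpNorm_tendsto_zero_of_le (c := 1 / fs) hlim fun j f => ?_
      have e : fvec (hcat (stacked Υ fs Cx Γ f) (0 : Matrix (Fin N) (Fin K) ℂ)) - fvec (G f * B f)
          - (fvec (hcat (stacked Υ fs Cx Γ f) (0 : Matrix (Fin N) (Fin K) ℂ))
          - fvec (((1 / fs : ℝ) : ℂ) • dtft fs (c j) f * B f))
          = -(((1 / fs : ℝ) : ℂ) • (fvec (h' f * B f) - fvec (dtft fs (c j) f * B f))) := by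
        have e1 : fvec (G f * B f) = ((1 / fs : ℝ) : ℂ) • fvec (h' f * B f) := by
          have : G f = ((1 / fs : ℝ) : ℂ) • h' f := by
            rw [hh', smul_smul]
            push_cast
            rw [one_div, inv_mul_cancel₀ hfs0, one_smul]
          rw [this, Matrix.smul_mul]
          rfl
        have e2 : fvec (((1 / fs : ℝ) : ℂ) • dtft fs (c j) f * B f)
            = ((1 / fs : ℝ) : ℂ) • fvec (dtft fs (c j) f * B f) := by
          rw [Matrix.smul_mul]
          rfl
        rw [e1, e2, smul_sub]
        abel
      rw [e, norm_neg, norm_smul, Complex.norm_real, Real.norm_eq_abs,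
        abs_of_pos (by positivity : 0 < 1 / fs)])
  have e : ∀ (D : Matrix (Fin N) (Fin K) ℂ) f,
      ‖fvec (hcat (stacked Υ fs Cx Γ f) (0 : Matrix (Fin N) (Fin K) ℂ)) - fvec (D * B f)‖ ^ 2
        = frob (stacked Υ fs Cx Γ f - D * stacked Υ fs Cx H f) + c' * frob D := by
    intro D f
    rw [← fvec_sub, norm_fvec_sq, hmulB, hcat_sub, frob_hcat, zero_sub, ← neg_smul,
      ← Complex.ofReal_neg,
      frob_smul, neg_sq, Real.sq_sqrt hc0.le]
  simp only [e] at h2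
  refine h2.congr fun j => ?_
  have i1 : Integrable (fun f => frob (stacked Υ fs Cx Γ f
      - ((1 / fs : ℝ) : ℂ) • dtft fs (c j) f * stacked Υ fs Cx H f)) (base fs) := by
    have h3 : MemLp (fun f => fvec (((1 / fs : ℝ) : ℂ) • dtft fs (c j) f * stacked Υ fs Cx H f)) 2
        (base fs) := by
      have := memLp_tapFreq_mul (fun n : ℤ => (n : ℝ) / fs) hHs (c j)
      rw [memLp_fvec_iff] at this ⊢
      intro i k
      simp only [Matrix.smul_mul, Matrix.smul_apply]
      exact (this i k).const_mul _
    have := (hΓs.sub h3).norm.integrable_sq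
    simpa only [Pi.sub_apply, ← fvec_sub, norm_fvec_sq] using this
  have i2 : Integrable (fun f => frob (((1 / fs : ℝ) : ℂ) • dtft fs (c j) f)) (base fs) := by
    simp only [frob_smul]
    exact (hint2 (c j)).const_mul _
  rw [integral_add i1 (i2.const_mul _), integral_const_mul]

end

/-! ### Water-filling -/

/-- The poured volume is continuous in `ζ`, zero for `ζ ≤ 0` and eventually at least `W`, which
gives existence. Divided by `ζ > 0`, the excess `max (ζ σ - 1) 0` is nondecreasing, so two levels
with the same positive volume coincide. -/
theorem existsUnique_waterLevel {α : Type*} [MeasurableSpace α] {μ : Measure α} [IsFiniteMeasure μ]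
    {m : ℕ} {σ : ℕ → α → ℝ} (hσ : ∀ i a, 0 ≤ σ i a) (hi : ∀ i, Integrable (σ i) μ)
    (hpos : ∃ i < m, 0 < ∫ a, σ i a ∂μ) {W : ℝ} (hW : 0 < W) :
    ∃! ζ : ℝ, ∫ a, ∑ i ∈ Finset.range m, max (ζ * σ i a - 1) 0 ∂μ = W := by
  have hint : ∀ ζ i, Integrable (fun a => max (ζ * σ i a - 1) 0) μ := fun ζ i =>
    (((hi i).const_mul ζ).sub (integrable_const 1)).pos_part
  have hsum : ∀ ζ, ∫ a, ∑ i ∈ Finset.range m, max (ζ * σ i a - 1) 0 ∂μ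
      = ∑ i ∈ Finset.range m, ∫ a, max (ζ * σ i a - 1) 0 ∂μ := fun ζ =>
    integral_finsetSum _ fun i _ => hint ζ i
  have hlip : ∀ i, Continuous fun ζ => ∫ a, max (ζ * σ i a - 1) 0 ∂μ := by
    intro i
    refine continuous_iff_continuousAt.mpr fun ζ₀ => ?_
    refine continuousAt_of_dominated (bound := fun a => (|ζ₀| + 1) * σ i a + 1) ?_ ?_ ?_ ?_
    · exact Eventually.of_forall fun ζ => (hint ζ i).1
    · filter_upwards [Metric.ball_mem_nhds ζ₀ one_pos] with ζ hζ
      refine Eventually.of_forall fun a => ?_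
      rw [Real.norm_eq_abs, abs_of_nonneg (le_max_right _ _)]
      have h1 : |ζ| ≤ |ζ₀| + 1 := by
        have h2 := abs_sub_abs_le_abs_sub ζ ζ₀
        rw [Metric.mem_ball, Real.dist_eq] at hζ
        linarith
      have h3 := mul_le_mul_of_nonneg_right ((le_abs_self ζ).trans h1) (hσ i a)
      have h4 : 0 ≤ (|ζ₀| + 1) * σ i a := mul_nonneg (by positivity) (hσ i a)
      exact max_le (by linarith) (by linarith)
    · exact ((hi i).const_mul _).add (integrable_const 1)
    · exact Eventually.of_forall fun a => by fun_prop
  have hcont : Continuous fun ζ => ∫ a, ∑ i ∈ Finset.range m, max (ζ * σ i a - 1) 0 ∂μ := by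
    simp only [hsum]
    exact continuous_finsetSum _ fun i _ => hlip i
  have h0 : ∀ ζ ≤ 0, ∫ a, ∑ i ∈ Finset.range m, max (ζ * σ i a - 1) 0 ∂μ = 0 := by
    intro ζ hζ
    have : ∀ a, ∑ i ∈ Finset.range m, max (ζ * σ i a - 1) 0 = 0 := fun a =>
      Finset.sum_eq_zero fun i _ => max_eq_right (by nlinarith [hσ i a])
    simp [this]
  have hlarge : ∃ ζ, 0 ≤ ζ ∧ W ≤ ∫ a, ∑ i ∈ Finset.range m, max (ζ * σ i a - 1) 0 ∂μ := by
    obtain ⟨i, him, hip⟩ := hpos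
    -- At this level the integral of `ζ * σ i - 1` alone is exactly `W`; taking positive parts and
    -- adding the other terms only increases it.
    refine ⟨(W + μ.real Set.univ) / ∫ a, σ i a ∂μ, by positivity, ?_⟩
    set ζ := (W + μ.real Set.univ) / ∫ a, σ i a ∂μ with hζ
    have h1 : ∫ a, (ζ * σ i a - 1) ∂μ = W := by
      rw [integral_sub ((hi i).const_mul _) (integrable_const _), integral_const_mul, integral_const,
        hζ, div_mul_cancel₀ _ hip.ne']
      simp
    rw [← h1]
    refine integral_mono (((hi i).const_mul ζ).sub (integrable_const 1))
      (integrable_finsetSum _ fun i _ => hint ζ i) fun a => ?_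
    exact (le_max_left _ 0).trans (Finset.single_le_sum
      (f := fun i => max (ζ * σ i a - 1) 0) (fun i _ => le_max_right _ _) (Finset.mem_range.mpr him))
  obtain ⟨ζ₁, hζ₁, hW₁⟩ := hlarge
  obtain ⟨ζ, -, hζ⟩ := intermediate_value_Icc hζ₁ hcont.continuousOn
    ⟨(h0 0 le_rfl).le.trans hW.le, hW₁⟩
  refine ⟨ζ, hζ, ?_⟩
  have hpos' : ∀ ζ, ∫ a, ∑ i ∈ Finset.range m, max (ζ * σ i a - 1) 0 ∂μ = W → 0 < ζ := by
    intro ζ h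
    by_contra h'
    rw [h0 ζ (not_lt.mp h')] at h
    exact hW.ne h
  have hle : ∀ ζ ζ', 0 < ζ → ∫ a, ∑ i ∈ Finset.range m, max (ζ * σ i a - 1) 0 ∂μ = W →
      ∫ a, ∑ i ∈ Finset.range m, max (ζ' * σ i a - 1) 0 ∂μ = W → ζ ≤ ζ' → ζ' ≤ ζ := by
    intro ζ ζ' hp h h' hlt
    have hp' : 0 < ζ' := hp.trans_le hlt
    -- After integration this reads `W ≤ (ζ / ζ') W`, which forces `ζ' ≤ ζ`.
    have h1 : ∫ a, ∑ i ∈ Finset.range m, max (ζ * σ i a - 1) 0 ∂μ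
        ≤ ∫ a, ζ / ζ' * ∑ i ∈ Finset.range m, max (ζ' * σ i a - 1) 0 ∂μ := by
      refine integral_mono (integrable_finsetSum _ fun i _ => hint ζ i)
        ((integrable_finsetSum _ fun i _ => hint ζ' i).const_mul _) fun a => ?_
      simp only [Finset.mul_sum]
      refine Finset.sum_le_sum fun i _ => max_le ?_ (by positivity)
      have h2 : ζ / ζ' ≤ 1 := (div_le_one hp').mpr hlt
      have h3 : ζ / ζ' * (ζ' * σ i a - 1) = ζ * σ i a - ζ / ζ' := by field_simp
      have h4 : ζ / ζ' * (ζ' * σ i a - 1) ≤ ζ / ζ' * max (ζ' * σ i a - 1) 0 :=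
        mul_le_mul_of_nonneg_left (le_max_left _ _) (by positivity)
      linarith
    rw [integral_const_mul, h, h'] at h1
    have h2 : W * 1 ≤ W * (ζ / ζ') := by linarith
    have h3 := le_of_mul_le_mul_left h2 hW
    rwa [le_div_iff₀ hp', one_mul] at h3
  intro ζ' hζ'
  rcases le_total ζ ζ' with h | h
  · exact le_antisymm (hle ζ ζ' (hpos' ζ hζ) hζ hζ' h) h
  · exact le_antisymm h (hle ζ' ζ (hpos' ζ' hζ') hζ' hζ h)

theorem waterEntry_sq (b : ℕ) (ζ σ : ℝ) :
    waterEntry b ζ σ ^ 2 = 1 / 2 ^ (2 * b) * max (ζ * σ - 1) 0 := by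
  rw [waterEntry, mul_pow, Real.sq_sqrt (le_max_right _ _), div_pow, one_pow, ← pow_mul, mul_comm b]

/-- The reduction of the distortion per singular value, split into a Lagrangian and a power term. -/
theorem waterEntry_gain (b : ℕ) {ζ σ : ℝ} (hζ : 0 < ζ) :
    σ ^ 2 * waterEntry b ζ σ ^ 2 / (waterEntry b ζ σ ^ 2 + 1 / 2 ^ (2 * b))
      = max (σ - 1 / ζ) 0 ^ 2 + 1 / ζ ^ 2 * 2 ^ (2 * b) * waterEntry b ζ σ ^ 2 := by
  rw [waterEntry_sq]
  have h2 : (0 : ℝ) < 2 ^ (2 * b) := by positivity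
  rcases le_total (ζ * σ) 1 with h | h
  · have h1 : σ ≤ 1 / ζ := by rw [le_div_iff₀ hζ]; linarith
    rw [max_eq_right (by linarith), max_eq_right (by linarith)]
    simp
  · have h1 : 1 / ζ ≤ σ := by rw [div_le_iff₀ hζ]; linarith
    rw [max_eq_left (by linarith), max_eq_left (by linarith)]
    have hσ : 0 < σ := lt_of_lt_of_le (by positivity) h1
    have : 1 / 2 ^ (2 * b) * (ζ * σ - 1) + 1 / 2 ^ (2 * b) = 1 / 2 ^ (2 * b) * (ζ * σ) := by ring
    rw [this]
    field_simp
    ring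

theorem kappaBar_pos {η : ℝ} {b : ℕ} (hη : 0 < η) (hηb : 2 * η ^ 2 < 3 * 2 ^ (2 * b)) :
    0 < kappaBar η b := by
  have : 2 * η ^ 2 / (3 * 2 ^ (2 * b)) < 1 := (div_lt_one (by positivity)).mpr hηb
  rw [kappaBar]
  have : 0 < 1 - 2 * η ^ 2 / (3 * 2 ^ (2 * b)) := by linarith
  positivity

section

variable {N Mb K b : ℕ} {fs η : ℝ} {Gb : ℝ → Matrix (Fin N) (Fin Mb) ℂ}

theorem intervalIntegral_base (hfs : 0 < fs) (φ : ℝ → ℝ) :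
    ∫ f in (-(fs / 2))..(fs / 2), φ f = ∫ f, φ f ∂(base fs) := by
  rw [intervalIntegral.integral_of_le (by linarith), base, integral_Icc_eq_integral_Ioc]

theorem isWaterLevel_iff (hK : 0 < K) (hfs : 0 < fs) (hη : 0 < η)
    (hηb : 2 * η ^ 2 < 3 * 2 ^ (2 * b)) (ζ : ℝ) :
    IsWaterLevel K fs b η Gb ζ ↔
      ∫ f, ∑ i ∈ Finset.range (min K Mb), max (ζ * singVal (Gb f) i - 1) 0 ∂(base fs)
        = K * 2 ^ (2 * b) * fs / kappaBar η b := by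
  have hκ := kappaBar_pos hη hηb
  rw [IsWaterLevel, intervalIntegral_base hfs]
  simp only [waterEntry_sq, ← Finset.mul_sum]
  rw [integral_const_mul, eq_div_iff hκ.ne']
  have hK' : (0 : ℝ) < K := Nat.cast_pos.mpr hK
  have : kappaBar η b * (1 / fs) / K * (1 / 2 ^ (2 * b)
      * ∫ f, ∑ i ∈ Finset.range (min K Mb), max (ζ * singVal (Gb f) i - 1) 0 ∂(base fs))
      = (∫ f, ∑ i ∈ Finset.range (min K Mb), max (ζ * singVal (Gb f) i - 1) 0 ∂(base fs))
        * kappaBar η b / (K * 2 ^ (2 * b) * fs) := by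
    field_simp
  rw [this, div_eq_one_iff_eq (by positivity)]

theorem IsWaterLevel.pos (hK : 0 < K) (hfs : 0 < fs) (hη : 0 < η)
    (hηb : 2 * η ^ 2 < 3 * 2 ^ (2 * b)) {ζ : ℝ} (h : IsWaterLevel K fs b η Gb ζ) : 0 < ζ := by
  by_contra h'
  have h1 := (isWaterLevel_iff hK hfs hη hηb ζ).mp h
  have h2 : ∀ f, ∑ i ∈ Finset.range (min K Mb), max (ζ * singVal (Gb f) i - 1) 0 = 0 := fun f =>
    Finset.sum_eq_zero fun i _ => max_eq_right (by nlinarith [singVal_nonneg (Gb f) i])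
  simp only [h2, integral_zero] at h1
  have hκ := kappaBar_pos hη hηb
  have hK' : (0 : ℝ) < K := Nat.cast_pos.mpr hK
  have : 0 < K * 2 ^ (2 * b) * fs / kappaBar η b := by positivity
  exact this.ne h1

/-- The integrated power of a water-filling filter. -/
theorem IsWaterLevel.integral_eq (hK : 0 < K) (hfs : 0 < fs) (hη : 0 < η)
    (hηb : 2 * η ^ 2 < 3 * 2 ^ (2 * b)) {ζ : ℝ} (h : IsWaterLevel K fs b η Gb ζ) :
    ∫ f, ∑ i ∈ Finset.range (min K Mb), waterEntry b ζ (singVal (Gb f) i) ^ 2 ∂(base fs)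
      = K * fs / kappaBar η b := by
  have hκ := kappaBar_pos hη hηb
  have hK' : (0 : ℝ) < K := Nat.cast_pos.mpr hK
  rw [IsWaterLevel, intervalIntegral_base hfs] at h
  rw [eq_div_iff hκ.ne']
  field_simp at h
  linarith

/-- A non-integrable integrand would have integral zero by convention, contradicting the
normalisation to one. -/
theorem IsWaterLevel.integrable (hfs : 0 < fs) {ζ : ℝ} (h : IsWaterLevel K fs b η Gb ζ) :
    Integrable (fun f => ∑ i ∈ Finset.range (min K Mb), waterEntry b ζ (singVal (Gb f) i) ^ 2)
      (base fs) := by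
  by_contra h'
  rw [IsWaterLevel, intervalIntegral_base hfs, integral_undef h', mul_zero] at h
  exact zero_ne_one h

theorem measurable_singVal (hm : EntryMeas Gb) (i : ℕ) : Measurable fun f => singVal (Gb f) i :=
  (exists_measurable_left (hm.mul hm.conjTranspose)).1 i

theorem integrable_singVal_sq (hm : EntryMeas Gb) (h2 : MemLp (fun f => fvec (Gb f)) 2 (base fs))
    (i : ℕ) : Integrable (fun f => singVal (Gb f) i ^ 2) (base fs) := by
  have h1 : Integrable (fun f => frob (Gb f)) (base fs) := by
    have := h2.norm.integrable_sq
    simpa only [norm_fvec_sq] using this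
  refine h1.mono' ((measurable_singVal hm i).pow_const 2).aestronglyMeasurable
    (Eventually.of_forall fun f => ?_)
  rw [Real.norm_eq_abs, abs_of_nonneg (sq_nonneg _)]
  rcases lt_or_ge i Mb with hi | hi
  · rw [frob_eq_sum_singVal]
    exact Finset.single_le_sum (f := fun i => singVal (Gb f) i ^ 2) (fun i _ => sq_nonneg _)
      (Finset.mem_range.mpr hi)
  · rw [singVal_of_le _ hi]
    simpa using frob_nonneg _

theorem integrable_singVal (hm : EntryMeas Gb) (h2 : MemLp (fun f => fvec (Gb f)) 2 (base fs))
    (i : ℕ) : Integrable (fun f => singVal (Gb f) i) (base fs) := by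
  have : MemLp (fun f => singVal (Gb f) i) 2 (base fs) :=
    (memLp_two_iff_integrable_sq (measurable_singVal hm i).aestronglyMeasurable).mpr
      (integrable_singVal_sq hm h2 i)
  exact this.integrable one_le_two

theorem integrable_singVal_excess (hm : EntryMeas Gb)
    (h2 : MemLp (fun f => fvec (Gb f)) 2 (base fs)) {τ : ℝ} (hτ : 0 ≤ τ) (i : ℕ) :
    Integrable (fun f => max (singVal (Gb f) i - τ) 0 ^ 2) (base fs) := by
  refine (integrable_singVal_sq hm h2 i).mono' (((((measurable_singVal hm i).sub_const _).max
    measurable_const).pow_const 2).aestronglyMeasurable) (Eventually.of_forall fun f => ?_)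
  rw [Real.norm_eq_abs, abs_of_nonneg (sq_nonneg _)]
  exact pow_le_pow_left₀ (le_max_right _ _) (max_le (by linarith) (singVal_nonneg _ i)) 2

theorem existsUnique_isWaterLevel (hK : 0 < K) (hfs : 0 < fs) (hη : 0 < η)
    (hηb : 2 * η ^ 2 < 3 * 2 ^ (2 * b)) (hm : EntryMeas Gb)
    (h2 : MemLp (fun f => fvec (Gb f)) 2 (base fs)) (hpos : 0 < ∫ f, frob (Gb f) ∂(base fs)) :
    ∃! ζ, IsWaterLevel K fs b η Gb ζ := by
  simp only [isWaterLevel_iff hK hfs hη hηb]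
  have hκ := kappaBar_pos hη hηb
  have hK' : (0 : ℝ) < K := Nat.cast_pos.mpr hK
  refine existsUnique_waterLevel (σ := fun i f => singVal (Gb f) i) (fun i f => singVal_nonneg _ i)
    (integrable_singVal hm h2) ?_ (by positivity)
  have hMb : 0 < Mb := by
    rcases Nat.eq_zero_or_pos Mb with h | h
    · subst h
      simp [frob] at hpos
    · exact h
  -- The largest singular value dominates the others: if its integral vanished, the whole matrix
  -- would vanish almost everywhere.
  refine ⟨0, lt_min hK hMb, ?_⟩
  refine lt_of_le_of_ne (integral_nonneg fun f => singVal_nonneg _ 0) fun h => ?_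
  have h3 := (integral_eq_zero_iff_of_nonneg (fun f => singVal_nonneg _ 0)
    (integrable_singVal hm h2 0)).mp h.symm
  have h4 : (fun f => frob (Gb f)) =ᵐ[base fs] 0 := by
    filter_upwards [h3] with f hf
    rw [frob_eq_sum_singVal]
    refine Finset.sum_eq_zero fun i _ => ?_
    have h5 : singVal (Gb f) i ≤ singVal (Gb f) 0 := singVal_antitone _ (Nat.zero_le i)
    have h6 : singVal (Gb f) 0 = 0 := hf
    have h7 : singVal (Gb f) i = 0 := le_antisymm (h6 ▸ h5) (singVal_nonneg _ i)
    rw [h7]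
    simp
  rw [integral_congr_ae h4] at hpos
  simp at hpos

/-- The closed-form value of the distortion in Lagrangian form. -/
theorem IsWaterLevel.optimalDistortion_eq (hK : 0 < K) (hfs : 0 < fs) (hη : 0 < η)
    (hηb : 2 * η ^ 2 < 3 * 2 ^ (2 * b)) (hm : EntryMeas Gb)
    (h2 : MemLp (fun f => fvec (Gb f)) 2 (base fs)) {ζ : ℝ} (h : IsWaterLevel K fs b η Gb ζ)
    (E : ℝ) :
    optimalDistortion K fs b Gb ζ E
      = E - (∫ f, ∑ i ∈ Finset.range (min K Mb), max (singVal (Gb f) i - 1 / ζ) 0 ^ 2 ∂(base fs))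
        - 1 / ζ ^ 2 * 2 ^ (2 * b) * (K * fs / kappaBar η b) := by
  have hζ := h.pos hK hfs hη hηb
  rw [optimalDistortion, intervalIntegral_base hfs, ← h.integral_eq hK hfs hη hηb]
  simp only [waterEntry_gain b hζ, Finset.sum_add_distrib, ← Finset.mul_sum]
  rw [integral_add _ ((h.integrable hfs).const_mul _), integral_const_mul]
  · ring
  · exact integrable_finsetSum _ fun i _ => integrable_singVal_excess hm h2 (by positivity) i

end

/-! ### Dynamic range and the lower bound -/

/-- The dither power `Δ² / 6` is itself the multiple `2 / (3 * 2 ^ (2 * b))` of `γ²`. Solving the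
resulting linear equation for `γ²` produces `kappaBar`, and the bound on `η` keeps the coefficient
positive. -/
theorem range_sq_iff {K b : ℕ} (hK : 0 < K) {η γ : ℝ}
    (hηb : 2 * η ^ 2 < 3 * 2 ^ (2 * b)) (a : Fin K → ℝ) :
    γ ^ 2 = η ^ 2 * ⨆ k, (a k + stepSize γ b ^ 2 / 6) ↔ γ ^ 2 = kappaBar η b * ⨆ k, a k := by
  have : Nonempty (Fin K) := ⟨⟨0, hK⟩⟩
  have h1 : ⨆ k, (a k + stepSize γ b ^ 2 / 6) = (⨆ k, a k) + stepSize γ b ^ 2 / 6 :=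
    (ciSup_add (Set.finite_range a).bddAbove _).symm
  have h2 : stepSize γ b ^ 2 / 6 = 2 / 3 * (γ ^ 2 / 2 ^ (2 * b)) := by
    rw [← stepSize_sq]; ring
  have h3 : 0 < 1 - 2 * η ^ 2 / (3 * 2 ^ (2 * b)) := by
    have : 2 * η ^ 2 / (3 * 2 ^ (2 * b)) < 1 := (div_lt_one (by positivity)).mpr hηb
    linarith
  rw [h1, h2, kappaBar, mul_right_comm, ← div_eq_mul_inv, eq_div_iff h3.ne']
  have h4 : γ ^ 2 * (1 - 2 * η ^ 2 / (3 * 2 ^ (2 * b)))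
      = γ ^ 2 - η ^ 2 * (2 / 3 * (γ ^ 2 / 2 ^ (2 * b))) := by
    field_simp
  rw [h4]
  constructor <;> intro h <;> linarith

section

variable {Ω : Type*} [mΩ : MeasurableSpace Ω] {P : Measure Ω} {M N K : ℕ}
  {x : Proc ℝ Ω M} {Cx : ℝ → Matrix (Fin M) (Fin M) ℂ} {s : Ω → Fin N → ℝ}
  {Γ : ℝ → Matrix (Fin N) (Fin M) ℂ} {fs η γ : ℝ} {b Υ : ℕ} {H : ℝ → Matrix (Fin K) (Fin M) ℂ}
  {y w z : Proc ℤ Ω K}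

/-- The mean power of a filter output, on the base band. -/
theorem IsFilterOutput.integral_norm_sq (hfs : 0 < fs) (hx : IsWSS P x Cx)
    (hband : ∀ f : ℝ, ((Υ : ℝ) + 1 / 2) * fs < |f| → Cx f = 0) {r : ℕ} {t : ℝ}
    {F : ℝ → Matrix (Fin r) (Fin M) ℂ} (hF : EntryMeas F) {U : Ω → Fin r → ℝ}
    (hU : IsFilterOutput P x Cx F t U) :
    ∫ ω, ‖evec (U ω)‖ ^ 2 ∂P = ∫ f, frob (stacked Υ fs Cx F f) ∂(base fs) := by
  rw [hU.isometry hx hF]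
  simp only [norm_fvec_sq]
  exact (integral_stack hfs (hF.mul hx.entryMeas_sqrt)
    (fun f hf => by rw [hband f hf, CFC.sqrt_zero, Matrix.mul_zero])
    (hU.memLp_weighted hx hF)).symm

/-- The mean power of one channel of a filter output. -/
theorem IsFilterOutput.integral_channel_sq (hfs : 0 < fs) (hx : IsWSS P x Cx)
    (hband : ∀ f : ℝ, ((Υ : ℝ) + 1 / 2) * fs < |f| → Cx f = 0) {r : ℕ} {t : ℝ}
    {F : ℝ → Matrix (Fin r) (Fin M) ℂ} (hF : EntryMeas F) {U : Ω → Fin r → ℝ}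
    (hU : IsFilterOutput P x Cx F t U) (k : Fin r) :
    ∫ ω, U ω k ^ 2 ∂P = ∫ f, ((stacked Υ fs Cx F f * (stacked Υ fs Cx F f).conjTranspose) k k).re
      ∂(base fs) := by
  -- A row selecting channel `k` reduces the claim to the total power of a one-channel filter.
  set C : Matrix (Fin 1) (Fin r) ℝ := Matrix.of fun _ j => if j = k then 1 else 0 with hC
  have h1 := (hU.mulVec hx C).integral_norm_sq hfs hx hband (EntryMeas.mul (EntryMeas.const _) hF)
  have e1 : ∀ ω, ‖evec (C.mulVec (U ω))‖ ^ 2 = U ω k ^ 2 := fun ω => by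
    rw [norm_evec_sq]
    simp [hC, Matrix.mulVec, dotProduct]
  have e2 : ∀ f, frob (stacked Υ fs Cx (fun f => C.map (fun a : ℝ => (a : ℂ)) * F f) f)
      = ((stacked Υ fs Cx F f * (stacked Υ fs Cx F f).conjTranspose) k k).re := fun f => by
    simp only [stacked_eq, Matrix.mul_assoc]
    rw [stack_mul_left (G := fun _ => C.map (fun a : ℝ => (a : ℂ))) fun _ _ => rfl]
    rw [frob, Matrix.mul_apply, Complex.re_sum]
    simp only [Fin.sum_univ_one]
    refine Finset.sum_congr rfl fun j _ => ?_
    rw [Matrix.mul_apply, Finset.sum_eq_single k (fun i _ hi => by simp [hC, hi]) (by simp),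
      Matrix.conjTranspose_apply, Complex.star_def, Complex.mul_conj, Complex.normSq_eq_norm_sq]
    simp [hC]
    rw [← Complex.ofReal_pow, Complex.ofReal_re]
  simp only [e1, e2] at h1
  exact h1

section

variable [IsProbabilityMeasure P] (hm : IsSignalModel P x Cx s Γ) (hfs : 0 < fs)
  (hband : ∀ f : ℝ, ((Υ : ℝ) + 1 / 2) * fs < |f| → Cx f = 0)

include hm hfs hband

omit [IsProbabilityMeasure P] in
theorem IsSignalModel.memLp_stacked :
    MemLp (fun f => fvec (stacked Υ fs Cx Γ f)) 2 (base fs) :=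
  TaskADC.memLp_stacked hfs hm hband hm.freqResponse.measurable hm.linear_mmse

omit [IsProbabilityMeasure P] in
theorem IsSignalModel.mse_zero :
    mse P (mmseEst P x s) 0 = ∫ f, frob (stacked Υ fs Cx Γ f) ∂(base fs) := by
  rw [mse_eq (V := (0 : Ω → Fin N → ℝ)) hm.linear_mmse.1 fun i => MemLp.zero]
  simp only [Pi.zero_apply, sub_zero]
  exact hm.linear_mmse.integral_norm_sq hfs hm.wss hband hm.freqResponse.measurable

omit hfs hband in
theorem IsAcquisition.range_sq (hK : 0 < K) (hηb : 2 * η ^ 2 < 3 * 2 ^ (2 * b))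
    (h : IsAcquisition P x Cx s fs b η H y γ w z) (n : ℤ) :
    γ ^ 2 = kappaBar η b * ⨆ k, ∫ ω, y n ω k ^ 2 ∂P := by
  rw [← range_sq_iff hK hηb, h.range_eq n]
  congr 2
  ext k
  exact h.dither.integral_add_sq hm h.stepSize_pos (h.memLp_sample n k) (h.aesm_sample hm n k)

/-- The range is fixed by the strongest channel, and the total power is at most `K` times that of
the strongest channel. The factor `fs ^ 2` undoes the factor `1 / fs` in the samples. -/
theorem IsAcquisition.power_le (hK : 0 < K) (hη : 0 < η) (hηb : 2 * η ^ 2 < 3 * 2 ^ (2 * b))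
    (h : IsAcquisition P x Cx s fs b η H y γ w z) :
    ∫ f, frob (stacked Υ fs Cx H f) ∂(base fs) ≤ K * γ ^ 2 * fs ^ 2 / kappaBar η b := by
  have hκ := kappaBar_pos hη hηb
  obtain ⟨Y, hY, hy⟩ := h.samples
  have h1 := (hY 0).integral_norm_sq hfs hm.wss hband h.freqResponse.measurable
  rw [← h1]
  simp only [norm_evec_sq]
  rw [integral_finsetSum _ fun k _ => ((hY 0).1 k).integrable_sq]
  have h2 := h.range_sq hm hK hηb 0
  have h3 : ∀ k, ∫ ω, y 0 ω k ^ 2 ∂P ≤ γ ^ 2 / kappaBar η b := fun k => by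
    rw [h2, mul_div_cancel_left₀ _ hκ.ne']
    exact le_ciSup (f := fun k => ∫ ω, y 0 ω k ^ 2 ∂P) (Set.finite_range _).bddAbove k
  have h4 : ∀ k, ∫ ω, Y 0 ω k ^ 2 ∂P = fs ^ 2 * ∫ ω, y 0 ω k ^ 2 ∂P := fun k => by
    rw [← integral_const_mul]
    congr 1
    ext ω
    rw [hy]
    field_simp
  simp only [h4]
  calc ∑ k, fs ^ 2 * ∫ ω, y 0 ω k ^ 2 ∂P ≤ ∑ _k : Fin K, fs ^ 2 * (γ ^ 2 / kappaBar η b) :=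
        Finset.sum_le_sum fun k _ => mul_le_mul_of_nonneg_left (h3 k) (sq_nonneg _)
    _ = K * γ ^ 2 * fs ^ 2 / kappaBar η b := by
        rw [Finset.sum_const, Finset.card_univ, Fintype.card_fin, nsmul_eq_mul]
        ring

omit [IsProbabilityMeasure P] hm hfs hband in
theorem integrable_frob {α : Type*} [MeasurableSpace α] {μ : Measure α} {r q : ℕ}
    {A : α → Matrix (Fin r) (Fin q) ℂ} (h : MemLp (fun a => fvec (A a)) 2 μ) :
    Integrable (fun a => frob (A a)) μ := by
  have := h.norm.integrable_sq
  simpa only [norm_fvec_sq] using this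

omit [IsProbabilityMeasure P] hfs hband in
theorem IsSignalModel.entryMeas_stacked : EntryMeas (stacked Υ fs Cx Γ) :=
  EntryMeas.stack (EntryMeas.mul hm.freqResponse.measurable hm.wss.entryMeas_sqrt)

/-- No finite impulse response digital filter has a smaller error than the closed-form value. -/
theorem IsAcquisition.optimalDistortion_le (hK : 0 < K) (hη : 0 < η)
    (hηb : 2 * η ^ 2 < 3 * 2 ^ (2 * b)) {ζ : ℝ}
    (hζ : IsWaterLevel K fs b η (stacked Υ fs Cx Γ) ζ)
    (h : IsAcquisition P x Cx s fs b η H y γ w z) (c : ℤ →₀ Matrix (Fin N) (Fin K) ℝ) :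
    optimalDistortion K fs b (stacked Υ fs Cx Γ) ζ (mse P (mmseEst P x s) 0)
      ≤ ∫ ω, ‖evec (mmseEst P x s ω - firOut (fun n => z (-n)) c ω)‖ ^ 2 ∂P := by
  have hκ := kappaBar_pos hη hηb
  have hζ0 := hζ.pos hK hfs hη hηb
  have hγ := h.range_pos
  have hΓm : EntryMeas (stacked Υ fs Cx Γ) := hm.entryMeas_stacked
  have hΓ := hm.memLp_stacked hfs hband
  obtain ⟨Y, hY, -⟩ := h.samples
  have hH := TaskADC.memLp_stacked hfs hm hband h.freqResponse.measurable (hY 0)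
  rw [hζ.optimalDistortion_eq hK hfs hη hηb hΓm hΓ, hm.mse_zero hfs hband,
    h.integral_fir_error hm hfs hband hm.freqResponse.measurable hm.linear_mmse]
  set c' : ℝ := γ ^ 2 / 2 ^ (2 * b) * fs with hc'
  have hc0 : 0 < c' := by positivity
  -- The multiplier makes the threshold `√(c' l)` equal to `1 / ζ`, whatever the dynamic range of
  -- the system at hand.
  set l : ℝ := (1 / ζ) ^ 2 / c' with hl
  have hl0 : 0 < l := by positivity
  set G : ℝ → Matrix (Fin N) (Fin K) ℂ := fun f => ((1 / fs : ℝ) : ℂ) • dtft fs c f with hG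
  have hGm : MemLp (fun f => fvec (G f)) 2 (base fs) := by
    have := memLp_tapFreq_mul (μ := base fs) (fun n : ℤ => (n : ℝ) / fs)
      (B := fun _ => (1 : Matrix (Fin K) (Fin K) ℂ)) (memLp_const _) c
    rw [memLp_fvec_iff] at this ⊢
    intro i k
    have h1 := (this i k).const_mul ((1 / fs : ℝ) : ℂ)
    simp only [Matrix.mul_one] at h1
    exact h1
  have hGH : MemLp (fun f => fvec (G f * stacked Υ fs Cx H f)) 2 (base fs) := by
    have := memLp_tapFreq_mul (fun n : ℤ => (n : ℝ) / fs) hH c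
    rw [memLp_fvec_iff] at this ⊢
    intro i k
    simp only [hG, Matrix.smul_mul, Matrix.smul_apply]
    exact (this i k).const_mul _
  have hE : MemLp (fun f => fvec (stacked Υ fs Cx Γ f - G f * stacked Υ fs Cx H f)) 2 (base fs) :=
    hΓ.sub hGH
  have i1 := integrable_frob hE
  have i2 := (integrable_frob hGm).const_mul c'
  have i3 := (integrable_frob hH).const_mul l
  have iW : Integrable (fun f => ∑ i ∈ Finset.range (min K ((2 * Υ + 1) * M)),
      max (singVal (stacked Υ fs Cx Γ f) i - 1 / ζ) 0 ^ 2) (base fs) := by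
    exact integrable_finsetSum _ fun i _ => integrable_singVal_excess hΓm hΓ (by positivity) i
  have key : (∫ f, frob (stacked Υ fs Cx Γ f) ∂(base fs))
      - ∫ f, ∑ i ∈ Finset.range (min K ((2 * Υ + 1) * M)),
        max (singVal (stacked Υ fs Cx Γ f) i - 1 / ζ) 0 ^ 2 ∂(base fs)
      ≤ ∫ f, frob (stacked Υ fs Cx Γ f - G f * stacked Υ fs Cx H f) ∂(base fs)
        + c' * ∫ f, frob (G f) ∂(base fs) + l * ∫ f, frob (stacked Υ fs Cx H f) ∂(base fs) := by
    rw [← integral_const_mul, ← integral_const_mul, ← integral_sub (integrable_frob hΓ) iW,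
      ← integral_add i1 i2]
    refine le_trans ?_ (integral_add (i1.add i2) i3).le
    refine integral_mono ((integrable_frob hΓ).sub iW) ((i1.add i2).add i3) fun f => ?_
    exact pointwise_lower_bound _ _ _ hc0 (by rw [hl]; field_simp)
  have hpow := h.power_le hm hfs hband hK hη hηb
  -- Here `γ ^ 2` from the power budget cancels against the one in `c'`, which makes the bound
  -- common to all acquisition systems.
  have h5 : l * ∫ f, frob (stacked Υ fs Cx H f) ∂(base fs)
      ≤ 1 / ζ ^ 2 * 2 ^ (2 * b) * (K * fs / kappaBar η b) := by
    refine (mul_le_mul_of_nonneg_left hpow hl0.le).trans (le_of_eq ?_)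
    rw [hl, hc']
    field_simp
  linarith

end

end

/-! ### Conjugate symmetry and measurability of the Wiener filter -/

/-- Entrywise conjugation. -/
def conjMat {p q : ℕ} (A : Matrix (Fin p) (Fin q) ℂ) : Matrix (Fin p) (Fin q) ℂ :=
  A.conjTranspose.transpose

section

variable {p q r : ℕ}

theorem conjMat_apply (A : Matrix (Fin p) (Fin q) ℂ) (i : Fin p) (j : Fin q) :
    conjMat A i j = star (A i j) := rfl

theorem conjMat_mul (A : Matrix (Fin p) (Fin q) ℂ) (B : Matrix (Fin q) (Fin r) ℂ) :
    conjMat (A * B) = conjMat A * conjMat B := by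
  simp only [conjMat, Matrix.conjTranspose_mul, Matrix.transpose_mul]

theorem conjMat_add (A B : Matrix (Fin p) (Fin q) ℂ) : conjMat (A + B) = conjMat A + conjMat B := by
  simp only [conjMat, Matrix.conjTranspose_add, Matrix.transpose_add]

theorem conjMat_conjTranspose (A : Matrix (Fin p) (Fin q) ℂ) :
    conjMat A.conjTranspose = (conjMat A).conjTranspose := by
  ext i j
  simp [conjMat]

theorem conjMat_conjMat (A : Matrix (Fin p) (Fin q) ℂ) : conjMat (conjMat A) = A := by
  ext i j
  simp [conjMat]

theorem conjMat_one : conjMat (1 : Matrix (Fin p) (Fin p) ℂ) = 1 := by simp [conjMat]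

theorem conjMat_ofReal_smul (c : ℝ) (A : Matrix (Fin p) (Fin q) ℂ) :
    conjMat ((c : ℂ) • A) = (c : ℂ) • conjMat A := by
  ext i j
  simp [conjMat]

theorem conjMat_inv (A : Matrix (Fin p) (Fin p) ℂ) : conjMat A⁻¹ = (conjMat A)⁻¹ := by
  simp only [conjMat, Matrix.conjTranspose_nonsing_inv, Matrix.transpose_nonsing_inv]

theorem conjMat_rectDiag (d : ℕ → ℝ) : conjMat (rectDiag p q d) = rectDiag p q d := by
  ext i j
  rw [conjMat_apply, rectDiag_apply]
  split_ifs <;> simp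

theorem conjMat_sum {ι : Type*} (s : Finset ι) (F : ι → Matrix (Fin p) (Fin q) ℂ) :
    conjMat (∑ k ∈ s, F k) = ∑ k ∈ s, conjMat (F k) := by
  simp only [conjMat, Matrix.conjTranspose_sum, Matrix.transpose_sum]

theorem EntryMeas.det {α : Type*} [MeasurableSpace α] {F : α → Matrix (Fin p) (Fin p) ℂ}
    (hF : EntryMeas F) : Measurable fun a => (F a).det := by
  simp only [Matrix.det_apply]
  exact Finset.measurable_sum _ fun σ _ =>
    (Finset.measurable_prod _ fun i _ => hF (σ i) i).const_smul _

theorem EntryMeas.inv {α : Type*} [MeasurableSpace α] {F : α → Matrix (Fin p) (Fin p) ℂ}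
    (hF : EntryMeas F) : EntryMeas fun a => (F a)⁻¹ := by
  intro i j
  simp only [Matrix.inv_def, Matrix.smul_apply, Matrix.adjugate_apply, Ring.inverse_eq_inv]
  refine hF.det.inv.mul (EntryMeas.det fun k l => ?_)
  by_cases h : k = j
  · subst h
    simp only [Matrix.updateRow_self]
    exact measurable_const
  · simp only [Matrix.updateRow_ne h]
    exact hF k l

theorem EntryMeas.wiener {α : Type*} [MeasurableSpace α] {K : ℕ} (c : ℝ)
    {A : α → Matrix (Fin p) (Fin q) ℂ} {H : α → Matrix (Fin K) (Fin q) ℂ} (hA : EntryMeas A)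
    (hH : EntryMeas H) : EntryMeas fun a => wiener c (A a) (H a) :=
  (hA.mul hH.conjTranspose).mul ((hH.mul hH.conjTranspose).add (EntryMeas.const _)).inv

theorem memLp_of_frob_le {α : Type*} [MeasurableSpace α] {μ : Measure α} {p' q' : ℕ}
    {F : α → Matrix (Fin p) (Fin q) ℂ} {A : α → Matrix (Fin p') (Fin q') ℂ} (hF : EntryMeas F)
    (hA : MemLp (fun a => fvec (A a)) 2 μ) {C : ℝ}
    (h : ∀ᵐ a ∂μ, frob (F a) ≤ C * frob (A a)) : MemLp (fun a => fvec (F a)) 2 μ := by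
  have hm : AEStronglyMeasurable (fun a => fvec (F a)) μ :=
    aesm_fvec fun i j => (hF i j).aestronglyMeasurable
  rw [memLp_two_iff_integrable_sq_norm hm]
  refine ((integrable_frob hA).const_mul C).mono' (hm.norm.pow 2) ?_
  filter_upwards [h] with a ha
  rwa [Real.norm_eq_abs, abs_of_nonneg (sq_nonneg _), norm_fvec_sq]

end

section

variable {Ω : Type*} [mΩ : MeasurableSpace Ω] {P : Measure Ω} {M N K : ℕ}
  {x : Proc ℝ Ω M} {Cx : ℝ → Matrix (Fin M) (Fin M) ℂ} {s : Ω → Fin N → ℝ}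
  {Γ : ℝ → Matrix (Fin N) (Fin M) ℂ} {fs η γ : ℝ} {b Υ : ℕ} {Ho : ℝ → Matrix (Fin K) (Fin M) ℂ}
  {y w z : Proc ℤ Ω K}

/-- Cross spectra of aliased filters are conjugate symmetric. -/
theorem stacked_cross_conj (hfs : 0 < fs) (hx : IsWSS P x Cx)
    (hband : ∀ f : ℝ, ((Υ : ℝ) + 1 / 2) * fs < |f| → Cx f = 0) {p q : ℕ}
    {A : ℝ → Matrix (Fin p) (Fin M) ℂ} {B : ℝ → Matrix (Fin q) (Fin M) ℂ}
    (hA : IsFreqResponse A) (hB : IsFreqResponse B) :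
    ∀ᵐ f : ℝ, stacked Υ fs Cx A (-f) * (stacked Υ fs Cx B (-f)).conjTranspose
      = conjMat (stacked Υ fs Cx A f * (stacked Υ fs Cx B f).conjTranspose) := by
  have hc := hx.psd_conj (R := ((Υ : ℝ) + 1 / 2) * fs) (by positivity) hband
  filter_upwards [ae_shiftBand (Υ := Υ) (fs := fs) hA.conj_symm,
    ae_shiftBand (Υ := Υ) (fs := fs) hB.conj_symm, ae_shiftBand (Υ := Υ) (fs := fs) hc]
    with f h1 h2 h3
  simp only [stacked_eq, stack_mul_conjTranspose]
  -- The alias of `-f` with index `2 Υ - k` is minus the alias of `f` with index `k`. In the product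
  -- the two square roots merge into `Cx`, so no symmetry of the root itself is needed.
  rw [conjMat_sum, ← Finset.sum_range_reflect]
  refine Finset.sum_congr rfl fun k hk => ?_
  have hk' := Finset.mem_range.mp hk
  have e : 2 * Υ + 1 - 1 - k = 2 * Υ - k := by omega
  have e2 : shiftBand Υ fs (-f) (2 * Υ - k) = -shiftBand Υ fs f k := by
    rw [shiftBand_neg f (by omega)]
    congr 2
    omega
  rw [e, e2]
  have hprod : ∀ g, (A g * CFC.sqrt (Cx g)) * (B g * CFC.sqrt (Cx g)).conjTranspose
      = A g * Cx g * (B g).conjTranspose := fun g => by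
    rw [Matrix.conjTranspose_mul, sqrt_conjTranspose, Matrix.mul_assoc, ← Matrix.mul_assoc _ _
      (B g).conjTranspose, sqrt_mul_sqrt (hx.psd_posSemidef g), Matrix.mul_assoc]
  rw [hprod, hprod, conjMat_mul, conjMat_mul, conjMat_conjTranspose]
  have e3 : A (-shiftBand Υ fs f k) = conjMat (A (shiftBand Υ fs f k)) := by ext i j; exact h1 k i j
  have e4 : B (-shiftBand Υ fs f k) = conjMat (B (shiftBand Υ fs f k)) := by ext i j; exact h2 k i j
  have e5 : Cx (-shiftBand Υ fs f k) = conjMat (Cx (shiftBand Υ fs f k)) := by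
    ext i j; exact h3 k i j
  rw [e3, e4, e5]

/-- The Wiener filter depends on the stacked matrices only through `A Bᴴ` and `B Bᴴ`, which are
conjugate symmetric, and conjugation commutes with products and inverses. -/
theorem wiener_conj (hfs : 0 < fs) (hx : IsWSS P x Cx)
    (hband : ∀ f : ℝ, ((Υ : ℝ) + 1 / 2) * fs < |f| → Cx f = 0) {p q : ℕ}
    {A : ℝ → Matrix (Fin p) (Fin M) ℂ} {B : ℝ → Matrix (Fin q) (Fin M) ℂ}
    (hA : IsFreqResponse A) (hB : IsFreqResponse B) (c : ℝ) :
    ∀ᵐ f : ℝ, wiener c (stacked Υ fs Cx A (-f)) (stacked Υ fs Cx B (-f))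
      = conjMat (wiener c (stacked Υ fs Cx A f) (stacked Υ fs Cx B f)) := by
  filter_upwards [stacked_cross_conj hfs hx hband hA hB, stacked_cross_conj hfs hx hband hB hB]
    with f h1 h2
  rw [wiener, wiener, h1, h2, conjMat_mul _ (_ + _)⁻¹, conjMat_inv, conjMat_add,
    conjMat_ofReal_smul, conjMat_one]

/-! ### Water-filling filters -/

theorem unitary_left {n : ℕ} {U : Matrix (Fin n) (Fin n) ℂ}
    (h : U ∈ Matrix.unitaryGroup (Fin n) ℂ) : U.conjTranspose * U = 1 :=
  Matrix.mem_unitaryGroup_iff'.mp h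

section

variable {U : ℝ → Matrix (Fin K) (Fin K) ℂ}
  {V : ℝ → Matrix (Fin ((2 * Υ + 1) * M)) (Fin ((2 * Υ + 1) * M)) ℂ} {ζ : ℝ}

/-- Total power and power per channel of a water-filling filter. -/
theorem HasWaterFillingForm.power {Mb : ℕ} {Gb : ℝ → Matrix (Fin N) (Fin Mb) ℂ}
    {Hb : ℝ → Matrix (Fin K) (Fin Mb) ℂ} {V : ℝ → Matrix (Fin Mb) (Fin Mb) ℂ}
    (h : HasWaterFillingForm fs b ζ Gb Hb U V) : ∀ᵐ f ∂(base fs),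
      frob (Hb f) = ∑ i ∈ Finset.range (min K Mb), waterEntry b ζ (singVal (Gb f) i) ^ 2 ∧
      ∀ k, K * ((Hb f * (Hb f).conjTranspose) k k).re
        = ∑ i ∈ Finset.range (min K Mb), waterEntry b ζ (singVal (Gb f) i) ^ 2 := by
  filter_upwards [h] with f ⟨⟨hV, _⟩, hU, hd, hH⟩
  have h1 : frob (Hb f)
      = ∑ i ∈ Finset.range (min K Mb), waterEntry b ζ (singVal (Gb f) i) ^ 2 := by
    rw [hH, frob_mul_right _ (by simpa using unitary_left hV), frob_mul_left _ (unitary_left hU),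
      waterMatrix, frob_rectDiag]
  refine ⟨h1, fun k => ?_⟩
  have h2 : Hb f * (Hb f).conjTranspose = U f * waterMatrix K b ζ (Gb f)
      * (waterMatrix K b ζ (Gb f)).conjTranspose * (U f).conjTranspose := by
    rw [hH, Matrix.conjTranspose_mul, Matrix.conjTranspose_conjTranspose, Matrix.mul_assoc,
      ← Matrix.mul_assoc _ (V f), unitary_left hV, Matrix.one_mul, Matrix.conjTranspose_mul,
      Matrix.mul_assoc, Matrix.mul_assoc, Matrix.mul_assoc]
  rw [← h1]
  have h3 := congrArg Complex.re (frob_eq_trace (Hb f))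
  rw [Complex.ofReal_re] at h3
  rw [← h3, h2, Matrix.trace, Complex.re_sum]
  simp only [Matrix.diag]
  rw [Finset.sum_congr rfl fun l _ => congrArg Complex.re (hd l k), Finset.sum_const,
    Finset.card_univ, Fintype.card_fin, nsmul_eq_mul]

variable (hm : IsSignalModel P x Cx s Γ) (hfs : 0 < fs)
  (hband : ∀ f : ℝ, ((Υ : ℝ) + 1 / 2) * fs < |f| → Cx f = 0)
  (hζ : IsWaterLevel K fs b η (stacked Υ fs Cx Γ) ζ) (hHo : IsFreqResponse Ho)
  (h : HasWaterFillingForm fs b ζ (stacked Υ fs Cx Γ) (stacked Υ fs Cx Ho) U V)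

include hm hfs hband hζ hHo h

theorem HasWaterFillingForm.exists_output (t : ℝ) :
    ∃ Y, IsFilterOutput P x Cx Ho t Y := by
  have hB : EntryMeas fun f => Ho f * CFC.sqrt (Cx f) :=
    EntryMeas.mul hHo.measurable hm.wss.entryMeas_sqrt
  have hb : ∀ f : ℝ, ((Υ : ℝ) + 1 / 2) * fs < |f| → Ho f * CFC.sqrt (Cx f) = 0 := fun f hf => by
    rw [hband f hf, CFC.sqrt_zero, Matrix.mul_zero]
  refine exists_isFilterOutput hm.wss (R := ((Υ : ℝ) + 1 / 2) * fs) (by positivity) hband hHo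
    ((memLp_stack hfs hB hb).mp ?_) t
  have hs : AEStronglyMeasurable (fun f => fvec (stacked Υ fs Cx Ho f)) (base fs) :=
    aesm_fvec fun i j => (hB.stack i j).aestronglyMeasurable
  refine (memLp_two_iff_integrable_sq_norm hs).mpr ?_
  simp only [norm_fvec_sq]
  refine (hζ.integrable hfs).congr ?_
  filter_upwards [h.power] with f hf
  exact hf.1.symm

/-- Identical diagonal entries mean that every channel carries the fraction `1 / K` of the total
power, which the water level fixes. -/
theorem HasWaterFillingForm.integral_channel (hK : 0 < K) (hη : 0 < η)
    (hηb : 2 * η ^ 2 < 3 * 2 ^ (2 * b)) {t : ℝ} {Y : Ω → Fin K → ℝ}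
    (hY : IsFilterOutput P x Cx Ho t Y) (k : Fin K) :
    ∫ ω, (1 / fs * Y ω k) ^ 2 ∂P = 1 / fs / kappaBar η b := by
  have hK' : (0 : ℝ) < K := Nat.cast_pos.mpr hK
  have hκ := kappaBar_pos hη hηb
  have h1 := hY.integral_channel_sq hfs hm.wss hband hHo.measurable k
  have h2 : ∫ f, ((stacked Υ fs Cx Ho f * (stacked Υ fs Cx Ho f).conjTranspose) k k).re ∂(base fs)
      = 1 / K * (K * fs / kappaBar η b) := by
    rw [← hζ.integral_eq hK hfs hη hηb, ← integral_const_mul]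
    refine integral_congr_ae ?_
    filter_upwards [h.power] with f hf
    rw [← hf.2 k]
    field_simp
  simp only [mul_pow]
  rw [integral_const_mul, h1, h2]
  field_simp

/-- The water level normalises the range so that the noise weight `γ ^ 2 / 2 ^ (2 * b) * fs` becomes
`1 / 2 ^ (2 * b)`, the constant in the closed form. -/
theorem HasWaterFillingForm.range_sq [IsProbabilityMeasure P] (hK : 0 < K) (hη : 0 < η)
    (hηb : 2 * η ^ 2 < 3 * 2 ^ (2 * b)) (hacq : IsAcquisition P x Cx s fs b η Ho y γ w z) :
    γ ^ 2 = 1 / fs := by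
  have hκ := kappaBar_pos hη hηb
  have : Nonempty (Fin K) := ⟨⟨0, hK⟩⟩
  obtain ⟨Y, hY, hy⟩ := hacq.samples
  rw [hacq.range_sq hm hK hηb 0]
  simp only [hy, h.integral_channel hm hfs hband hζ hHo hK hη hηb (hY 0), ciSup_const]
  field_simp

/-- Water-filling filters are admissible. -/
theorem HasWaterFillingForm.exists_acquisition [IsProbabilityMeasure P] (hK : 0 < K) (hη : 0 < η)
    (hηb : 2 * η ^ 2 < 3 * 2 ^ (2 * b))
    (hdither : ∀ Δ : ℝ, 0 < Δ → ∃ w : Proc ℤ Ω K, IsDither P x s Δ w) :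
    ∃ y γ w z, IsAcquisition P x Cx s fs b η Ho y γ w z := by
  have hκ := kappaBar_pos hη hηb
  have : Nonempty (Fin K) := ⟨⟨0, hK⟩⟩
  have hγ : 0 < √(1 / fs) := Real.sqrt_pos.mpr (by positivity)
  have hΔ : 0 < stepSize √(1 / fs) b := by rw [stepSize]; positivity
  obtain ⟨w, hw⟩ := hdither _ hΔ
  have hY : ∀ n : ℤ, ∃ Y, IsFilterOutput P x Cx Ho (n * (1 / fs)) Y := fun n =>
    h.exists_output hm hfs hband hζ hHo _
  choose Y hY using hY
  refine ⟨fun n ω k => 1 / fs * Y n ω k, √(1 / fs), w, fun n ω k =>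
    granular (stepSize √(1 / fs) b) (1 / fs * Y n ω k + w n ω k), hHo,
    ⟨Y, hY, fun n ω k => rfl⟩, hγ, fun n => ?_, hw, fun n k => EventuallyEq.rfl⟩
  have h1 : ∀ k, ∫ ω, (1 / fs * Y n ω k + w n ω k) ^ 2 ∂P
      = ∫ ω, (1 / fs * Y n ω k) ^ 2 ∂P + stepSize √(1 / fs) b ^ 2 / 6 := fun k =>
    hw.integral_add_sq hm hΔ (((hY n).1 k).const_mul _) (((hY n).aesm hm.wss k).const_mul _)
  simp only [h1]
  rw [range_sq_iff hK hηb fun k => ∫ ω, (1 / fs * Y n ω k) ^ 2 ∂P]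
  simp only [h.integral_channel hm hfs hband hζ hHo hK hη hηb (hY n), ciSup_const]
  rw [Real.sq_sqrt (by positivity)]
  field_simp

/-- The closed-form value is attained by a linear digital filter. -/
theorem HasWaterFillingForm.exists_digitalOutput [IsProbabilityMeasure P] (hK : 0 < K) (hη : 0 < η)
    (hηb : 2 * η ^ 2 < 3 * 2 ^ (2 * b)) (hacq : IsAcquisition P x Cx s fs b η Ho y γ w z) :
    ∃ (D : ℤ → Matrix (Fin N) (Fin K) ℝ) (r : Ω → Fin N → ℝ), IsDigitalOutput P z D r ∧
      mse P (mmseEst P x s) r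
        = optimalDistortion K fs b (stacked Υ fs Cx Γ) ζ (mse P (mmseEst P x s) 0) := by
  set c : ℝ := 1 / 2 ^ (2 * b) with hc
  have hc0 : 0 < c := by positivity
  obtain ⟨Y, hY, -⟩ := hacq.samples
  have hΓm : EntryMeas (stacked Υ fs Cx Γ) := hm.entryMeas_stacked
  have hHm : EntryMeas (stacked Υ fs Cx Ho) :=
    EntryMeas.stack (EntryMeas.mul hHo.measurable hm.wss.entryMeas_sqrt)
  have hΓ := hm.memLp_stacked hfs hband
  set G : ℝ → Matrix (Fin N) (Fin K) ℂ := fun f =>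
    wiener c (stacked Υ fs Cx Γ f) (stacked Υ fs Cx Ho f) with hG
  have hGm : EntryMeas G := EntryMeas.wiener c hΓm hHm
  have hval : ∀ᵐ f ∂(base fs), frob (stacked Υ fs Cx Γ f - G f * stacked Υ fs Cx Ho f)
      + c * frob (G f) = frob (stacked Υ fs Cx Γ f)
        - ∑ i ∈ Finset.range (min K ((2 * Υ + 1) * M)), singVal (stacked Υ fs Cx Γ f) i ^ 2
          * waterEntry b ζ (singVal (stacked Υ fs Cx Γ f) i) ^ 2
          / (waterEntry b ζ (singVal (stacked Υ fs Cx Γ f) i) ^ 2 + c) := by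
    filter_upwards [h] with f ⟨⟨hV, W, hW, hA⟩, hU, _, hH⟩
    exact wiener_value hc0 (unitary_left hW) (unitary_left hV) (unitary_left hU) hA hH
  -- The optimum never exceeds the cost of estimating nothing. This dominates both the Wiener filter
  -- and its error by the target and gives their square integrability.
  have hle : ∀ᵐ f ∂(base fs), frob (stacked Υ fs Cx Γ f - G f * stacked Υ fs Cx Ho f)
      + c * frob (G f) ≤ frob (stacked Υ fs Cx Γ f) := by
    filter_upwards [hval] with f hf
    rw [hf]
    refine sub_le_self _ (Finset.sum_nonneg fun i _ => ?_)
    positivity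
  have hGL : MemLp (fun f => fvec (G f)) 2 (base fs) := by
    refine memLp_of_frob_le (C := 1 / c) hGm hΓ ?_
    filter_upwards [hle] with f hf
    rw [one_div, ← div_eq_inv_mul, le_div_iff₀ hc0]
    linarith [frob_nonneg (stacked Υ fs Cx Γ f - G f * stacked Υ fs Cx Ho f)]
  have hEL : MemLp (fun f => fvec (stacked Υ fs Cx Γ f - G f * stacked Υ fs Cx Ho f)) 2
      (base fs) := by
    refine memLp_of_frob_le (C := 1) (hΓm.sub (hGm.mul hHm)) hΓ ?_
    filter_upwards [hle] with f hf
    linarith [mul_nonneg hc0.le (frob_nonneg (G f))]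
  have hGH : MemLp (fun f => fvec (G f * stacked Υ fs Cx Ho f)) 2 (base fs) := by
    refine (hΓ.sub hEL).ae_eq (Eventually.of_forall fun f => ?_)
    simp only [Pi.sub_apply, ← fvec_sub, sub_sub_cancel]
  have hsym : ∀ᵐ f ∂(base fs), ∀ i k, G (-f) i k = star (G f i k) := by
    refine ae_restrict_of_ae ?_
    filter_upwards [wiener_conj hfs hm.wss hband hm.freqResponse hHo c] with f hf i k
    exact congrFun (congrFun hf i) k
  obtain ⟨D, r, hD, hr⟩ := hacq.exists_digitalOutput hm hfs hband hGL hGH hsym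
  refine ⟨D, r, hD, ?_⟩
  have hγ : γ ^ 2 / 2 ^ (2 * b) * fs = c := by
    rw [h.range_sq hm hfs hband hζ hHo hK hη hηb hacq, hc]
    field_simp
  rw [hr, hγ, optimalDistortion, intervalIntegral_base hfs, hm.mse_zero hfs hband]
  have hS : Integrable (fun f => ∑ i ∈ Finset.range (min K ((2 * Υ + 1) * M)),
      singVal (stacked Υ fs Cx Γ f) i ^ 2 * waterEntry b ζ (singVal (stacked Υ fs Cx Γ f) i) ^ 2
          / (waterEntry b ζ (singVal (stacked Υ fs Cx Γ f) i) ^ 2 + c)) (base fs) := by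
    refine ((integrable_frob hΓ).sub ((integrable_frob hEL).add
      ((integrable_frob hGL).const_mul c))).congr ?_
    filter_upwards [hval] with f hf
    simp only [Pi.sub_apply, Pi.add_apply]
    linarith
  rw [integral_congr_ae hval, integral_sub (integrable_frob hΓ) hS]

end

end

/-! ### Existence of water-filling filters -/

/-- The unitary discrete Fourier transform. -/
def dftMat (K : ℕ) : Matrix (Fin K) (Fin K) ℂ :=
  Matrix.of fun k l => ((√(K : ℝ))⁻¹ : ℝ) * Complex.exp (2 * Real.pi * Complex.I / K) ^ (k * l : ℕ)

theorem norm_dftMat_sq {K : ℕ} (hK : 0 < K) (k l : Fin K) : ‖dftMat K k l‖ ^ 2 = 1 / K := by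
  have hω : ‖Complex.exp (2 * Real.pi * Complex.I / K)‖ = 1 :=
    (Complex.isPrimitiveRoot_exp K hK.ne').norm'_eq_one hK.ne'
  rw [dftMat, Matrix.of_apply, norm_mul, norm_pow, hω, one_pow, mul_one, Complex.norm_real,
    Real.norm_eq_abs, sq_abs, inv_pow, Real.sq_sqrt (Nat.cast_nonneg K), one_div]

theorem dftMat_unitary {K : ℕ} (hK : 0 < K) : dftMat K * (dftMat K).conjTranspose = 1 := by
  have hprim := Complex.isPrimitiveRoot_exp K hK.ne'
  set ω := Complex.exp (2 * Real.pi * Complex.I / K) with hω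
  have hnorm : ‖ω‖ = 1 := hprim.norm'_eq_one hK.ne'
  have hω0 : ω ≠ 0 := norm_ne_zero_iff.mp (by rw [hnorm]; exact one_ne_zero)
  have hstar : star ω = ω⁻¹ := (Complex.inv_eq_conj hnorm).symm
  have hK' : (K : ℂ) ≠ 0 := Nat.cast_ne_zero.mpr hK.ne'
  have hs : (((√(K : ℝ))⁻¹ : ℝ) : ℂ) * (((√(K : ℝ))⁻¹ : ℝ) : ℂ) = (K : ℂ)⁻¹ := by
    rw [← Complex.ofReal_mul, ← mul_inv, Real.mul_self_sqrt (Nat.cast_nonneg K)]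
    push_cast
    rfl
  ext k k'
  have hterm : ∀ l : Fin K, dftMat K k l * (dftMat K).conjTranspose l k'
      = (K : ℂ)⁻¹ * (ω ^ (k : ℕ) * ω⁻¹ ^ (k' : ℕ)) ^ (l : ℕ) := by
    intro l
    rw [Matrix.conjTranspose_apply, dftMat, Matrix.of_apply, Matrix.of_apply, star_mul', star_pow,
      ← hω, hstar, Complex.star_def, Complex.conj_ofReal, mul_pow, ← pow_mul, ← pow_mul, ← hs]
    ring
  rw [Matrix.mul_apply]
  simp only [hterm]
  rw [← Finset.mul_sum, Fin.sum_univ_eq_sum_range (fun l => (ω ^ (k : ℕ) * ω⁻¹ ^ (k' : ℕ)) ^ l) K]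
  by_cases h : k = k'
  · subst h
    rw [inv_pow, mul_inv_cancel₀ (pow_ne_zero _ hω0)]
    simp [hK']
  · rw [Matrix.one_apply_ne h]
    have hne : ω ^ (k : ℕ) * ω⁻¹ ^ (k' : ℕ) ≠ 1 := by
      intro h1
      rw [inv_pow, mul_inv_eq_one₀ (pow_ne_zero _ hω0)] at h1
      exact h (Fin.ext (hprim.pow_inj k.2 k'.2 h1))
    have hpow : (ω ^ (k : ℕ) * ω⁻¹ ^ (k' : ℕ)) ^ K = 1 := by
      rw [mul_pow, ← pow_mul, ← pow_mul, mul_comm (k : ℕ), mul_comm (k' : ℕ), pow_mul, pow_mul,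
        inv_pow, hprim.pow_eq_one]
      simp
    rw [geom_sum_eq hne, hpow, sub_self, zero_div, mul_zero]

/-- The gain that turns the singular value `σ` into the water-filling entry. -/
def waterGain (b : ℕ) (ζ σ : ℝ) : ℝ := waterEntry b ζ σ / σ

/-- At `σ = 0` the division returns zero, in agreement with the water-filling entry, since `max (-1)
0 = 0`. -/
theorem waterGain_mul (b : ℕ) {ζ σ : ℝ} : waterGain b ζ σ * σ = waterEntry b ζ σ := by
  rcases eq_or_ne σ 0 with h | h
  · subst h
    simp [waterGain, waterEntry]
  · rw [waterGain, div_mul_cancel₀ _ h]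

/-- The filter acts on `A` from the left, so only the left frame `W` has to be chosen with care; a
matching `V` is completed afterwards. Entries of `U` of equal squared modulus `v` make every
diagonal entry of `U Σ Σᴴ Uᴴ` equal to `v` times the trace of `Σ Σᴴ`. -/
theorem exists_rightSingular {p q K b : ℕ} {ζ v : ℝ} {A : Matrix (Fin p) (Fin q) ℂ}
    {W : Matrix (Fin p) (Fin p) ℂ} (hW : W.conjTranspose * W = 1)
    (hA : A * A.conjTranspose = W * rectDiag p p (fun i => singVal A i ^ 2) * W.conjTranspose)
    (hσ : ∀ i, p ≤ i → singVal A i = 0) {U : Matrix (Fin K) (Fin K) ℂ}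
    (hU1 : ∀ k l, ‖U k l‖ ^ 2 = v) :
    ∃ V, IsRightSingular A V ∧
      (∀ k l, (U * waterMatrix K b ζ A * (waterMatrix K b ζ A).conjTranspose * U.conjTranspose) k k
        = (U * waterMatrix K b ζ A * (waterMatrix K b ζ A).conjTranspose * U.conjTranspose) l l) ∧
      U * rectDiag K p (fun i => waterGain b ζ (singVal A i)) * W.conjTranspose * A
        = U * waterMatrix K b ζ A * V.conjTranspose := by
  obtain ⟨-, V, hV, hAV⟩ := exists_svd_of_left hW
    (fun i j hij => pow_le_pow_left₀ (singVal_nonneg _ _) (singVal_antitone A hij) 2)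
    (fun i => sq_nonneg _) (fun i hi => by rw [hσ i hi]; simp) hA
  refine ⟨V, ⟨Matrix.mem_unitaryGroup_iff'.mpr hV, W, Matrix.mem_unitaryGroup_iff'.mpr hW, hAV⟩,
    ?_, ?_⟩
  · have h1 : ∀ k, (U * waterMatrix K b ζ A * (waterMatrix K b ζ A).conjTranspose
        * U.conjTranspose) k k = ∑ l : Fin K, ((trunc q (fun i => waterEntry b ζ (singVal A i)) l
          * waterEntry b ζ (singVal A l) : ℝ) : ℂ) * (v : ℂ) := by
      intro k
      rw [Matrix.mul_assoc U, waterMatrix, rectDiag_conjTranspose, rectDiag_mul_rectDiag,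
        rectDiag_self, Matrix.mul_apply]
      refine Finset.sum_congr rfl fun l _ => ?_
      rw [Matrix.mul_diagonal, Matrix.conjTranspose_apply, mul_right_comm, Complex.star_def,
        Complex.mul_conj, Complex.normSq_eq_norm_sq, hU1, mul_comm]
    intro k l
    rw [h1, h1]
  · have h2 : W.conjTranspose * A = rectDiag p q (singVal A) * V.conjTranspose := by
      nth_rewrite 1 [hAV]
      rw [Matrix.mul_assoc, ← Matrix.mul_assoc, hW, Matrix.one_mul]
    rw [Matrix.mul_assoc, h2, ← Matrix.mul_assoc, Matrix.mul_assoc U, rectDiag_mul_rectDiag,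
      waterMatrix]
    congr 2
    refine rectDiag_congr fun i _ _ => ?_
    rw [trunc]
    split_ifs with hi
    · exact waterGain_mul b
    · rw [hσ i (not_lt.mp hi)]
      simp [waterEntry]

/-- The representative of the frequency `g` in the base band. -/
def reduce (fs g : ℝ) : ℝ := g - ⌊g / fs + 1 / 2⌋ * fs

theorem measurable_reduce (fs : ℝ) : Measurable (reduce fs) := by
  have : Measurable fun g : ℝ => ((⌊g / fs + 1 / 2⌋ : ℤ) : ℝ) :=
    (measurable_from_top (f := fun n : ℤ => (n : ℝ))).comp
      (Int.measurable_floor.comp ((measurable_id.div_const fs).add_const _))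
  exact measurable_id.sub (this.mul_const fs)

theorem reduce_add {fs : ℝ} (hfs : 0 < fs) (g : ℝ) (m : ℤ) :
    reduce fs (g + m * fs) = reduce fs g := by
  have : (g + m * fs) / fs + 1 / 2 = g / fs + 1 / 2 + m := by field_simp; ring
  rw [reduce, reduce, this, Int.floor_add_intCast]
  push_cast
  ring

theorem reduce_eq {fs : ℝ} (hfs : 0 < fs) {f : ℝ} (h : f ∈ Set.Ico (-(fs / 2)) (fs / 2)) :
    reduce fs f = f := by
  have : ⌊f / fs + 1 / 2⌋ = 0 := by
    rw [Int.floor_eq_zero_iff]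
    have h1 : -(1 / 2) ≤ f / fs := by rw [le_div_iff₀ hfs]; linarith [h.1]
    have h2 : f / fs < 1 / 2 := by rw [div_lt_iff₀ hfs]; linarith [h.2]
    constructor <;> linarith
  rw [reduce, this]
  simp

theorem reduce_mem {fs : ℝ} (hfs : 0 < fs) (g : ℝ) :
    reduce fs g ∈ Set.Ico (-(fs / 2)) (fs / 2) := by
  have h1 := Int.floor_le (g / fs + 1 / 2)
  have h2 := Int.lt_floor_add_one (g / fs + 1 / 2)
  have h3 : g = g / fs * fs := by field_simp
  rw [reduce, Set.mem_Ico]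
  constructor <;> nlinarith

/-- Reduction to a half-open band fails to be odd only at its endpoints. Excluding the countably
many multiples of `fs / 2` also keeps the reduced frequency away from zero. -/
theorem ae_reduce_neg {fs : ℝ} (hfs : 0 < fs) :
    ∀ᵐ g : ℝ, reduce fs (-g) = -reduce fs g ∧ reduce fs g ≠ 0 := by
  have hc : (Set.range fun n : ℤ => (n : ℝ) * (fs / 2)).Countable := Set.countable_range _
  filter_upwards [hc.ae_notMem volume] with g hg
  have hm := reduce_mem hfs g
  have h0 : ∀ n : ℤ, (n : ℝ) * (fs / 2) ≠ g := fun n h => hg ⟨n, h⟩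
  constructor
  · have h1 : -(fs / 2) ≠ reduce fs g := by
      intro h
      refine h0 (2 * ⌊g / fs + 1 / 2⌋ - 1) ?_
      rw [reduce] at h
      push_cast
      linarith
    have h2 : -reduce fs g ∈ Set.Ico (-(fs / 2)) (fs / 2) :=
      ⟨by linarith [hm.2], by linarith [lt_of_le_of_ne hm.1 h1]⟩
    rw [← reduce_eq hfs h2]
    have : -g = -reduce fs g + (-⌊g / fs + 1 / 2⌋ : ℤ) * fs := by
      rw [reduce]
      push_cast
      ring
    rw [this, reduce_add hfs]
  · intro h
    refine h0 (2 * ⌊g / fs + 1 / 2⌋) ?_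
    rw [reduce] at h
    push_cast
    linarith

section

variable {Ω : Type*} [mΩ : MeasurableSpace Ω] {P : Measure Ω} {M N K : ℕ}
  {x : Proc ℝ Ω M} {Cx : ℝ → Matrix (Fin M) (Fin M) ℂ} {s : Ω → Fin N → ℝ}
  {Γ : ℝ → Matrix (Fin N) (Fin M) ℂ} {fs η : ℝ} {b Υ : ℕ}

/-- A measurable left factor is built from the left-singular vectors of the stacked target for `f ≥
0`, extended by conjugation and made `fs`-periodic. Multiplying `Γ` by it keeps conjugate symmetry
almost everywhere, and periodicity makes it factor out of the stack. -/
theorem exists_waterFilling (hm : IsSignalModel P x Cx s Γ) (hfs : 0 < fs)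
    (hband : ∀ f : ℝ, ((Υ : ℝ) + 1 / 2) * fs < |f| → Cx f = 0) (hK : 0 < K) (ζ : ℝ) :
    ∃ (Ho : ℝ → Matrix (Fin K) (Fin M) ℂ) (U : ℝ → Matrix (Fin K) (Fin K) ℂ)
      (V : ℝ → Matrix (Fin ((2 * Υ + 1) * M)) (Fin ((2 * Υ + 1) * M)) ℂ),
      IsFreqResponse Ho ∧
      HasWaterFillingForm fs b ζ (stacked Υ fs Cx Γ) (stacked Υ fs Cx Ho) U V := by
  have hΓm : EntryMeas (stacked Υ fs Cx Γ) := hm.entryMeas_stacked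
  obtain ⟨hσm, W, hWm, hW⟩ := exists_measurable_left (hΓm.mul hΓm.conjTranspose)
  set A := stacked Υ fs Cx Γ with hAdef
  set F₀ : ℝ → Matrix (Fin K) (Fin N) ℂ := fun f =>
    dftMat K * rectDiag K N (fun i => waterGain b ζ (singVal (A f) i)) * (W f).conjTranspose with hF₀
  have hF₀m : EntryMeas F₀ := by
    refine EntryMeas.mul (EntryMeas.mul (EntryMeas.const _) fun i j => ?_) hWm.conjTranspose
    simp only [rectDiag_apply]
    split_ifs
    · have h1 : Measurable fun f => waterGain b ζ (singVal (A f) i) := by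
        unfold waterGain waterEntry
        have := hσm i
        fun_prop
      exact Complex.measurable_ofReal.comp h1
    · exact measurable_const
  set F : ℝ → Matrix (Fin K) (Fin N) ℂ := fun f => if 0 ≤ f then F₀ f else conjMat (F₀ (-f)) with hF
  have hFm : EntryMeas F := by
    intro i j
    have h1 : Measurable fun f => star (F₀ (-f) i j) :=
      continuous_star.measurable.comp ((hF₀m i j).comp measurable_neg)
    have h2 : Measurable fun f : ℝ => if 0 ≤ f then F₀ f i j else star (F₀ (-f) i j) :=
      Measurable.ite (p := fun f : ℝ => 0 ≤ f) measurableSet_Ici (hF₀m i j) h1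
    convert h2 using 2 with f
    simp only [hF]
    split_ifs <;> rfl
  have hFneg : ∀ f, f ≠ 0 → F (-f) = conjMat (F f) := by
    intro f hf
    simp only [hF]
    rcases lt_or_gt_of_ne hf with h | h
    · rw [if_pos (by linarith), if_neg (by linarith), conjMat_conjMat]
    · rw [if_neg (by linarith), if_pos h.le, neg_neg]
  -- The left unitary has to be conjugated along with `F` on negative frequencies; conjugation
  -- preserves unitarity and the moduli of its entries.
  set U : ℝ → Matrix (Fin K) (Fin K) ℂ := fun f => if 0 ≤ f then dftMat K else conjMat (dftMat K)
    with hUdef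
  have hUu : ∀ f, U f * (U f).conjTranspose = 1 := by
    intro f
    simp only [hUdef]
    split_ifs
    · exact dftMat_unitary hK
    · rw [← conjMat_conjTranspose, ← conjMat_mul, dftMat_unitary hK, conjMat_one]
  have hU1 : ∀ f k l, ‖U f k l‖ ^ 2 = 1 / K := by
    intro f k l
    simp only [hUdef]
    split_ifs
    · exact norm_dftMat_sq hK k l
    · rw [conjMat_apply, norm_star, norm_dftMat_sq hK]
  let Q (f : ℝ) (V : Matrix (Fin ((2 * Υ + 1) * M)) (Fin ((2 * Υ + 1) * M)) ℂ) : Prop :=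
      IsRightSingular (A f) V ∧
      (∀ k l, (U f * waterMatrix K b ζ (A f) * (waterMatrix K b ζ (A f)).conjTranspose
        * (U f).conjTranspose) k k = (U f * waterMatrix K b ζ (A f)
        * (waterMatrix K b ζ (A f)).conjTranspose * (U f).conjTranspose) l l) ∧
      F f * A f = U f * waterMatrix K b ζ (A f) * V.conjTranspose
  have hpoint : ∀ᵐ f : ℝ, ∃ V, Q f V := by
    filter_upwards [stacked_cross_conj (Υ := Υ) hfs hm.wss hband hm.freqResponse hm.freqResponse]
      with f hf
    rcases le_or_gt 0 f with h | h
    · obtain ⟨hW1, -, hW3, hW4⟩ := hW f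
      obtain ⟨V, h1, h2, h3⟩ := exists_rightSingular (b := b) (ζ := ζ) hW1 hW3 hW4 (hU1 f)
      refine ⟨V, h1, h2, ?_⟩
      rw [← h3]
      simp only [hF, hF₀, hUdef, if_pos h]
    -- For negative `f` the Gram matrix is the conjugate of the one at `-f`, so `conjMat (W (-f))`
    -- diagonalises it with the same singular values.
    · obtain ⟨hW1, -, hW3, hW4⟩ := hW (-f)
      have hW1' : (conjMat (W (-f))).conjTranspose * conjMat (W (-f)) = 1 := by
        rw [← conjMat_conjTranspose, ← conjMat_mul, hW1, conjMat_one]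
      have hgram : A f * (A f).conjTranspose = conjMat (W (-f))
          * rectDiag N N (fun i => singVal (A (-f)) i ^ 2) * (conjMat (W (-f))).conjTranspose := by
        rw [← conjMat_conjMat (A f * (A f).conjTranspose), ← hf, hW3, conjMat_mul, conjMat_mul,
          conjMat_rectDiag, conjMat_conjTranspose]
      have hsing : ∀ i, singVal (A f) i = singVal (A (-f)) i := by
        intro i
        rw [(exists_svd_of_left hW1'
          (fun i j hij => pow_le_pow_left₀ (singVal_nonneg _ _) (singVal_antitone (A (-f)) hij) 2)
          (fun i => sq_nonneg _) (fun i hi => by rw [hW4 i hi]; simp) hgram).1 i,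
          Real.sqrt_sq (singVal_nonneg _ _)]
      simp only [← hsing] at hgram hW4
      obtain ⟨V, h1, h2, h3⟩ := exists_rightSingular (b := b) (ζ := ζ) hW1' hgram hW4 (hU1 f)
      refine ⟨V, h1, h2, ?_⟩
      rw [← h3]
      simp only [hF, hF₀, hUdef, if_neg (not_le.mpr h), conjMat_mul, conjMat_rectDiag,
        conjMat_conjTranspose, ← hsing]
  -- No measurability is demanded of `V`, so it is chosen frequency by frequency, with default `0`
  -- on the exceptional null set.
  have hsel : ∀ f, ∃ V, (∃ V', Q f V') → Q f V := fun f => by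
    by_cases h : ∃ V', Q f V'
    · exact h.imp fun _ hV _ => hV
    · exact ⟨0, fun h' => absurd h' h⟩
  choose V hV using hsel
  refine ⟨fun g => F (reduce fs g) * Γ g, U, V, ⟨?_, ?_⟩, ?_⟩
  · exact EntryMeas.mul (hFm.comp (measurable_reduce fs)) hm.freqResponse.measurable
  · filter_upwards [hm.freqResponse.conj_symm, ae_reduce_neg hfs] with g h1 ⟨h2, h3⟩ i m
    have h4 : Γ (-g) = conjMat (Γ g) := by ext i j; exact h1 i j
    rw [h2, hFneg _ h3, h4, ← conjMat_mul]
    rfl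
  -- The right endpoint of the base band reduces to the left one and is discarded.
  · have hlt : ∀ᵐ f ∂(base fs), f ≠ fs / 2 :=
      ae_restrict_of_ae (by simp [ae_iff])
    filter_upwards [ae_restrict_of_ae hpoint, hlt, ae_restrict_mem measurableSet_Icc]
      with f hf hne hmem
    obtain ⟨h1, h2, h3⟩ := hV f hf
    refine ⟨h1, Matrix.mem_unitaryGroup_iff.mpr (hUu f), h2, ?_⟩
    rw [← h3]
    have h5 : stacked Υ fs Cx (fun g => F (reduce fs g) * Γ g) f = F (reduce fs f) * A f := by
      simp only [stacked_eq, hAdef, Matrix.mul_assoc]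
      rw [stack_mul_left (G := fun g => F (reduce fs g))]
      intro k _
      simp only [shiftBand_eq, reduce_add hfs]
    rw [h5, reduce_eq hfs ⟨hmem.1, lt_of_le_of_ne hmem.2 hne⟩]

end

end

end TaskADC

/-! ### Lower bounds for arbitrary acquisition systems and the final assembly -/

namespace TaskADC
noncomputable section

/-- The bound for FIR filters survives the mean-square limit that defines a digital output. The task
version follows by adding the irreducible error of the analog estimate. -/
theorem IsAcquisition.lowerBounds {Ω : Type*} [MeasurableSpace Ω] {P : Measure Ω}
    [IsProbabilityMeasure P] {M N K : ℕ} {x : Proc ℝ Ω M} {Cx : ℝ → Matrix (Fin M) (Fin M) ℂ}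
    {s : Ω → Fin N → ℝ} {Γ : ℝ → Matrix (Fin N) (Fin M) ℂ} {fs η : ℝ} {b Υ : ℕ}
    {H : ℝ → Matrix (Fin K) (Fin M) ℂ} {y : Proc ℤ Ω K} {γ : ℝ} {w z : Proc ℤ Ω K}
    (h : IsAcquisition P x Cx s fs b η H y γ w z) (hm : IsSignalModel P x Cx s Γ) (hfs : 0 < fs)
    (hband : ∀ f : ℝ, ((Υ : ℝ) + 1 / 2) * fs < |f| → Cx f = 0) (hK : 0 < K) (hη : 0 < η)
    (hηb : 2 * η ^ 2 < 3 * 2 ^ (2 * b)) {ζ : ℝ}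
    (hζ : IsWaterLevel K fs b η (stacked Υ fs Cx Γ) ζ) :
    optimalDistortion K fs b (stacked Υ fs Cx Γ) ζ (mse P (mmseEst P x s) 0)
        ∈ lowerBounds (digitalMSEs P z (mmseEst P x s)) ∧
      mse P s (mmseEst P x s)
          + optimalDistortion K fs b (stacked Υ fs Cx Γ) ζ (mse P (mmseEst P x s) 0)
        ∈ lowerBounds (digitalMSEs P z s) := by
  have key : ∀ {G r}, IsDigitalOutput P z G r →
      optimalDistortion K fs b (stacked Υ fs Cx Γ) ζ (mse P (mmseEst P x s) 0)
        ≤ mse P (mmseEst P x s) r := fun hr =>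
    hr.le_mse (h.memLp_out hm) hm.linear_mmse.1
      fun c => h.optimalDistortion_le hm hfs hband hK hη hηb hζ c
  constructor
  · rintro _ ⟨G, r, hr, rfl⟩
    exact key hr
  · rintro _ ⟨G, r, hr, rfl⟩
    rw [h.mse_task hm hr]
    exact add_le_add_right (key hr) _

end

end TaskADC

theorem theorem1 {Ω : Type*} [MeasurableSpace Ω] (P : Measure Ω) [IsProbabilityMeasure P]
    {M N : ℕ} (K : ℕ) (hK : 0 < K) (b : ℕ) (Υ : ℕ) (fs η : ℝ) (hfs : 0 < fs) (hη : 0 < η)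
    (hηb : 2 * η ^ 2 < 3 * 2 ^ (2 * b))
    (x : TaskADC.Proc ℝ Ω M) (Cx : ℝ → Matrix (Fin M) (Fin M) ℂ)
    (s : Ω → Fin N → ℝ) (Γ : ℝ → Matrix (Fin N) (Fin M) ℂ)
    (hmodel : TaskADC.IsSignalModel P x Cx s Γ)
    (hband : ∀ f : ℝ, ((Υ : ℝ) + 1 / 2) * fs < |f| → Cx f = 0)
    (hdither : ∀ Δ : ℝ, 0 < Δ → ∃ w : TaskADC.Proc ℤ Ω K, TaskADC.IsDither P x s Δ w)
    (hne : 0 < TaskADC.mse P (TaskADC.mmseEst P x s) 0) :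
    (∃! ζ : ℝ, TaskADC.IsWaterLevel K fs b η (TaskADC.stacked Υ fs Cx Γ) ζ) ∧
    ∀ ζ : ℝ, TaskADC.IsWaterLevel K fs b η (TaskADC.stacked Υ fs Cx Γ) ζ →
      -- a filter of the stated form exists
      (∃ (Ho : ℝ → Matrix (Fin K) (Fin M) ℂ) (U : ℝ → Matrix (Fin K) (Fin K) ℂ)
          (V : ℝ → Matrix (Fin ((2 * Υ + 1) * M)) (Fin ((2 * Υ + 1) * M)) ℂ),
        TaskADC.IsFreqResponse Ho ∧
        TaskADC.HasWaterFillingForm fs b ζ (TaskADC.stacked Υ fs Cx Γ)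
          (TaskADC.stacked Υ fs Cx Ho) U V) ∧
      -- every filter of the stated form can be used and attains the closed-form value
      (∀ (Ho : ℝ → Matrix (Fin K) (Fin M) ℂ) (U : ℝ → Matrix (Fin K) (Fin K) ℂ)
          (V : ℝ → Matrix (Fin ((2 * Υ + 1) * M)) (Fin ((2 * Υ + 1) * M)) ℂ),
        TaskADC.IsFreqResponse Ho →
        TaskADC.HasWaterFillingForm fs b ζ (TaskADC.stacked Υ fs Cx Γ)
          (TaskADC.stacked Υ fs Cx Ho) U V →
        (∃ y γ w z, TaskADC.IsAcquisition P x Cx s fs b η Ho y γ w z) ∧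
        ∀ y γ w z, TaskADC.IsAcquisition P x Cx s fs b η Ho y γ w z →
          IsLeast (TaskADC.digitalMSEs P z (TaskADC.mmseEst P x s))
            (TaskADC.optimalDistortion K fs b (TaskADC.stacked Υ fs Cx Γ) ζ
              (TaskADC.mse P (TaskADC.mmseEst P x s) 0)) ∧
          IsLeast (TaskADC.digitalMSEs P z s) (TaskADC.mse P s (TaskADC.mmseEst P x s)
              + TaskADC.optimalDistortion K fs b (TaskADC.stacked Υ fs Cx Γ) ζ
              (TaskADC.mse P (TaskADC.mmseEst P x s) 0))) ∧
      -- no analog filter and no linear digital filter do better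
      (∀ (H : ℝ → Matrix (Fin K) (Fin M) ℂ) (y : TaskADC.Proc ℤ Ω K) (γ : ℝ)
          (w z : TaskADC.Proc ℤ Ω K),
        TaskADC.IsAcquisition P x Cx s fs b η H y γ w z →
          TaskADC.optimalDistortion K fs b (TaskADC.stacked Υ fs Cx Γ) ζ
              (TaskADC.mse P (TaskADC.mmseEst P x s) 0) ∈
            lowerBounds (TaskADC.digitalMSEs P z (TaskADC.mmseEst P x s)) ∧
          TaskADC.mse P s (TaskADC.mmseEst P x s)
              + TaskADC.optimalDistortion K fs b (TaskADC.stacked Υ fs Cx Γ) ζ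
              (TaskADC.mse P (TaskADC.mmseEst P x s) 0) ∈ lowerBounds (TaskADC.digitalMSEs P z s)) := by
  refine ⟨TaskADC.existsUnique_isWaterLevel hK hfs hη hηb hmodel.entryMeas_stacked
    (hmodel.memLp_stacked hfs hband) (hmodel.mse_zero hfs hband ▸ hne), fun ζ hζ =>
    ⟨TaskADC.exists_waterFilling hmodel hfs hband hK ζ, fun Ho U V hHo h =>
      ⟨h.exists_acquisition hmodel hfs hband hζ hHo hK hη hηb hdither, fun y γ w z hacq => ?_⟩,
      fun H y γ w z hacq => hacq.lowerBounds hmodel hfs hband hK hη hηb hζ⟩⟩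
  obtain ⟨D, r, hr, hD⟩ := h.exists_digitalOutput hmodel hfs hband hζ hHo hK hη hηb hacq
  obtain ⟨h1, h2⟩ := hacq.lowerBounds hmodel hfs hband hK hη hηb hζ
  exact ⟨⟨⟨D, r, hr, hD.symm⟩, h1⟩, ⟨D, r, hr, by rw [hacq.mse_task hmodel hr, hD]⟩, h2⟩
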